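/- Two points of the Euclidean plane dominate each other if their distance is at most $2$. In the minimum partial dominating set problem (PDS) the input consists of a finite set $P\subset\mathbb{R}^2$ and a subset $P'\subseteq P$, and one seeks a smallest set $D\subseteq P$ such that every point of $P'$ is dominated by some point of $D$. The unit disk graph of $P$ has vertex set $P$, and two distinct points are adjacent if their distance is at most $2$; a dominating set of a graph is a set $D$ of vertices such that every vertex outside $D$ is adjacent to a vertex in $D$. An $\alpha$-approximation is a feasible solution whose cardinality is at most $\alpha$ times that of every feasible solution. The model of computation is the real RAM: registers and arrays of integers and of real numbers, with array access, the integer operations $+,-,\times$, the real operations $+,-,\times,/$, comparisons, rational constants and conversion of integers to reals, each at unit cost. The real RAM with floor and constant-time hashing has, in addition, the unit-cost operation $x\mapsto\lfloor x\rfloor$ from reals to integers and hash tables, keyed by pairs of integers, with unit-cost reading and writing. Point sets are given and returned as lists of coordinates, in arbitrary order and without repetition. **Theorem.** Let $\varepsilon>0$ be a constant. 1. There is an algorithm on the real RAM with floor and constant-time hashing that, for all finite $P\subset\mathbb{R}^2$ and $P'\subseteq P$ with $|P|=n$, computes a $(4+\varepsilon)$-approximation for the PDS on $(P,P')$ in $O(n)$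 time. 2. There is an algorithm on the real RAM without floor and hashing that does the same in $O(n\log n)$ time. 3. Consequently, for every finite $P\subset\mathbb{R}^2$ with $|P|=n$, given by its coordinates, a $(4+\varepsilon)$-approximation of the minimum dominating set of the unit disk graph of $P$ can be computed in $O(n)$ time on the real RAM with floor and constant-time hashing, and in $O(n\log n)$ time on the real RAM without them. The algorithms and the constants in the time bounds may depend on $\varepsilon$. -/

import Mathlib

/-! ### The real RAM

A uniform real RAM, presented as a structured imperative language with a step count.  There are
registers and arrays of integers and of reals.  An array occupies as many memory cells as have
been appended to it, so addresses never exceed the number of steps plus the input size, and plain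
indirect addressing is not a disguised form of hashing.  Integers can be converted to reals, but
reals can be converted to integers only by the floor instruction.  Constants in a program are
rational. -/

namespace RealRAM

/-- Memory contents.  `hash h` is the `h`-th hash table, keyed by pairs of integers; absent keys
have the value `0`. -/
structure State where
  intReg : ℕ → ℤ
  realReg : ℕ → ℝ
  intArr : ℕ → List ℤ
  realArr : ℕ → List ℝ
  hash : ℕ → ℤ × ℤ → ℤ

/-- Array read; reading outside the array gives `0`. -/
def readAt {α : Type} [Zero α] (l : List α) (i : ℤ) : α :=
  if 0 ≤ i then l.getD i.toNat 0 else 0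

/-- Array write; writing outside the array has no effect. -/
def writeAt {α : Type} (l : List α) (i : ℤ) (v : α) : List α :=
  if 0 ≤ i then l.set i.toNat v else l

/-- Integer expressions. -/
inductive IExpr where
  | const (z : ℤ)
  | reg (x : ℕ)
  | get (a : ℕ) (i : IExpr)
  | lenInt (a : ℕ)
  | lenReal (a : ℕ)
  | add (e f : IExpr)
  | sub (e f : IExpr)
  | mul (e f : IExpr)

/-- Real expressions. -/
inductive RExpr where
  | const (q : ℚ)
  | reg (x : ℕ)
  | get (a : ℕ) (i : IExpr)
  | ofInt (i : IExpr)
  | add (e f : RExpr)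
  | sub (e f : RExpr)
  | mul (e f : RExpr)
  | div (e f : RExpr)

/-- Tests. -/
inductive BExpr where
  | ltInt (e f : IExpr)
  | leInt (e f : IExpr)
  | ltReal (e f : RExpr)
  | leReal (e f : RExpr)
  | not (b : BExpr)
  | and (b c : BExpr)

namespace IExpr

/-- Value of an integer expression. -/
def eval (s : State) : IExpr → ℤ
  | const z => z
  | reg x => s.intReg x
  | get a i => readAt (s.intArr a) (i.eval s)
  | lenInt a => (s.intArr a).length
  | lenReal a => (s.realArr a).length
  | add e f => e.eval s + f.eval s
  | sub e f => e.eval s - f.eval s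
  | mul e f => e.eval s * f.eval s

/-- Number of elementary operations needed to evaluate an integer expression. -/
def cost : IExpr → ℕ
  | const _ => 1
  | reg _ => 1
  | get _ i => i.cost + 1
  | lenInt _ => 1
  | lenReal _ => 1
  | add e f => e.cost + f.cost + 1
  | sub e f => e.cost + f.cost + 1
  | mul e f => e.cost + f.cost + 1

end IExpr

namespace RExpr

/-- Value of a real expression (a division by zero gives `0`). -/
noncomputable def eval (s : State) : RExpr → ℝ
  | const q => (q : ℝ)
  | reg x => s.realReg x
  | get a i => readAt (s.realArr a) (i.eval s)
  | ofInt i => ((i.eval s : ℤ) : ℝ)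
  | add e f => e.eval s + f.eval s
  | sub e f => e.eval s - f.eval s
  | mul e f => e.eval s * f.eval s
  | div e f => e.eval s / f.eval s

/-- Number of elementary operations needed to evaluate a real expression. -/
def cost : RExpr → ℕ
  | const _ => 1
  | reg _ => 1
  | get _ i => i.cost + 1
  | ofInt i => i.cost + 1
  | add e f => e.cost + f.cost + 1
  | sub e f => e.cost + f.cost + 1
  | mul e f => e.cost + f.cost + 1
  | div e f => e.cost + f.cost + 1

end RExpr

namespace BExpr

/-- Truth of a test. -/
def Holds (s : State) : BExpr → Prop
  | ltInt e f => e.eval s < f.eval s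
  | leInt e f => e.eval s ≤ f.eval s
  | ltReal e f => e.eval s < f.eval s
  | leReal e f => e.eval s ≤ f.eval s
  | not b => ¬ b.Holds s
  | and b c => b.Holds s ∧ c.Holds s

/-- Number of elementary operations needed to evaluate a test. -/
def cost : BExpr → ℕ
  | ltInt e f => e.cost + f.cost + 1
  | leInt e f => e.cost + f.cost + 1
  | ltReal e f => e.cost + f.cost + 1
  | leReal e f => e.cost + f.cost + 1
  | not b => b.cost + 1
  | and b c => b.cost + c.cost + 1

end BExpr

/-- Programs. -/
inductive Prog where
  | skip
  | setInt (x : ℕ) (e : IExpr)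
  | setReal (x : ℕ) (e : RExpr)
  | storeInt (a : ℕ) (i : IExpr) (e : IExpr)
  | storeReal (a : ℕ) (i : IExpr) (e : RExpr)
  | pushInt (a : ℕ) (e : IExpr)
  | pushReal (a : ℕ) (e : RExpr)
  | floor (x : ℕ) (e : RExpr)
  | hashGet (x : ℕ) (h : ℕ) (k l : IExpr)
  | hashSet (h : ℕ) (k l : IExpr) (e : IExpr)
  | seq (p q : Prog)
  | branch (b : BExpr) (p q : Prog)
  | loop (b : BExpr) (p : Prog)

/-- The program uses neither the floor function nor hashing. -/
def Prog.Basic : Prog → Prop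
  | floor _ _ => False
  | hashGet _ _ _ _ => False
  | hashSet _ _ _ _ => False
  | seq p q => p.Basic ∧ q.Basic
  | branch _ p q => p.Basic ∧ q.Basic
  | loop _ p => p.Basic
  | _ => True

/-- `Exec p s s' t`: started in the state `s`, the program `p` halts in the state `s'` after `t`
elementary operations. -/
inductive Exec : Prog → State → State → ℕ → Prop
  | skip (s : State) : Exec .skip s s 1
  | setInt (s : State) (x : ℕ) (e : IExpr) :
      Exec (.setInt x e) s { s with intReg := Function.update s.intReg x (e.eval s) } (e.cost + 1)
  | setReal (s : State) (x : ℕ) (e : RExpr) :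
      Exec (.setReal x e) s { s with realReg := Function.update s.realReg x (e.eval s) }
        (e.cost + 1)
  | storeInt (s : State) (a : ℕ) (i e : IExpr) :
      Exec (.storeInt a i e) s
        { s with intArr :=
          Function.update s.intArr a (writeAt (s.intArr a) (i.eval s) (e.eval s)) }
        (i.cost + e.cost + 1)
  | storeReal (s : State) (a : ℕ) (i : IExpr) (e : RExpr) :
      Exec (.storeReal a i e) s
        { s with realArr :=
          Function.update s.realArr a (writeAt (s.realArr a) (i.eval s) (e.eval s)) }
        (i.cost + e.cost + 1)
  | pushInt (s : State) (a : ℕ) (e : IExpr) :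
      Exec (.pushInt a e) s
        { s with intArr := Function.update s.intArr a (s.intArr a ++ [e.eval s]) } (e.cost + 1)
  | pushReal (s : State) (a : ℕ) (e : RExpr) :
      Exec (.pushReal a e) s
        { s with realArr := Function.update s.realArr a (s.realArr a ++ [e.eval s]) } (e.cost + 1)
  | floor (s : State) (x : ℕ) (e : RExpr) :
      Exec (.floor x e) s { s with intReg := Function.update s.intReg x ⌊e.eval s⌋ } (e.cost + 1)
  | hashGet (s : State) (x h : ℕ) (k l : IExpr) :
      Exec (.hashGet x h k l) s
        { s with intReg := Function.update s.intReg x (s.hash h (k.eval s, l.eval s)) }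
        (k.cost + l.cost + 1)
  | hashSet (s : State) (h : ℕ) (k l e : IExpr) :
      Exec (.hashSet h k l e) s
        { s with hash :=
          Function.update s.hash h (Function.update (s.hash h) (k.eval s, l.eval s) (e.eval s)) }
        (k.cost + l.cost + e.cost + 1)
  | seq {p q : Prog} {s s' s'' : State} {t t' : ℕ} :
      Exec p s s' t → Exec q s' s'' t' → Exec (.seq p q) s s'' (t + t')
  | branchTrue {b : BExpr} {p : Prog} (q : Prog) {s s' : State} {t : ℕ} :
      b.Holds s → Exec p s s' t → Exec (.branch b p q) s s' (b.cost + 1 + t)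
  | branchFalse {b : BExpr} (p : Prog) {q : Prog} {s s' : State} {t : ℕ} :
      ¬ b.Holds s → Exec q s s' t → Exec (.branch b p q) s s' (b.cost + 1 + t)
  | loopFalse {b : BExpr} (p : Prog) {s : State} :
      ¬ b.Holds s → Exec (.loop b p) s s (b.cost + 1)
  | loopTrue {b : BExpr} {p : Prog} {s s' s'' : State} {t t' : ℕ} :
      b.Holds s → Exec p s s' t → Exec (.loop b p) s' s'' t' →
      Exec (.loop b p) s s'' (b.cost + 1 + t + t')

/-- The machine is deterministic: the final state and the number of steps are unique. -/
theorem Exec.unique {p : Prog} {s s₁ s₂ : State} {t₁ t₂ : ℕ} (h₁ : Exec p s s₁ t₁)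
    (h₂ : Exec p s s₂ t₂) : s₁ = s₂ ∧ t₁ = t₂ := by
  induction h₁ generalizing s₂ t₂ with
  | seq _ _ ih ih' =>
    cases h₂ with
    | seq a b =>
      obtain ⟨rfl, rfl⟩ := ih a
      obtain ⟨rfl, rfl⟩ := ih' b
      exact ⟨rfl, rfl⟩
  | branchTrue q hb _ ih =>
    cases h₂ with
    | branchTrue _ _ a =>
      obtain ⟨rfl, rfl⟩ := ih a
      exact ⟨rfl, rfl⟩
    | branchFalse _ hn _ => exact absurd hb hn
  | branchFalse p hb _ ih =>
    cases h₂ with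
    | branchFalse _ _ a =>
      obtain ⟨rfl, rfl⟩ := ih a
      exact ⟨rfl, rfl⟩
    | branchTrue _ hn _ => exact absurd hn hb
  | loopFalse p hb =>
    cases h₂ with
    | loopFalse => exact ⟨rfl, rfl⟩
    | loopTrue hn _ _ => exact absurd hn hb
  | loopTrue hb _ _ ih ih' =>
    cases h₂ with
    | loopFalse _ hn => exact absurd hb hn
    | loopTrue _ a b =>
      obtain ⟨rfl, rfl⟩ := ih a
      obtain ⟨rfl, rfl⟩ := ih' b
      exact ⟨rfl, rfl⟩
  | _ => cases h₂; exact ⟨rfl, rfl⟩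

/-- The initial memory: real array number `a` holds the `a`-th list of the input; everything
else is zero or empty. -/
def init (input : List (List ℝ)) : State where
  intReg := fun _ => 0
  realReg := fun _ => 0
  intArr := fun _ => []
  realArr := fun a => input.getD a []
  hash := fun _ _ => 0

end RealRAM

/-! ### Dominating sets of unit disk graphs -/

namespace UnitDisk

/-- The Euclidean plane. -/
abbrev Plane : Type := EuclideanSpace ℝ (Fin 2)

/-- The unit disk graph on a finite set of disk centers: two distinct centers are adjacent if
their distance is at most `2`. -/
def graph (P : Finset Plane) : SimpleGraph P where
  Adj p q := p ≠ q ∧ dist (p : Plane) (q : Plane) ≤ 2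
  symm := ⟨fun _ _ h => ⟨h.1.symm, by rw [dist_comm]; exact h.2⟩⟩
  loopless := ⟨fun _ h => h.1 rfl⟩

/-- A vertex set `D` is dominating if every vertex outside `D` has a neighbor in `D`. -/
def IsDominatingSet {V : Type} (G : SimpleGraph V) (D : Finset V) : Prop :=
  ∀ v, v ∉ D → ∃ u ∈ D, G.Adj v u

/-- `D` is a feasible solution of the partial dominating set problem `(P, P')`: a subset of `P`
that dominates every point of `P'`. -/
def IsPartialDominatingSet (P P' D : Finset Plane) : Prop :=
  D ⊆ P ∧ ∀ q ∈ P', ∃ p ∈ D, dist p q ≤ 2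

/-- `D` is feasible for `(P, P')` and at most `α` times as large as every feasible solution. -/
def IsPDSApprox (α : ℝ) (P P' D : Finset Plane) : Prop :=
  IsPartialDominatingSet P P' D ∧
    ∀ D' : Finset Plane, IsPartialDominatingSet P P' D' → (D.card : ℝ) ≤ α * (D'.card : ℝ)

/-- `D` is a dominating set of the unit disk graph of `P` that is at most `α` times as large as
every dominating set. -/
def IsDSApprox (α : ℝ) (P : Finset Plane) (D : Finset P) : Prop :=
  IsDominatingSet (graph P) D ∧
    ∀ D' : Finset P, IsDominatingSet (graph P) D' → (D.card : ℝ) ≤ α * (D'.card : ℝ)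

/-- `L` lists the points of `S`, in some order and without repetition. -/
def Lists (L : List Plane) (S : Finset Plane) : Prop :=
  L.Nodup ∧ ∀ p, p ∈ L ↔ p ∈ S

/-- The abscissas of a list of points. -/
def xs (L : List Plane) : List ℝ := L.map fun p => p 0

/-- The ordinates of a list of points. -/
def ys (L : List Plane) : List ℝ := L.map fun p => p 1

/-- The real arrays `4` and `5` hold the coordinates of the points of `D`. -/
def Outputs (s : RealRAM.State) (D : Finset Plane) : Prop :=
  ∃ L : List Plane, Lists L D ∧ s.realArr 4 = xs L ∧ s.realArr 5 = ys L

/-- The program `A` is an `α`-approximation algorithm for the partial dominating set problem which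
on every instance with `|P| = n` halts after at most `T n` steps.  The input arrays hold the
abscissas and ordinates of `P`, and those of `P'`, in an arbitrary order. -/
def ApproximatesPDS (A : RealRAM.Prog) (α : ℝ) (T : ℕ → ℕ) : Prop :=
  ∀ (P P' : Finset Plane), P' ⊆ P → ∀ (L L' : List Plane), Lists L P → Lists L' P' →
    ∃ (s : RealRAM.State) (t : ℕ),
      RealRAM.Exec A (RealRAM.init [xs L, ys L, xs L', ys L']) s t ∧ t ≤ T P.card ∧
      ∃ D : Finset Plane, Outputs s D ∧ IsPDSApprox α P P' D

/-- The program `A` is an `α`-approximation algorithm for the minimum dominating set problem on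
unit disk graphs which on every instance with `|P| = n` halts after at most `T n` steps.  The input
arrays hold the abscissas and ordinates of `P` in an arbitrary order. -/
def ApproximatesDS (A : RealRAM.Prog) (α : ℝ) (T : ℕ → ℕ) : Prop :=
  ∀ (P : Finset Plane) (L : List Plane), Lists L P →
    ∃ (s : RealRAM.State) (t : ℕ),
      RealRAM.Exec A (RealRAM.init [xs L, ys L]) s t ∧ t ≤ T P.card ∧
      ∃ D : Finset P, Outputs s (D.map (Function.Embedding.subtype _)) ∧ IsDSApprox α P D

/-- `T` is `O(n)`. -/
def IsLinear (T : ℕ → ℕ) : Prop :=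
  Asymptotics.IsBigO Filter.atTop (fun n => (T n : ℝ)) (fun n : ℕ => (n : ℝ))

/-- `T` is `O(n log n)`. -/
def IsLinearithmic (T : ℕ → ℕ) : Prop :=
  Asymptotics.IsBigO Filter.atTop (fun n => (T n : ℝ)) (fun n : ℕ => (n : ℝ) * Real.log n)

end UnitDisk

set_option linter.unusedSimpArgs false

/-! ### Program logic for the real RAM -/

namespace RealRAM

/-! The approximation combines a coreset inside grid cells with an averaging argument over shifted
grids.

Geometry. Let `p` be a point of `P`, and move the center of its disk of radius 2 by at most 1/100. A
point of the old disk that the moved disk misses lies near the old boundary and away from the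
direction of the displacement. If a second center is displaced in a roughly opposite direction, in
the sense that the unit displacements have inner product at most 1/20, then everything that both
moved disks miss lies in two caps (`exists_two_caps`, `exists_caps`). A cap is so narrow that a
point within 1/100 of any of its points in the disk dominates its whole intersection with the disk
(`cap_dist`, `cap_dominated`). It therefore suffices to keep, in each cell of a fine grid and for
each of 41 · 41 integer directions, one extreme point as a candidate. The disk of `p` is replaced by
four candidates: the one for direction zero from the fine cell of `p`, the one for a direction
opposite to the displacement of the first, and for each cap a candidate from the fine cell of some
point of `P'` in the cap. The last step uses `P' ⊆ P`. This is `CandSpec.replace`.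

Search. A coarse cell consists of `N × N` fine cells, and every point that can dominate something in
it lies in the cell enlarged by `R = 401` fine cells on each side. The number of candidates per
coarse cell is thus bounded by a constant, and trying all subsets finds a smallest selection. Its
size is at most four times the number of points of any given solution with a copy in the cell
(`exists_feas`).

Shifts. A point has copies at the four corners of a square of `2R` fine cells, so that each coarse
cell in which it might dominate something contains a copy. Of the `N` diagonal shifts of the coarse
grid, at most `2R` separate the corners horizontally and at most `2R` vertically
(`card_bad_shifts`). Summed over all shifts, a point touches at most `N + 12 R` cells, so the best
shift uses at most `4 (1 + 12 R / N)` times as many points as any solution (`card_best_le`). A large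
constant `N` makes this at most `4 + ε`.

Time. After the fine columns and rows and the numbers of the coarse cells are known, every stage is
a constant number of linear passes. With floor and hashing these numbers are computed in linear
time. Without them, merge sort and a greedy left-to-right scan produce columns and rows that are as
good as those of a true grid, a table replaces division by `N`, and sorting encoded key pairs
replaces the hash table.

The programs are verified with a small program logic: `Runs` for total correctness with a time
bound, `Agree` for what is left unchanged, and `Prog.WP` for loop-free code. -/

/-- The effect of a loop-free program, as a function on states. -/
noncomputable def Prog.run : Prog → State → State
  | .skip, s => s
  | .setInt x e, s => { s with intReg := Function.update s.intReg x (e.eval s) }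
  | .setReal x e, s => { s with realReg := Function.update s.realReg x (e.eval s) }
  | .storeInt a i e, s =>
      { s with intArr := Function.update s.intArr a (writeAt (s.intArr a) (i.eval s) (e.eval s)) }
  | .storeReal a i e, s =>
      { s with
        realArr := Function.update s.realArr a (writeAt (s.realArr a) (i.eval s) (e.eval s)) }
  | .pushInt a e, s =>
      { s with intArr := Function.update s.intArr a (s.intArr a ++ [e.eval s]) }
  | .pushReal a e, s =>
      { s with realArr := Function.update s.realArr a (s.realArr a ++ [e.eval s]) }
  | .floor x e, s => { s with intReg := Function.update s.intReg x ⌊e.eval s⌋ }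
  | .hashGet x h k l, s =>
      { s with intReg := Function.update s.intReg x (s.hash h (k.eval s, l.eval s)) }
  | .hashSet h k l e, s =>
      { s with hash :=
          Function.update s.hash h (Function.update (s.hash h) (k.eval s, l.eval s) (e.eval s)) }
  | .seq p q, s => q.run (p.run s)
  | .branch b p q, s => open Classical in if b.Holds s then p.run s else q.run s
  | .loop _ _, s => s

/-- The program contains no loop. -/
def Prog.LoopFree : Prog → Prop
  | .seq p q => p.LoopFree ∧ q.LoopFree
  | .branch _ p q => p.LoopFree ∧ q.LoopFree
  | .loop _ _ => False
  | _ => True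

theorem Prog.loopFree_seq {p q : Prog} :
    (Prog.seq p q).LoopFree ↔ p.LoopFree ∧ q.LoopFree := Iff.rfl

/-- An upper bound for the running time of a loop-free program. -/
def Prog.costBound : Prog → ℕ
  | .skip => 1
  | .setInt _ e => e.cost + 1
  | .setReal _ e => e.cost + 1
  | .storeInt _ i e => i.cost + e.cost + 1
  | .storeReal _ i e => i.cost + e.cost + 1
  | .pushInt _ e => e.cost + 1
  | .pushReal _ e => e.cost + 1
  | .floor _ e => e.cost + 1
  | .hashGet _ _ k l => k.cost + l.cost + 1
  | .hashSet _ k l e => k.cost + l.cost + e.cost + 1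
  | .seq p q => p.costBound + q.costBound
  | .branch b p q => b.cost + 1 + (p.costBound + q.costBound)
  | .loop _ _ => 0

/-- Charging both branches of every test overestimates the cost of the branch taken. The values of
`run` and `costBound` on loops are irrelevant, since `LoopFree` excludes them. -/
theorem Prog.LoopFree.exec {p : Prog} (hp : p.LoopFree) (s : State) :
    ∃ t, Exec p s (p.run s) t ∧ t ≤ p.costBound := by
  induction p generalizing s with
  | skip => exact ⟨_, .skip s, le_rfl⟩
  | setInt x e => exact ⟨_, .setInt s x e, le_rfl⟩
  | setReal x e => exact ⟨_, .setReal s x e, le_rfl⟩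
  | storeInt a i e => exact ⟨_, .storeInt s a i e, le_rfl⟩
  | storeReal a i e => exact ⟨_, .storeReal s a i e, le_rfl⟩
  | pushInt a e => exact ⟨_, .pushInt s a e, le_rfl⟩
  | pushReal a e => exact ⟨_, .pushReal s a e, le_rfl⟩
  | floor x e => exact ⟨_, .floor s x e, le_rfl⟩
  | hashGet x h k l => exact ⟨_, .hashGet s x h k l, le_rfl⟩
  | hashSet h k l e => exact ⟨_, .hashSet s h k l e, le_rfl⟩
  | seq p q ihp ihq =>
    obtain ⟨t, h, ht⟩ := ihp hp.1 s
    obtain ⟨t', h', ht'⟩ := ihq hp.2 (p.run s)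
    exact ⟨_, .seq h h', add_le_add ht ht'⟩
  | branch b p q ihp ihq =>
    by_cases hb : b.Holds s
    · obtain ⟨t, h, ht⟩ := ihp hp.1 s
      refine ⟨_, by simpa only [Prog.run, if_pos hb] using Exec.branchTrue q hb h, ?_⟩
      simp only [Prog.costBound]; omega
    · obtain ⟨t, h, ht⟩ := ihq hp.2 s
      refine ⟨_, by simpa only [Prog.run, if_neg hb] using Exec.branchFalse p hb h, ?_⟩
      simp only [Prog.costBound]; omega
  | loop b p _ => exact hp.elim

/-! ### Frame conditions: what a program leaves unchanged -/

/-- The memory locations of the machine: registers, whole arrays and hash tables. -/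
inductive Loc where
  | ireg (x : ℕ)
  | rreg (x : ℕ)
  | iarr (a : ℕ)
  | rarr (a : ℕ)
  | table (h : ℕ)

/-- The locations that a program may modify. -/
def Prog.Mod : Prog → Loc → Prop
  | .skip, _ => False
  | .setInt x _, l => l = .ireg x
  | .setReal x _, l => l = .rreg x
  | .storeInt a _ _, l => l = .iarr a
  | .storeReal a _ _, l => l = .rarr a
  | .pushInt a _, l => l = .iarr a
  | .pushReal a _, l => l = .rarr a
  | .floor x _, l => l = .ireg x
  | .hashGet x _ _ _, l => l = .ireg x
  | .hashSet h _ _ _, l => l = .table h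
  | .seq p q, l => p.Mod l ∨ q.Mod l
  | .branch _ p q, l => p.Mod l ∨ q.Mod l
  | .loop _ p, l => p.Mod l

/-- The states agree outside the locations in `M`. -/
structure Agree (M : Loc → Prop) (s s' : State) : Prop where
  ireg : ∀ x, ¬ M (.ireg x) → s'.intReg x = s.intReg x
  rreg : ∀ x, ¬ M (.rreg x) → s'.realReg x = s.realReg x
  iarr : ∀ x, ¬ M (.iarr x) → s'.intArr x = s.intArr x
  rarr : ∀ x, ¬ M (.rarr x) → s'.realArr x = s.realArr x
  table : ∀ x, ¬ M (.table x) → s'.hash x = s.hash x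

theorem Agree.refl (M : Loc → Prop) (s : State) : Agree M s s :=
  ⟨fun _ _ => rfl, fun _ _ => rfl, fun _ _ => rfl, fun _ _ => rfl, fun _ _ => rfl⟩

theorem Agree.trans {M : Loc → Prop} {s s' s'' : State} (h : Agree M s s') (h' : Agree M s' s'') :
    Agree M s s'' :=
  ⟨fun x hx => (h'.ireg x hx).trans (h.ireg x hx), fun x hx => (h'.rreg x hx).trans (h.rreg x hx),
    fun x hx => (h'.iarr x hx).trans (h.iarr x hx), fun x hx => (h'.rarr x hx).trans (h.rarr x hx),
    fun x hx => (h'.table x hx).trans (h.table x hx)⟩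

theorem Agree.mono {M M' : Loc → Prop} {s s' : State} (h : Agree M s s') (hM : ∀ l, M l → M' l) :
    Agree M' s s' :=
  ⟨fun x hx => h.ireg x fun h => hx (hM _ h), fun x hx => h.rreg x fun h => hx (hM _ h),
    fun x hx => h.iarr x fun h => hx (hM _ h), fun x hx => h.rarr x fun h => hx (hM _ h),
    fun x hx => h.table x fun h => hx (hM _ h)⟩

/-- This is the frame rule: the set of written locations is read off from the syntax, so an
invariant need not mention anything that the program at hand cannot write. A loop and its body have
the same set, so the rounds compose by transitivity. -/
theorem Exec.agree {p : Prog} {s s' : State} {t : ℕ} (h : Exec p s s' t) : Agree p.Mod s s' := by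
  induction h with
  | skip s => exact .refl _ _
  | seq _ _ ih ih' => exact (ih.mono fun _ => Or.inl).trans (ih'.mono fun _ => Or.inr)
  | branchTrue q _ _ ih => exact ih.mono fun _ => Or.inl
  | branchFalse p _ _ ih => exact ih.mono fun _ => Or.inr
  | loopFalse p _ => exact .refl _ _
  | loopTrue _ _ _ ih ih' => exact Agree.trans (M := Prog.Mod _) ih ih'
  | _ =>
    refine ⟨fun x hx => ?_, fun x hx => ?_, fun x hx => ?_, fun x hx => ?_, fun x hx => ?_⟩ <;>
    first
    | rfl
    | exact Function.update_of_ne (fun h => hx (by rw [h]; rfl)) _ _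

/-! ### Total correctness with time bounds -/

/-- Started in `s`, the program `p` halts within `T` steps in a state with property `Q`. -/
def Runs (p : Prog) (s : State) (T : ℕ) (Q : State → Prop) : Prop :=
  ∃ s' t, Exec p s s' t ∧ t ≤ T ∧ Q s'

/-- The consequence rule hands the frame condition to the new postcondition, which is how facts
about untouched memory pass from one stage to the next. -/
theorem Runs.mono {p : Prog} {s : State} {T T' : ℕ} {Q Q' : State → Prop} (h : Runs p s T Q)
    (hT : T ≤ T') (hQ : ∀ s', Agree p.Mod s s' → Q s' → Q' s') : Runs p s T' Q' := by
  obtain ⟨s', t, h, ht, hq⟩ := h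
  exact ⟨s', t, h, ht.trans hT, hQ s' h.agree hq⟩

/-- The postcondition of the first program is the correctness of the second, so no intermediate
assertion has to be named. -/
theorem Runs.seq {p q : Prog} {s : State} {T T' : ℕ} {Q : State → Prop}
    (h : Runs p s T fun s' => Runs q s' T' Q) : Runs (.seq p q) s (T + T') Q := by
  obtain ⟨s', t, h, ht, s'', t', h', ht', hq⟩ := h
  exact ⟨s'', t + t', .seq h h', add_le_add ht ht', hq⟩

theorem Prog.LoopFree.runs {p : Prog} (hp : p.LoopFree) {s : State} {Q : State → Prop}
    (h : Q (p.run s)) : Runs p s p.costBound Q := by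
  obtain ⟨t, ht, hc⟩ := hp.exec s
  exact ⟨_, t, ht, hc, h⟩

/-- Sequential composition of a list of programs. -/
def seqList : List Prog → Prog
  | [] => .skip
  | p :: l => .seq p (seqList l)

theorem seqList_loopFree {l : List Prog} : (seqList l).LoopFree ↔ ∀ p ∈ l, p.LoopFree := by
  induction l with
  | nil => simp [seqList, Prog.LoopFree]
  | cons p l ih => simp [seqList, Prog.LoopFree, ih]

theorem seqList_basic {l : List Prog} : (seqList l).Basic ↔ ∀ p ∈ l, p.Basic := by
  induction l with
  | nil => simp [seqList, Prog.Basic]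
  | cons p l ih => simp [seqList, Prog.Basic, ih]

theorem seqList_mod {l : List Prog} {x : Loc} : (seqList l).Mod x ↔ ∃ p ∈ l, p.Mod x := by
  induction l with
  | nil => simp [seqList, Prog.Mod]
  | cons p l ih => simp [seqList, Prog.Mod, ih]

/-- The invariant is indexed by the prefix already executed; the induction is on the remaining
suffix. -/
theorem run_seqList {α : Type*} (f : α → Prog) (I : List α → State → Prop) {l : List α} {s : State}
    (h0 : I [] s)
    (hstep : ∀ pre a post, l = pre ++ a :: post → ∀ s, I pre s → I (pre ++ [a]) ((f a).run s)) :
    I l ((seqList (l.map f)).run s) := by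
  suffices H : ∀ post pre s, l = pre ++ post → I pre s → I l ((seqList (post.map f)).run s) from
    H l [] s rfl h0
  intro post
  induction post with
  | nil => intro pre s h hI; simpa [seqList, Prog.run, h] using hI
  | cons a post ih =>
    intro pre s h hI
    exact ih (pre ++ [a]) _ (by simp [h]) (hstep pre a post h s hI)

/-- `run_seqList` for an unrolled loop over `0, …, n - 1`. -/
theorem run_seqList_range (f : ℕ → Prog) (I : ℕ → State → Prop) {n : ℕ} {s : State}
    (h0 : I 0 s) (hstep : ∀ i < n, ∀ s, I i s → I (i + 1) ((f i).run s)) :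
    I n ((seqList ((List.range n).map f)).run s) := by
  have := run_seqList f (fun l s => I l.length s) (l := List.range n) (s := s) h0 ?_
  · simpa using this
  · intro pre a post h s hI
    have ha : a = pre.length := by
      have h1 : (List.range n)[pre.length]? = some a := by rw [h]; simp
      rw [List.getElem?_eq_some_iff] at h1
      obtain ⟨h1, h2⟩ := h1
      simpa using h2.symm
    have hn : pre.length < n := by
      have := congrArg List.length h
      simp at this; omega
    subst ha
    simpa using hstep _ hn s hI

theorem Runs.seqList {α : Type*} (f : α → Prog) (I : List α → State → Prop) {l : List α}
    {s : State} {c : ℕ} (h0 : I [] s)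
    (hstep : ∀ pre a post, l = pre ++ a :: post → ∀ s', Agree (seqList (l.map f)).Mod s s' →
      I pre s' → Runs (f a) s' c (I (pre ++ [a]))) :
    Runs (seqList (l.map f)) s (l.length * c + 1) (I l) := by
  suffices H : ∀ post pre s', l = pre ++ post → Agree (RealRAM.seqList (l.map f)).Mod s s' →
      I pre s' → Runs (RealRAM.seqList (post.map f)) s' (post.length * c + 1) (I l) from
    H l [] s rfl (.refl _ _) h0
  intro post
  induction post with
  | nil =>
    intro pre s' h _ hI
    exact ⟨s', 1, .skip s', by simp, by simpa [h] using hI⟩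
  | cons a post ih =>
    intro pre s' h hA hI
    have := (hstep pre a post h s' hA hI).mono le_rfl (fun s'' hA' hI' =>
      ih (pre ++ [a]) s'' (by simp [h])
        (hA.trans (hA'.mono fun x hx => seqList_mod.2 ⟨f a, by simp [h], hx⟩)) hI')
    refine Runs.mono (Runs.seq this) ?_ (fun _ _ h => h)
    simp only [List.length_cons]; ring_nf; omega

/-- `Runs.seqList` for an unrolled loop over `0, …, n - 1`. -/
theorem Runs.seqList_range (f : ℕ → Prog) (I : ℕ → State → Prop) {n c : ℕ} {s : State}
    (h0 : I 0 s)
    (hstep : ∀ i < n, ∀ s', Agree (RealRAM.seqList ((List.range n).map f)).Mod s s' → I i s' →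
      Runs (f i) s' c (I (i + 1))) :
    Runs (RealRAM.seqList ((List.range n).map f)) s (n * c + 1) (I n) := by
  have := Runs.seqList f (fun l s => I l.length s) (l := List.range n) (s := s) (c := c) h0 ?_
  · simpa using this
  · intro pre a post h s₁ hA hI
    have ha : a = pre.length := by
      have h1 : (List.range n)[pre.length]? = some a := by rw [h]; simp
      rw [List.getElem?_eq_some_iff] at h1
      obtain ⟨h1, h2⟩ := h1
      simpa using h2.symm
    have hn : pre.length < n := by
      have := congrArg List.length h
      simp at this; omega
    subst ha
    simpa using hstep _ hn s₁ hA hI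

/-- Counting loop: run `body` with register `x` set to `0, 1, …` as long as it is below `b`. -/
def forLoop (x : ℕ) (b : IExpr) (body : Prog) : Prog :=
  .seq (.setInt x (.const 0))
    (.loop (.ltInt (.reg x) b) (.seq body (.setInt x (.add (.reg x) (.const 1)))))

/-- The state with a new value in an integer register. -/
def State.setReg (s : State) (x : ℕ) (v : ℤ) : State :=
  { s with intReg := Function.update s.intReg x v }

@[simp] theorem State.setReg_intReg (s : State) (x : ℕ) (v : ℤ) :
    (s.setReg x v).intReg = Function.update s.intReg x v := rfl
@[simp] theorem State.setReg_realReg (s : State) (x : ℕ) (v : ℤ) :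
    (s.setReg x v).realReg = s.realReg := rfl
@[simp] theorem State.setReg_intArr (s : State) (x : ℕ) (v : ℤ) :
    (s.setReg x v).intArr = s.intArr := rfl
@[simp] theorem State.setReg_realArr (s : State) (x : ℕ) (v : ℤ) :
    (s.setReg x v).realArr = s.realArr := rfl
@[simp] theorem State.setReg_hash (s : State) (x : ℕ) (v : ℤ) :
    (s.setReg x v).hash = s.hash := rfl

/-- The summand `c + b.cost + 8` pays for test, body and increment of one round; the extra round
pays for the initialization and the final failing test. The bound `b` is reevaluated each time, so
the invariant must force its value to remain `n`. The invariant is required after the counter is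
advanced, because it may mention other registers of the same state. -/
theorem Runs.forLoop {x : ℕ} {b : IExpr} {body : Prog} {s : State} (n c : ℕ)
    (I : ℕ → State → Prop) (h0 : I 0 (s.setReg x 0)) (hx : ¬ body.Mod (.ireg x))
    (hb : ∀ i ≤ n, ∀ s', Agree (forLoop x b body).Mod s s' → I i s' → b.eval s' = n)
    (hstep : ∀ i < n, ∀ s', Agree (forLoop x b body).Mod s s' → s'.intReg x = i → I i s' →
      Runs body s' c fun s'' => I (i + 1) (s''.setReg x (i + 1))) :
    Runs (forLoop x b body) s ((n + 1) * (c + b.cost + 8)) (fun s' => I n s') := by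
  -- Induction on the number `k` of rounds still to be made.
  have H : ∀ k i s', i + k = n → Agree (RealRAM.forLoop x b body).Mod s s' → s'.intReg x = i →
      I i s' → Runs (.loop (.ltInt (.reg x) b) (.seq body (.setInt x (.add (.reg x) (.const 1)))))
        s' (k * (c + b.cost + 8) + (b.cost + 4)) (fun s' => I n s') := by
    intro k
    induction k with
    | zero =>
      intro i s' hi hA hx' hI
      have hin : i = n := by omega
      refine ⟨s', _, .loopFalse _ ?_, ?_, hin ▸ hI⟩
      · simp only [BExpr.Holds, IExpr.eval, hx', hb i (by omega) s' hA hI]; omega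
      · simp [BExpr.cost, IExpr.cost]; omega
    | succ k ih =>
      intro i s' hi hA hx' hI
      obtain ⟨s'', t, hE, ht, hI''⟩ := hstep i (by omega) s' hA hx' hI
      have hx'' : s''.intReg x = i := by rw [hE.agree.ireg x hx, hx']
      have hE2 := Exec.setInt s'' x (.add (.reg x) (.const 1))
      have hv : IExpr.eval s'' (.add (.reg x) (.const 1)) = i + 1 := by simp [IExpr.eval, hx'']
      rw [hv] at hE2
      change Exec _ s'' (s''.setReg x (i + 1)) _ at hE2
      have hE3 := Exec.seq hE hE2
      obtain ⟨s₃, t', hL, ht', hQ⟩ := ih (i + 1) _ (by omega)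
        (hA.trans (hE3.agree.mono fun l hl => Or.inr hl)) (by simp) hI''
      refine ⟨s₃, _, .loopTrue ?_ hE3 hL, ?_, hQ⟩
      · simp only [BExpr.Holds, IExpr.eval, hx', hb i (by omega) s' hA hI]; omega
      · simp only [BExpr.cost, IExpr.cost] at *
        ring_nf at ht' ⊢; omega
  have h1 : Runs (.setInt x (.const 0)) s 2 (fun s' => s' = s.setReg x 0) :=
    ⟨_, _, .setInt s x _, by simp [IExpr.cost], rfl⟩
  refine Runs.mono (Runs.seq (h1.mono le_rfl fun s' hA hs' =>
    H n 0 s' (by omega) ?_ (by simp [hs']) (hs' ▸ h0))) ?_ (fun _ _ h => h)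
  · exact hA.mono fun l hl => Or.inl hl
  · ring_nf; omega

theorem forLoop_mod {x : ℕ} {b : IExpr} {body : Prog} {l : Loc} :
    (forLoop x b body).Mod l ↔ l = .ireg x ∨ body.Mod l := by
  simp only [forLoop, Prog.Mod]; tauto

theorem forLoop_basic {x : ℕ} {b : IExpr} {body : Prog} :
    (forLoop x b body).Basic ↔ body.Basic := by
  simp [forLoop, Prog.Basic]

/-- A loop with a variant: the invariant `I i` holds after `i` rounds, and `I n` ends the loop. -/
theorem Runs.while {b : BExpr} {body : Prog} {s : State} (n c : ℕ) (I : ℕ → State → Prop)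
    (h0 : I 0 s)
    (hend : ∀ s', I n s' → ¬ b.Holds s')
    (hstep : ∀ i < n, ∀ s', Agree body.Mod s s' → I i s' → b.Holds s' → Runs body s' c (I (i + 1))) :
    Runs (.loop b body) s ((n + 1) * (c + b.cost + 1)) (fun s' => ¬ b.Holds s' ∧ ∃ i ≤ n, I i s') := by
  have H : ∀ k i s', i + k = n → Agree body.Mod s s' → I i s' →
      Runs (.loop b body) s' ((k + 1) * (c + b.cost + 1))
        (fun s' => ¬ b.Holds s' ∧ ∃ i ≤ n, I i s') := by
    intro k
    induction k with
    | zero =>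
      intro i s' hi hA hI
      have hin : i = n := by omega
      subst hin
      exact ⟨s', _, .loopFalse _ (hend s' hI), by omega, hend s' hI, i, le_rfl, hI⟩
    | succ k ih =>
      intro i s' hi hA hI
      by_cases hb : b.Holds s'
      · obtain ⟨s'', t, hE, ht, hI''⟩ := hstep i (by omega) s' hA hI hb
        obtain ⟨s₃, t', hL, ht', hQ⟩ := ih (i + 1) s'' (by omega) (hA.trans hE.agree) hI''
        refine ⟨s₃, _, .loopTrue hb hE hL, ?_, hQ⟩
        have e : (k + 1 + 1) * (c + b.cost + 1) = (k + 1) * (c + b.cost + 1) + (c + b.cost + 1) := by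
          ring
        omega
      · refine ⟨s', _, .loopFalse _ hb, ?_, hb, i, by omega, hI⟩
        have e : (k + 1 + 1) * (c + b.cost + 1) = (k + 1) * (c + b.cost + 1) + (c + b.cost + 1) := by
          ring
        omega
  exact H n 0 s (by omega) (.refl _ _) h0

/-! ### Symbolic execution of loop-free programs -/

/-- The state with a new value in a real register. -/
def State.setRReg (s : State) (x : ℕ) (v : ℝ) : State :=
  { s with realReg := Function.update s.realReg x v }

/-- The state with a new integer array. -/
def State.setIArr (s : State) (a : ℕ) (l : List ℤ) : State :=
  { s with intArr := Function.update s.intArr a l }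

/-- The state with a new real array. -/
def State.setRArr (s : State) (a : ℕ) (l : List ℝ) : State :=
  { s with realArr := Function.update s.realArr a l }

/-- The state with a new hash table. -/
def State.setHash (s : State) (h : ℕ) (f : ℤ × ℤ → ℤ) : State :=
  { s with hash := Function.update s.hash h f }

@[simp] theorem State.setRReg_intReg (s : State) (x : ℕ) (v : ℝ) :
    (s.setRReg x v).intReg = s.intReg := rfl
@[simp] theorem State.setRReg_realReg (s : State) (x : ℕ) (v : ℝ) :
    (s.setRReg x v).realReg = Function.update s.realReg x v := rfl
@[simp] theorem State.setRReg_intArr (s : State) (x : ℕ) (v : ℝ) :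
    (s.setRReg x v).intArr = s.intArr := rfl
@[simp] theorem State.setRReg_realArr (s : State) (x : ℕ) (v : ℝ) :
    (s.setRReg x v).realArr = s.realArr := rfl
@[simp] theorem State.setRReg_hash (s : State) (x : ℕ) (v : ℝ) :
    (s.setRReg x v).hash = s.hash := rfl
@[simp] theorem State.setIArr_intReg (s : State) (x : ℕ) (v : List ℤ) :
    (s.setIArr x v).intReg = s.intReg := rfl
@[simp] theorem State.setIArr_realReg (s : State) (x : ℕ) (v : List ℤ) :
    (s.setIArr x v).realReg = s.realReg := rfl
@[simp] theorem State.setIArr_intArr (s : State) (x : ℕ) (v : List ℤ) :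
    (s.setIArr x v).intArr = Function.update s.intArr x v := rfl
@[simp] theorem State.setIArr_realArr (s : State) (x : ℕ) (v : List ℤ) :
    (s.setIArr x v).realArr = s.realArr := rfl
@[simp] theorem State.setIArr_hash (s : State) (x : ℕ) (v : List ℤ) :
    (s.setIArr x v).hash = s.hash := rfl
@[simp] theorem State.setRArr_intReg (s : State) (x : ℕ) (v : List ℝ) :
    (s.setRArr x v).intReg = s.intReg := rfl
@[simp] theorem State.setRArr_realReg (s : State) (x : ℕ) (v : List ℝ) :
    (s.setRArr x v).realReg = s.realReg := rfl
@[simp] theorem State.setRArr_intArr (s : State) (x : ℕ) (v : List ℝ) :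
    (s.setRArr x v).intArr = s.intArr := rfl
@[simp] theorem State.setRArr_realArr (s : State) (x : ℕ) (v : List ℝ) :
    (s.setRArr x v).realArr = Function.update s.realArr x v := rfl
@[simp] theorem State.setRArr_hash (s : State) (x : ℕ) (v : List ℝ) :
    (s.setRArr x v).hash = s.hash := rfl
@[simp] theorem State.setHash_intReg (s : State) (x : ℕ) (v : ℤ × ℤ → ℤ) :
    (s.setHash x v).intReg = s.intReg := rfl
@[simp] theorem State.setHash_realReg (s : State) (x : ℕ) (v : ℤ × ℤ → ℤ) :
    (s.setHash x v).realReg = s.realReg := rfl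
@[simp] theorem State.setHash_intArr (s : State) (x : ℕ) (v : ℤ × ℤ → ℤ) :
    (s.setHash x v).intArr = s.intArr := rfl
@[simp] theorem State.setHash_realArr (s : State) (x : ℕ) (v : ℤ × ℤ → ℤ) :
    (s.setHash x v).realArr = s.realArr := rfl
@[simp] theorem State.setHash_hash (s : State) (x : ℕ) (v : ℤ × ℤ → ℤ) :
    (s.setHash x v).hash = Function.update s.hash x v := rfl

/-- The loop-free program `p`, started in `s`, establishes `Q`. -/
def Prog.WP (p : Prog) (Q : State → Prop) (s : State) : Prop := Q (p.run s)

theorem wp_skip {Q : State → Prop} {s : State} : Prog.skip.WP Q s ↔ Q s := Iff.rfl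

theorem wp_setInt {Q : State → Prop} {s : State} {x : ℕ} {e : IExpr} :
    (Prog.setInt x e).WP Q s ↔ Q (s.setReg x (e.eval s)) := Iff.rfl

theorem wp_setReal {Q : State → Prop} {s : State} {x : ℕ} {e : RExpr} :
    (Prog.setReal x e).WP Q s ↔ Q (s.setRReg x (e.eval s)) := Iff.rfl

theorem wp_storeInt {Q : State → Prop} {s : State} {a : ℕ} {i e : IExpr} :
    (Prog.storeInt a i e).WP Q s ↔
      Q (s.setIArr a (writeAt (s.intArr a) (i.eval s) (e.eval s))) := Iff.rfl

theorem wp_pushInt {Q : State → Prop} {s : State} {a : ℕ} {e : IExpr} :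
    (Prog.pushInt a e).WP Q s ↔ Q (s.setIArr a (s.intArr a ++ [e.eval s])) := Iff.rfl

theorem wp_pushReal {Q : State → Prop} {s : State} {a : ℕ} {e : RExpr} :
    (Prog.pushReal a e).WP Q s ↔ Q (s.setRArr a (s.realArr a ++ [e.eval s])) := Iff.rfl

theorem wp_floor {Q : State → Prop} {s : State} {x : ℕ} {e : RExpr} :
    (Prog.floor x e).WP Q s ↔ Q (s.setReg x ⌊e.eval s⌋) := Iff.rfl

theorem wp_hashGet {Q : State → Prop} {s : State} {x h : ℕ} {k l : IExpr} :
    (Prog.hashGet x h k l).WP Q s ↔ Q (s.setReg x (s.hash h (k.eval s, l.eval s))) := Iff.rfl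

theorem wp_hashSet {Q : State → Prop} {s : State} {h : ℕ} {k l e : IExpr} :
    (Prog.hashSet h k l e).WP Q s ↔
      Q (s.setHash h (Function.update (s.hash h) (k.eval s, l.eval s) (e.eval s))) := Iff.rfl

theorem wp_seq {Q : State → Prop} {s : State} {p q : Prog} :
    (Prog.seq p q).WP Q s ↔ p.WP (fun s' => q.WP Q s') s := Iff.rfl

theorem wp_branch {Q : State → Prop} {s : State} {b : BExpr} {p q : Prog} :
    (Prog.branch b p q).WP Q s ↔ (b.Holds s → p.WP Q s) ∧ (¬ b.Holds s → q.WP Q s) := by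
  by_cases h : b.Holds s <;> simp [Prog.WP, Prog.run, h]

theorem Prog.WP.mono {p : Prog} {Q Q' : State → Prop} {s : State} (h : p.WP Q s)
    (hQ : ∀ s', Q s' → Q' s') : p.WP Q' s := hQ _ h

theorem Prog.LoopFree.runs_of_wp {p : Prog} (hp : p.LoopFree) {s : State} {Q : State → Prop}
    (h : p.WP Q s) : Runs p s p.costBound Q := hp.runs h

theorem wp_seqList_range (f : ℕ → Prog) (I : ℕ → State → Prop) {n : ℕ} {s : State}
    (h0 : I 0 s) (hstep : ∀ i < n, ∀ s, I i s → (f i).WP (I (i + 1)) s) :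
    (seqList ((List.range n).map f)).WP (I n) s :=
  run_seqList_range f I h0 hstep

theorem wp_seqList {α : Type*} (f : α → Prog) (I : List α → State → Prop) {l : List α} {s : State}
    (h0 : I [] s)
    (hstep : ∀ pre a post, l = pre ++ a :: post → ∀ s, I pre s → (f a).WP (I (pre ++ [a])) s) :
    (seqList (l.map f)).WP (I l) s :=
  run_seqList f I h0 hstep

/-! ### Arrays as tables of functions -/

/-- The array with entries `f 0, …, f (n - 1)`. -/
def tab {α : Type} (n : ℕ) (f : ℕ → α) : List α := (List.range n).map f

@[simp] theorem tab_length {α : Type} (n : ℕ) (f : ℕ → α) : (tab n f).length = n := by simp [tab]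

@[simp] theorem tab_zero {α : Type} (f : ℕ → α) : tab 0 f = [] := rfl

theorem tab_succ {α : Type} (n : ℕ) (f : ℕ → α) : tab (n + 1) f = tab n f ++ [f n] := by
  simp [tab, List.range_succ]

theorem tab_congr {α : Type} {n : ℕ} {f g : ℕ → α} (h : ∀ i < n, f i = g i) :
    tab n f = tab n g := by
  simpa [tab] using h

theorem readAt_tab {α : Type} [Zero α] {n : ℕ} {f : ℕ → α} {z : ℤ} {i : ℕ} (hz : z = i)
    (hi : i < n) : readAt (tab n f) z = f i := by
  simp [readAt, tab, hz, hi]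

/-- An index beyond the end needs no exception: neither the write nor the updated function then
affects the first `n` entries. -/
theorem writeAt_tab {α : Type} {n : ℕ} {f : ℕ → α} {z : ℤ} {i : ℕ} (hz : z = i) (v : α) :
    writeAt (tab n f) z v = tab n (Function.update f i v) := by
  subst hz
  apply List.ext_getElem
  · simp [writeAt]
  · intro k h1 h2
    simp only [writeAt, Int.natCast_nonneg, if_true, Int.toNat_natCast, tab, List.getElem_set,
      List.getElem_map, List.getElem_range, Function.update_apply]
    simp only [eq_comm]

/-! ### Bottom-up merge sort -/

/-- One pass of bottom-up merge sort: adjacent blocks of width `w` are merged. -/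
def mergePass {α : Type} (le : α → α → Bool) (w : ℕ) (l : List α) : List α :=
  if _h : l = [] ∨ w = 0 then l
  else List.merge (l.take w) ((l.drop w).take w) le ++ mergePass le w (l.drop (w + w))
termination_by l.length
decreasing_by
  have := List.length_pos_iff.2 (fun h' => _h (Or.inl h'))
  simp only [List.length_drop]; omega

theorem mergePass_of_ne {α : Type} (le : α → α → Bool) {w : ℕ} {l : List α} (h : l ≠ [])
    (hw : w ≠ 0) : mergePass le w l =
      List.merge (l.take w) ((l.drop w).take w) le ++ mergePass le w (l.drop (w + w)) := by
  rw [mergePass, dif_neg (by tauto)]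

@[simp] theorem mergePass_nil {α : Type} (le : α → α → Bool) (w : ℕ) :
    mergePass le w ([] : List α) = [] := by
  rw [mergePass, dif_pos (Or.inl rfl)]

theorem mergePass_perm {α : Type} (le : α → α → Bool) {w : ℕ} (hw : w ≠ 0) (l : List α) :
    (mergePass le w l).Perm l := by
  induction h : l.length using Nat.strong_induction_on generalizing l with
  | _ n ih =>
    by_cases hl : l = []
    · simp [hl]
    · rw [mergePass_of_ne le hl hw]
      have h1 := ih (l.drop (w + w)).length
        (by have := List.length_pos_iff.2 hl; simp only [List.length_drop]; omega) _ rfl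
      refine ((List.merge_perm_append le).append h1).trans ?_
      rw [← List.drop_drop, List.append_assoc, List.take_append_drop, List.take_append_drop]

/-- All blocks of width `w` are sorted. -/
def BlocksSorted {α : Type} (le : α → α → Bool) (w : ℕ) (l : List α) : Prop :=
  ∀ k, ((l.drop (k * w)).take w).Pairwise (fun a b => le a b = true)

/-- The first double block is the merge of two sorted blocks, and each later one is a double block
of the pass on the list without its first `2w` elements, so induction on the block number applies.
Only a list of at most `2w` elements can yield a shorter merge, and then nothing follows it. -/
theorem BlocksSorted.mergePass {α : Type} {le : α → α → Bool}
    (htrans : ∀ a b c, le a b → le b c → le a c) (htot : ∀ a b, le a b || le b a)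
    {w : ℕ} (hw : w ≠ 0) {l : List α} (hl : BlocksSorted le w l) :
    BlocksSorted le (w + w) (mergePass le w l) := by
  intro k
  induction k generalizing l with
  | zero =>
    by_cases h0 : l = []
    · simp [h0]
    rw [mergePass_of_ne le h0 hw]
    have hs : (List.merge (l.take w) ((l.drop w).take w) le).Pairwise (fun a b => le a b = true) :=
      List.pairwise_merge htrans htot _ _ (by simpa using hl 0) (by simpa using hl 1)
    by_cases h : l.length ≤ w + w
    · rw [List.drop_eq_nil_of_le h]
      simpa using hs.sublist (List.take_sublist _ _)
    · rw [zero_mul, List.drop_zero, List.take_append_of_le_length]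
      · exact hs.sublist (List.take_sublist _ _)
      · simp only [List.length_merge, List.length_take, List.length_drop]; omega
  | succ k ih =>
    by_cases h0 : l = []
    · simp [h0]
    rw [mergePass_of_ne le h0 hw]
    by_cases h : l.length ≤ w + w
    · rw [List.drop_eq_nil_of_le h, mergePass_nil, List.append_nil, List.drop_eq_nil_of_le]
      · simp
      · simp only [List.length_merge, List.length_take, List.length_drop]
        have : (k + 1) * (w + w) = k * (w + w) + (w + w) := by ring
        omega
    · have hlen : (List.merge (l.take w) ((l.drop w).take w) le).length = w + w := by
        simp only [List.length_merge, List.length_take, List.length_drop]; omega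
      have e : (k + 1) * (w + w) = (w + w) + k * (w + w) := by ring
      rw [e, ← List.drop_drop, List.drop_left' hlen]
      refine ih fun j => ?_
      rw [List.drop_drop]
      have : w + w + j * w = (j + 2) * w := by ring
      rw [this]; exact hl _

/-- The pass of merge sort stops at position `i` of the block ending at `mid` and at position `j` of
the block ending at `hi`. -/
structure PassState {α : Type} (le : α → α → Bool) (w : ℕ) (l out : List α) (i mid j hi : ℕ) :
    Prop where
  i_le : i ≤ mid
  mid_le : mid ≤ l.length
  j_le : j ≤ hi
  hi_le : hi ≤ l.length
  eq : out ++ (List.merge ((l.take mid).drop i) ((l.take hi).drop j) le ++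
    mergePass le w (l.drop hi)) = mergePass le w l

theorem PassState.start {α : Type} (le : α → α → Bool) (w : ℕ) (l : List α) :
    PassState le w l [] 0 0 0 0 := ⟨le_rfl, by simp, le_rfl, by simp, by simp⟩

theorem PassState.length {α : Type} {le : α → α → Bool} {w : ℕ} (hw : w ≠ 0) {l out : List α}
    {i mid j hi : ℕ} (h : PassState le w l out i mid j hi) :
    out.length + ((mid - i) + (hi - j) + (l.length - hi)) = l.length := by
  have := congrArg List.length h.eq
  have h1 := h.mid_le
  have h2 := h.hi_le
  simp only [List.length_append, List.length_merge, List.length_drop, List.length_take,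
    (mergePass_perm le hw _).length_eq] at this
  omega

/-- With both blocks used up, the equation of the state says that `mergePass` of the rest from `hi`
on remains to be output, and one unfolding exposes the next two blocks. That rest is nonempty since
the output is still too short. The minima truncate incomplete blocks at the end of the list. -/
theorem PassState.refill {α : Type} {le : α → α → Bool} {w : ℕ} (hw : w ≠ 0) {l out : List α}
    {i mid j hi : ℕ} (h : PassState le w l out i mid j hi) (hlt : out.length < l.length)
    (hi' : mid ≤ i) (hj' : hi ≤ j) :
    PassState le w l out hi (min (hi + w) l.length) (min (hi + w) l.length)
      (min (min (hi + w) l.length + w) l.length) := by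
  have hlen := h.length hw
  have h1 := h.mid_le
  have h2 := h.hi_le
  refine ⟨by omega, by omega, by omega, by omega, ?_⟩
  have he := h.eq
  rw [List.drop_eq_nil_of_le (by simp; omega), List.drop_eq_nil_of_le (by simp; omega)] at he
  rw [List.nil_merge, List.nil_append, mergePass_of_ne le (l := l.drop hi) (fun hn => by
    have := congrArg List.length hn
    simp at this; omega) hw] at he
  rw [← he]
  congr 1
  have e1 : (l.take (min (hi + w) l.length)).drop hi = (l.drop hi).take w := by
    rw [List.drop_take, List.take_eq_take_iff]
    simp only [List.length_drop]; omega
  have e2 : (l.take (min (min (hi + w) l.length + w) l.length)).drop (min (hi + w) l.length) =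
      ((l.drop hi).drop w).take w := by
    rw [List.drop_take]
    by_cases hc : hi + w ≤ l.length
    · rw [min_eq_left hc, List.drop_drop, List.take_eq_take_iff]
      simp only [List.length_drop]; omega
    · rw [List.drop_eq_nil_of_le (i := min _ _) (by omega), List.drop_drop,
        List.drop_eq_nil_of_le (by omega)]
      simp
  have e3 : l.drop (min (min (hi + w) l.length + w) l.length) = (l.drop hi).drop (w + w) := by
    rw [List.drop_drop]
    by_cases hc : hi + (w + w) ≤ l.length
    · congr 1; omega
    · rw [List.drop_eq_nil_of_le (by omega), List.drop_eq_nil_of_le (by omega)]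
  rw [e1, e2, e3]

theorem drop_take_cons {α : Type} {l : List α} {i m : ℕ} (h : i < m) (hm : m ≤ l.length) :
    (l.take m).drop i = l[i] :: (l.take m).drop (i + 1) := by
  rw [List.drop_eq_getElem_cons (by simp; omega)]
  simp

/-- The head of the right block is the head of the merge if the left block is empty or its head is
not smaller or equal. The comparison is thus only demanded when the left block is nonempty. -/
theorem PassState.emit_right {α : Type} {le : α → α → Bool} {w : ℕ} {l out : List α}
    {i mid j hi : ℕ} (h : PassState le w l out i mid j hi) (hj : j < hi) (hjl : j < l.length)
    (hle : ∀ (_ : i < mid) (hil : i < l.length), ¬ le l[i] l[j]) :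
    PassState le w l (out ++ [l[j]]) i mid (j + 1) hi := by
  refine ⟨h.i_le, h.mid_le, hj, h.hi_le, ?_⟩
  rw [← h.eq, drop_take_cons hj h.hi_le]
  rcases Nat.lt_or_ge i mid with hi' | hi'
  · have := h.mid_le
    rw [drop_take_cons hi' h.mid_le, List.cons_merge_cons_neg _ _ _ (hle hi' (by omega))]
    simp
  · rw [List.drop_eq_nil_of_le (by simp; omega)]
    simp

theorem PassState.emit_left {α : Type} {le : α → α → Bool} {w : ℕ} {l out : List α}
    {i mid j hi : ℕ} (h : PassState le w l out i mid j hi) (hi' : i < mid) (hil : i < l.length)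
    (hle : ∀ (_ : j < hi) (hjl : j < l.length), le l[i] l[j]) :
    PassState le w l (out ++ [l[i]]) (i + 1) mid j hi := by
  refine ⟨hi', h.mid_le, h.j_le, h.hi_le, ?_⟩
  rw [← h.eq, drop_take_cons hi' h.mid_le]
  rcases Nat.lt_or_ge j hi with hj | hj
  · have := h.hi_le
    rw [drop_take_cons hj h.hi_le, List.cons_merge_cons_pos _ _ _ (hle hj (by omega))]
    simp
  · rw [List.drop_eq_nil_of_le (as := l.take hi) (by simp; omega)]
    simp

theorem readAt_map_cast {l : List ℕ} {z : ℤ} {i : ℕ} (hz : z = i) (hi : i < l.length) :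
    readAt (l.map (fun k : ℕ => (k : ℤ))) z = (l[i] : ℤ) := by
  simp [readAt, hz, hi]

/-- Start merging the next two blocks if the current ones are exhausted. -/
def refillProg : Prog :=
  .branch (.and (.leInt (.reg 24) (.reg 23)) (.leInt (.reg 26) (.reg 25)))
    (.seq (.setInt 23 (.reg 26)) <| .seq (.setInt 24 (.add (.reg 26) (.reg 22))) <|
      .seq (.branch (.ltInt (.reg 20) (.reg 24)) (.setInt 24 (.reg 20)) .skip) <|
      .seq (.setInt 25 (.reg 24)) <| .seq (.setInt 26 (.add (.reg 24) (.reg 22))) <|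
      .branch (.ltInt (.reg 20) (.reg 26)) (.setInt 26 (.reg 20)) .skip)
    .skip

/-- Append the smaller one of the first elements of the two current blocks. -/
def emitProg (src A : ℕ) : Prog :=
  .branch (.and (.ltInt (.reg 25) (.reg 26)) (.not (.and (.ltInt (.reg 23) (.reg 24))
      (.leReal (.get src (.get A (.add (.reg 21) (.reg 23))))
        (.get src (.get A (.add (.reg 21) (.reg 25))))))))
    (.seq (.pushInt A (.get A (.add (.reg 21) (.reg 25))))
      (.setInt 25 (.add (.reg 25) (.const 1))))
    (.seq (.pushInt A (.get A (.add (.reg 21) (.reg 23))))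
      (.setInt 23 (.add (.reg 23) (.const 1))))

/-- One pass of merge sort on the indices stored in the integer array `A` from position `reg 21` on;
the result is appended to `A`. -/
def passProg (src A : ℕ) : Prog :=
  .seq (.setInt 23 (.const 0)) <| .seq (.setInt 24 (.const 0)) <| .seq (.setInt 25 (.const 0)) <|
  .seq (.setInt 26 (.const 0)) <|
  forLoop 27 (.reg 20) (.seq refillProg (emitProg src A))

/-- Comparison of indices by key. -/
noncomputable def keyLe (key : ℕ → ℝ) (i j : ℕ) : Bool := decide (key i ≤ key j)

/-- Memory during a pass of merge sort. -/
def PassMem (src A : ℕ) (key : ℕ → ℝ) (w : ℕ) (pre l out : List ℕ) (s : State) : Prop :=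
  ∃ i mid j hi : ℕ, PassState (keyLe key) w l out i mid j hi ∧
    s.intArr A = (pre ++ l ++ out).map (fun k : ℕ => (k : ℤ)) ∧
    s.realArr src = tab l.length key ∧ s.intReg 20 = l.length ∧ s.intReg 21 = pre.length ∧
    s.intReg 22 = w ∧ s.intReg 23 = i ∧ s.intReg 24 = mid ∧ s.intReg 25 = j ∧ s.intReg 26 = hi

/-- As long as the output is shorter than the list, the current blocks cannot both be empty after
the refill, so there is something to emit. -/
theorem refillProg_wp {src A : ℕ} {key : ℕ → ℝ} {w : ℕ} (hw : w ≠ 0) {pre l out : List ℕ}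
    {s : State} (h : PassMem src A key w pre l out s) (hlt : out.length < l.length) :
    refillProg.WP (fun s' => PassMem src A key w pre l out s' ∧
      ¬ (s'.intReg 24 ≤ s'.intReg 23 ∧ s'.intReg 26 ≤ s'.intReg 25)) s := by
  obtain ⟨i, mid, j, hi, hP, hA, hsrc, h20, h21, h22, h23, h24, h25, h26⟩ := h
  have hlen := hP.length hw
  have hhL := hP.hi_le
  have hmL := hP.mid_le
  rw [refillProg, wp_branch]
  constructor
  · intro hb
    simp only [BExpr.Holds, IExpr.eval, h23, h24, h25, h26, Nat.cast_le] at hb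
    have hP' := hP.refill hw hlt hb.1 hb.2
    simp only [wp_seq, wp_setInt, wp_branch, wp_skip, BExpr.Holds, IExpr.eval, State.setReg_intReg,
      Function.update_apply]
    norm_num only [h20, h21, h22, h23, h24, h25, h26, if_true, if_false]
    refine ⟨fun h1 => ⟨fun h2 => ?_, fun h2 => ?_⟩, fun h1 => ⟨fun h2 => ?_, fun h2 => ?_⟩⟩ <;>
    · refine ⟨⟨_, _, _, _, hP', ?_⟩, ?_⟩ <;>
      simp [hA, hsrc, h20, h21, h22, h23, h24, h25, h26, Function.update_apply] <;> omega
  · intro hb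
    refine ⟨⟨i, mid, j, hi, hP, hA, hsrc, h20, h21, h22, h23, h24, h25, h26⟩, hb⟩

theorem emitProg_run {src A : ℕ} {key : ℕ → ℝ} {w : ℕ} {pre l out : List ℕ} {s : State}
    (hl : ∀ i ∈ l, i < l.length)
    (h : PassMem src A key w pre l out s)
    (hne : ¬ (s.intReg 24 ≤ s.intReg 23 ∧ s.intReg 26 ≤ s.intReg 25)) :
    ∃ v, PassMem src A key w pre l (out ++ [v]) ((emitProg src A).run s) := by
  obtain ⟨i, mid, j, hi, hP, hA, hsrc, h20, h21, h22, h23, h24, h25, h26⟩ := h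
  have hiL := hP.i_le
  have hmL := hP.mid_le
  have hjL := hP.j_le
  have hhL := hP.hi_le
  have hrd : ∀ k (hk : k < l.length), readAt (s.intArr A) (s.intReg 21 + k) = (l[k] : ℤ) := by
    intro k hk
    rw [hA, readAt_map_cast (i := pre.length + k) (by rw [h21]; push_cast; rfl) (by simp; omega)]
    simp [List.getElem_append, hk]
  have hkey : ∀ k (hk : k < l.length), readAt (s.realArr src) (l[k] : ℤ) = key l[k] := by
    intro k hk
    rw [hsrc, readAt_tab rfl (hl _ (List.getElem_mem hk))]
  -- This is the test of the program with array reads replaced by list elements; the bounds proofs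
  -- make it meaningful without case distinctions on the ranges.
  by_cases hc : j < hi ∧ ¬ (i < mid ∧ ∀ (h1 : i < l.length) (h2 : j < l.length), key l[i] ≤ key l[j])
  · obtain ⟨hj, hc2⟩ := hc
    have hH : (BExpr.and (.ltInt (.reg 25) (.reg 26)) (.not (.and (.ltInt (.reg 23) (.reg 24))
      (.leReal (.get src (.get A (.add (.reg 21) (.reg 23))))
        (.get src (.get A (.add (.reg 21) (.reg 25)))))))).Holds s := by
      simp only [BExpr.Holds, IExpr.eval, RExpr.eval]
      rw [h23, h24, h25, h26]
      refine ⟨by exact_mod_cast hj, fun hh => hc2 ⟨by exact_mod_cast hh.1, fun h1 h2 => ?_⟩⟩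
      have := hh.2
      rwa [hrd i h1, hrd j h2, hkey i h1, hkey j h2] at this
    refine ⟨l[j]'(by omega), i, mid, j + 1, hi, hP.emit_right hj (by omega) ?_, ?_⟩
    · intro h1 h2 h3
      exact hc2 ⟨h1, fun _ _ => by simpa [keyLe] using h3⟩
    · simp only [emitProg, Prog.run]
      rw [if_pos hH]
      simp only [IExpr.eval, h25, hrd j (by omega)]
      simp [hA, h20, h21, h22, h23, h24, h25, h26, hsrc]
  · have hi' : i < mid := by
      by_contra hcon
      rw [h24, h23, h26, h25] at hne
      apply hc
      refine ⟨?_, by tauto⟩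
      by_contra hcon2
      exact hne ⟨by exact_mod_cast Nat.le_of_not_lt hcon, by exact_mod_cast Nat.le_of_not_lt hcon2⟩
    have hH : ¬ (BExpr.and (.ltInt (.reg 25) (.reg 26)) (.not (.and (.ltInt (.reg 23) (.reg 24))
      (.leReal (.get src (.get A (.add (.reg 21) (.reg 23))))
        (.get src (.get A (.add (.reg 21) (.reg 25)))))))).Holds s := by
      simp only [BExpr.Holds, IExpr.eval, RExpr.eval]
      rw [h23, h24, h25, h26]
      intro hh
      have hj : j < hi := by exact_mod_cast hh.1
      refine hc ⟨hj, fun hcc => hh.2 ⟨by exact_mod_cast hi', ?_⟩⟩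
      rw [hrd i (by omega), hrd j (by omega), hkey i (by omega), hkey j (by omega)]
      exact hcc.2 _ _
    refine ⟨l[i]'(by omega), i + 1, mid, j, hi, hP.emit_left hi' (by omega) ?_, ?_⟩
    · intro h1 h2
      by_contra h3
      exact hc ⟨h1, fun hcc => h3 (by simpa [keyLe] using hcc.2 (by omega) h2)⟩
    · simp only [emitProg, Prog.run]
      rw [if_neg hH]
      simp only [IExpr.eval, h23, hrd i (by omega)]
      simp [hA, h20, h21, h22, h23, h24, h25, h26, hsrc]

theorem emitProg_loopFree (src A : ℕ) : (emitProg src A).LoopFree := by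
  simp [emitProg, Prog.LoopFree]

theorem refillProg_loopFree : refillProg.LoopFree := by
  simp [refillProg, Prog.LoopFree]

/-- Running time of a pass of merge sort on `n` elements. -/
def passCost (n : ℕ) : ℕ := (n + 1) * (refillProg.costBound + (emitProg 0 0).costBound + 9) + 8

/-- Each round emits exactly one element, so the loop counter is the length of the output. After
`l.length` rounds both blocks and the remainder are empty, and the equation in `PassState`
identifies the output with `mergePass`. -/
theorem passProg_runs {src A : ℕ} {key : ℕ → ℝ} {w : ℕ} (hw : w ≠ 0) {pre l : List ℕ} {s : State}
    (hl : ∀ i ∈ l, i < l.length)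
    (hA : s.intArr A = (pre ++ l).map (fun k : ℕ => (k : ℤ)))
    (hsrc : s.realArr src = tab l.length key) (h20 : s.intReg 20 = l.length)
    (h21 : s.intReg 21 = pre.length) (h22 : s.intReg 22 = w) :
    Runs (passProg src A) s (passCost l.length) (fun s' =>
      s'.intArr A = (pre ++ l ++ mergePass (keyLe key) w l).map (fun k : ℕ => (k : ℤ))) := by
  have key1 : ∀ s₀ : State, PassMem src A key w pre l [] s₀ →
      Runs (forLoop 27 (.reg 20) (.seq refillProg (emitProg src A))) s₀
      ((l.length + 1) * (refillProg.costBound + (emitProg src A).costBound + 1 + 8)) (fun s' =>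
        ∃ out : List ℕ, out.length = l.length ∧ PassMem src A key w pre l out s') := by
    intro s₀ h₀
    refine Runs.forLoop l.length (refillProg.costBound + (emitProg src A).costBound)
      (fun i s' => ∃ out : List ℕ, out.length = i ∧ PassMem src A key w pre l out s') ?_ ?_ ?_ ?_
    · obtain ⟨i, mid, j, hi, hP, hA, hsrc, h20, h21, h22, h23, h24, h25, h26⟩ := h₀
      exact ⟨[], rfl, i, mid, j, hi, hP, by simpa using hA, by simpa using hsrc,
        by simpa using h20, by simpa using h21, by simpa using h22, by simpa using h23,
        by simpa using h24, by simpa using h25, by simpa using h26⟩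
    · simp [refillProg, emitProg, Prog.Mod]
    · rintro i - s' - ⟨out, -, i, mid, j, hi, hP, hA, hsrc, h20, -⟩
      exact h20
    · rintro i hi s' - - ⟨out, ho, hM⟩
      refine Prog.LoopFree.runs_of_wp (p := .seq refillProg (emitProg src A))
        ⟨refillProg_loopFree, emitProg_loopFree src A⟩ ?_
      rw [wp_seq]
      refine (refillProg_wp hw hM (by omega)).mono fun s₁ h₁ => ?_
      obtain ⟨v, i', mid, j, hi, hP, hA, hsrc, h20, h21, h22, h23, h24, h25, h26⟩ :=
        emitProg_run hl h₁.1 h₁.2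
      exact ⟨out ++ [v], by simp [ho], i', mid, j, hi, hP, by simpa using hA, by simpa using hsrc,
        by simpa using h20, by simpa using h21, by simpa using h22, by simpa using h23,
        by simpa using h24, by simpa using h25, by simpa using h26⟩
  have hinit : PassMem src A key w pre l []
      ((((s.setReg 23 0).setReg 24 0).setReg 25 0).setReg 26 0) :=
    ⟨0, 0, 0, 0, .start _ _ _, by simpa using hA, by simpa using hsrc, by simpa using h20,
      by simpa using h21, by simpa using h22, by simp, by simp, by simp, by simp⟩
  obtain ⟨s', t, hE, ht, out, ho, hM⟩ := key1 _ hinit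
  refine ⟨s', _, .seq (.setInt _ _ _) (.seq (.setInt _ _ _) (.seq (.setInt _ _ _)
    (.seq (.setInt _ _ _) hE))), ?_, ?_⟩
  -- Costs do not depend on which arrays an expression names.
  · have : (emitProg src A).costBound = (emitProg 0 0).costBound := rfl
    rw [this] at ht
    simp only [IExpr.cost, passCost]
    ring_nf at ht ⊢
    omega
  · obtain ⟨i', mid, j, hi, hP, hA, -⟩ := hM
    have hlen := hP.length hw
    have hhL := hP.hi_le
    have hmL := hP.mid_le
    have he := hP.eq
    rw [List.drop_eq_nil_of_le (as := l.take mid) (by simp; omega),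
      List.drop_eq_nil_of_le (as := l.take hi) (by simp; omega),
      List.drop_eq_nil_of_le (as := l) (by omega)] at he
    simp only [List.nil_merge, mergePass_nil, List.append_nil] at he
    rw [hA, he]

/-- The integer array `A` receives the indices of the real array `src`, and then the results of the
passes of merge sort, the last one of which starts at position `reg 21`.  The array `out` is filled
with zeros. -/
def sortProg (src A out : ℕ) : Prog :=
  .seq (.setInt 20 (.lenReal src)) <|
  .seq (forLoop 27 (.reg 20) (.seq (.pushInt A (.reg 27)) (.pushInt out (.const 0)))) <|
  .seq (.setInt 21 (.const 0)) <| .seq (.setInt 22 (.const 1)) <|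
  .loop (.ltInt (.reg 22) (.reg 20))
    (.seq (passProg src A) (.seq (.setInt 21 (.add (.reg 21) (.reg 20)))
      (.setInt 22 (.add (.reg 22) (.reg 22)))))

/-- Running time of merge sort. -/
def sortCost (n : ℕ) : ℕ := (Nat.clog 2 n + 1) * (passCost n + 12) + (n + 1) * 20 + 10

/-- After `k` passes the blocks of width `2 ^ k` are sorted, so `Nat.clog 2 n` passes suffice. A
pass never overwrites its input: it appends to `A`, and `pre` collects the results of the earlier
passes. -/
theorem sortProg_runs {src A out n : ℕ} (hAo : A ≠ out) {key : ℕ → ℝ} {s : State}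
    (hA : s.intArr A = []) (ho : s.intArr out = []) (hsrc : s.realArr src = tab n key) :
    Runs (sortProg src A out) s (sortCost n) (fun s' =>
      ∃ pre l : List ℕ, s'.intArr A = (pre ++ l).map (fun k : ℕ => (k : ℤ)) ∧
        l.Perm (List.range n) ∧ l.Pairwise (fun i j => key i ≤ key j) ∧
        s'.intReg 20 = n ∧ s'.intReg 21 = pre.length ∧ s'.intArr out = tab n (fun _ => 0)) := by
  have h1 : Runs (.setInt 20 (.lenReal src)) s 2 (fun s' => s' = s.setReg 20 n) :=
    ⟨_, _, .setInt _ _ _, by simp [IExpr.cost], by simp [IExpr.eval, hsrc, State.setReg]⟩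
  have h2 : ∀ s₀ : State, s₀ = s.setReg 20 n →
      Runs (forLoop 27 (.reg 20) (.seq (.pushInt A (.reg 27)) (.pushInt out (.const 0)))) s₀
        ((n + 1) * (4 + 1 + 8)) (fun s' => s'.intReg 20 = n ∧
          s'.intArr A = (List.range n).map (fun k : ℕ => (k : ℤ)) ∧
          s'.intArr out = tab n (fun _ => 0) ∧ s'.realArr src = tab n key) := by
    rintro s₀ rfl
    refine Runs.forLoop n 4 (fun i s' => s'.intReg 20 = n ∧
          s'.intArr A = (List.range i).map (fun k : ℕ => (k : ℤ)) ∧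
          s'.intArr out = tab i (fun _ => 0) ∧ s'.realArr src = tab n key) ?_ ?_ ?_ ?_
    · simp [hA, ho, hsrc]
    · simp [Prog.Mod]
    · rintro i - s' - ⟨h, -⟩; exact h
    · rintro i - s' - hx ⟨h20, hA', ho', hs'⟩
      refine Prog.LoopFree.runs_of_wp (p := .seq (.pushInt A (.reg 27)) (.pushInt out (.const 0)))
        ⟨trivial, trivial⟩ ?_
      simp [wp_seq, wp_pushInt, IExpr.eval, hx, hA', ho', hs', h20, hAo, hAo.symm, List.range_succ,
        tab_succ]
  have h3 : ∀ s₀ : State, s₀.intReg 20 = n →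
      s₀.intArr A = (List.range n).map (fun k : ℕ => (k : ℤ)) →
      s₀.intArr out = tab n (fun _ => 0) → s₀.realArr src = tab n key →
      s₀.intReg 21 = 0 → s₀.intReg 22 = 1 →
      Runs (.loop (.ltInt (.reg 22) (.reg 20))
        (.seq (passProg src A) (.seq (.setInt 21 (.add (.reg 21) (.reg 20)))
          (.setInt 22 (.add (.reg 22) (.reg 22)))))) s₀
        ((Nat.clog 2 n + 1) * (passCost n + 8 + 3 + 1))
        (fun s' => ∃ pre l : List ℕ, s'.intArr A = (pre ++ l).map (fun k : ℕ => (k : ℤ)) ∧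
          l.Perm (List.range n) ∧ l.Pairwise (fun i j => key i ≤ key j) ∧
          s'.intReg 20 = n ∧ s'.intReg 21 = pre.length ∧ s'.intArr out = tab n (fun _ => 0)) := by
    intro s₀ h20 hA ho hsrc h21 h22
    refine Runs.mono (Runs.while (Nat.clog 2 n) (passCost n + 8) (fun k s' =>
      ∃ pre l : List ℕ, s'.intArr A = (pre ++ l).map (fun k : ℕ => (k : ℤ)) ∧
        l.Perm (List.range n) ∧ BlocksSorted (keyLe key) (2 ^ k) l ∧
        s'.intReg 21 = pre.length ∧ s'.intReg 22 = (2 ^ k : ℕ) ∧ s'.intReg 20 = n ∧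
        s'.intArr out = tab n (fun _ => 0) ∧ s'.realArr src = tab n key) ?_ ?_ ?_) le_rfl ?_
    -- Blocks of width one are sorted for trivial reasons.
    · refine ⟨[], List.range n, by simpa using hA, List.Perm.refl _, ?_, by simpa using h21,
        by simpa using h22, h20, ho, hsrc⟩
      intro k
      rcases (List.range n).drop (k * 2 ^ 0) with _ | ⟨a, m⟩ <;> simp [List.take_one]
    · rintro s' ⟨pre, l, -, -, -, -, h22, h20, -⟩
      simp only [BExpr.Holds, IExpr.eval, h22, h20, Nat.cast_lt, not_lt]
      exact Nat.le_pow_clog (by norm_num) n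
    · rintro k hk s' - ⟨pre, l, hA, hp, hB, h21, h22, h20, ho, hsrc⟩ -
      have hlen : l.length = n := by simpa using hp.length_eq
      have hmem : ∀ i ∈ l, i < l.length := fun i hi => by
        simpa [hlen] using hp.mem_iff.1 hi
      have hpass := passProg_runs (src := src) (A := A) (key := key) (w := 2 ^ k) (by positivity)
        hmem hA (hlen ▸ hsrc) (hlen ▸ h20) h21 h22
      rw [hlen] at hpass
      have hmod : ∀ x ∈ ([20, 21, 22] : List ℕ), ¬ (passProg src A).Mod (.ireg x) := by
        simp [passProg, forLoop_mod, refillProg, emitProg, Prog.Mod]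
      refine Runs.mono (Runs.seq (T' := 8) (hpass.mono le_rfl fun s₁ hag h₁ => ?_)) le_rfl
        (fun _ _ h => h)
      have e20 := hag.ireg 20 (hmod 20 (by simp))
      have e21 := hag.ireg 21 (hmod 21 (by simp))
      have e22 := hag.ireg 22 (hmod 22 (by simp))
      have eo := hag.iarr out (by
        simp [passProg, forLoop_mod, refillProg, emitProg, Prog.Mod, hAo.symm])
      have es := hag.rarr src (by
        simp [passProg, forLoop_mod, refillProg, emitProg, Prog.Mod])
      refine Prog.LoopFree.runs_of_wp (p := .seq (.setInt 21 (.add (.reg 21) (.reg 20)))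
          (.setInt 22 (.add (.reg 22) (.reg 22)))) ⟨trivial, trivial⟩ ?_
      simp only [wp_seq, wp_setInt]
      refine ⟨pre ++ l, mergePass (keyLe key) (2 ^ k) l, by simpa using h₁,
        (mergePass_perm _ (by positivity) l).trans hp, ?_, ?_, ?_, ?_, ?_, ?_⟩
      · rw [pow_succ, mul_two]
        refine hB.mergePass ?_ ?_ (by positivity)
        · simp only [keyLe, decide_eq_true_eq]
          exact fun a b c => le_trans
        · intro a b
          simp only [keyLe, Bool.or_eq_true, decide_eq_true_eq]
          exact le_total _ _
      · simp [IExpr.eval, e20, e21, h20, h21, hlen]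
      · simp [IExpr.eval, e22, h22, pow_succ, mul_two]
      · simp [e20, h20]
      · simp [eo, ho]
      · simp [es, hsrc]
    · rintro s' - ⟨hb, k, -, pre, l, hA, hp, hB, h21, h22, h20, ho, hsrc⟩
      simp only [BExpr.Holds, IExpr.eval, h22, h20, Nat.cast_lt, not_lt] at hb
      have hlen : l.length = n := by simpa using hp.length_eq
      refine ⟨pre, l, hA, hp, ?_, h20, h21, ho⟩
      have := hB 0
      rw [zero_mul, List.drop_zero, List.take_of_length_le (by omega)] at this
      simpa [keyLe] using this
  refine Runs.mono (Runs.seq (h1.mono le_rfl fun s₁ _ hs₁ => Runs.seq ((h2 s₁ hs₁).mono le_rfl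
    fun s₂ _ hs₂ => Runs.seq (T := 2) ⟨_, _, .setInt _ _ _, by simp [IExpr.cost],
      Runs.seq (T := 2) ⟨_, _, .setInt _ _ _, by simp [IExpr.cost], h3 _ ?_ ?_ ?_ ?_ ?_ ?_⟩⟩))) ?_
    (fun _ _ h => h)
  · simpa using hs₂.1
  · simpa using hs₂.2.1
  · simpa using hs₂.2.2.1
  · simpa using hs₂.2.2.2
  · simp [IExpr.eval]
  · simp [IExpr.eval]
  · unfold sortCost
    ring_nf
    omega

/-! ### Greedy cells on the real line, replacing the floor function -/

/-- `c` numbers cells of width less than `δ` along the real line, at least `δ` apart from each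
other's starting points. -/
structure IsCells (n : ℕ) (δ : ℝ) (x : ℕ → ℝ) (c : ℕ → ℤ) : Prop where
  nonneg : ∀ i < n, 0 ≤ c i
  lt : ∀ i < n, c i < n
  same : ∀ i < n, ∀ j < n, c i = c j → x j - x i < δ
  mono : ∀ i < n, ∀ j < n, x i ≤ x j → c i ≤ c j
  gap : ∀ i < n, ∀ j < n, x i ≤ x j → ((c j - c i - 1 : ℤ) : ℝ) * δ ≤ x j - x i

/-- Walk through the sorted indices and number the cells greedily. -/
def scanBody (src A out : ℕ) (δ : ℚ) : Prog :=
  .seq (.setInt 23 (.get A (.add (.reg 21) (.reg 27)))) <|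
  .seq (.branch (.leInt (.reg 27) (.const 0)) (.setReal 0 (.get src (.reg 23)))
    (.branch (.leReal (.add (.reg 0) (.const δ)) (.get src (.reg 23)))
      (.seq (.setInt 24 (.add (.reg 24) (.const 1))) (.setReal 0 (.get src (.reg 23)))) .skip)) <|
  .storeInt out (.reg 23) (.reg 24)

/-- Number the entries of the real array `src` by cells of width `δ`; the cell numbers are stored in
the integer array `out`. -/
def compressProg (src A out : ℕ) (δ : ℚ) : Prog :=
  .seq (sortProg src A out) <| .seq (.setInt 24 (.const 0)) <|
  forLoop 27 (.reg 20) (scanBody src A out δ)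

/-- Invariant of the greedy numbering: the indices in `done` are numbered, `cur` is the number of
the last cell and `o` its starting point. -/
structure ScanInv (δ : ℝ) (x : ℕ → ℝ) (f : ℕ → ℤ) (cur : ℤ) (o : ℝ) (done : List ℕ) : Prop where
  nonneg : ∀ i ∈ done, 0 ≤ f i
  le : ∀ i ∈ done, f i ≤ cur
  start : ∀ i ∈ done, f i = cur → o ≤ x i ∧ x i < o + δ
  far : ∀ i ∈ done, f i < cur → x i + ((cur - f i - 1 : ℤ) : ℝ) * δ < o
  last : done = [] ∨ ∃ i ∈ done, f i = cur
  same : ∀ i ∈ done, ∀ j ∈ done, f i = f j → x j - x i < δ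
  mono : ∀ i ∈ done, ∀ j ∈ done, x i ≤ x j → f i ≤ f j
  gap : ∀ i ∈ done, ∀ j ∈ done, x i ≤ x j → ((f j - f i - 1 : ℤ) : ℝ) * δ ≤ x j - x i

/-- The three cases are the very first point, a point of the current cell, and a point that opens a
new cell. A new cell starts at least `δ` after the start of the current one, so the distance
recorded in `far` grows by `δ` per cell, and points of the current cell, which end before `o + δ`,
enter it with multiplicity zero. -/
theorem ScanInv.step {δ : ℝ} {x : ℕ → ℝ} {f : ℕ → ℤ} {cur : ℤ} {o : ℝ} (hδ : 0 < δ)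
    {done : List ℕ} (h : ScanInv δ x f cur o done) {k : ℕ} (hk : k ∉ done)
    (hmax : ∀ i ∈ done, x i ≤ x k) {cur' : ℤ} {o' : ℝ} (hcur : 0 ≤ cur')
    (h' : (done = [] ∧ o' = x k) ∨ (cur' = cur ∧ o' = o ∧ o ≤ x k ∧ x k < o + δ) ∨
      (cur' = cur + 1 ∧ o' = x k ∧ o + δ ≤ x k)) :
    ScanInv δ x (Function.update f k cur') cur' o' (done ++ [k]) := by
  have hf : ∀ i ∈ done, Function.update f k cur' i = f i := by
    rintro i hi
    exact Function.update_of_ne (by rintro rfl; exact hk hi) _ _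
  have hk' : Function.update f k cur' k = cur' := Function.update_self _ _ _
  have hok : o' ≤ x k ∧ x k < o' + δ := by
    rcases h' with ⟨-, rfl⟩ | ⟨-, rfl, h1, h2⟩ | ⟨-, rfl, h1⟩
    · exact ⟨le_rfl, by linarith⟩
    · exact ⟨h1, h2⟩
    · exact ⟨le_rfl, by linarith⟩
  have hle : ∀ i ∈ done, f i ≤ cur' := fun i hi => by
    have := h.le i hi
    rcases h' with ⟨rfl, -⟩ | ⟨rfl, -⟩ | ⟨rfl, -⟩
    · simp at hi
    all_goals omega
  have hstart : ∀ i ∈ done, f i = cur' → o' ≤ x i ∧ x i < o' + δ := fun i hi he => by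
    rcases h' with ⟨rfl, -⟩ | ⟨rfl, rfl, -⟩ | ⟨rfl, -⟩
    · simp at hi
    · exact h.start i hi he
    · have := h.le i hi; omega
  have hfar : ∀ i ∈ done, f i < cur' → x i + ((cur' - f i - 1 : ℤ) : ℝ) * δ < o' := by
    intro i hi hlt
    rcases h' with ⟨rfl, -⟩ | ⟨rfl, rfl, -⟩ | ⟨rfl, rfl, h1⟩
    · simp at hi
    · exact h.far i hi hlt
    · rcases (h.le i hi).lt_or_eq with h2 | h2
      · have := h.far i hi h2
        push_cast at this ⊢
        linarith
      · rw [h2]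
        have := (h.start i hi h2).2
        simp only [add_sub_cancel_left, sub_self, Int.cast_zero, zero_mul, add_zero]
        linarith
  -- Ties: a point equal to the newest one cannot have been put into an earlier cell, because `far`
  -- places those cells strictly before the start of the current cell.
  have hx : ∀ i ∈ done, x k ≤ x i → f i = cur' := by
    intro i hi he
    by_contra hne
    have hlt : f i < cur' := lt_of_le_of_ne (hle i hi) hne
    have h3 := hfar i hi hlt
    have h5 : (0 : ℝ) ≤ ((cur' - f i - 1 : ℤ) : ℝ) := by exact_mod_cast (by omega)
    nlinarith [mul_nonneg h5 hδ.le]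
  have hgap : ∀ i ∈ done, ((cur' - f i - 1 : ℤ) : ℝ) * δ ≤ x k - x i := by
    intro i hi
    rcases (hle i hi).lt_or_eq with h2 | h2
    · have := hfar i hi h2; linarith
    · rw [h2]
      have := hmax i hi
      push_cast; linarith
  simp only [← List.concat_eq_append]
  refine ⟨?_, ?_, ?_, ?_, Or.inr ⟨k, by simp, hk'⟩, ?_, ?_, ?_⟩
  all_goals simp only [List.concat_eq_append, List.mem_append, List.mem_singleton]
  · rintro i (hi | rfl)
    · rw [hf i hi]; exact h.nonneg i hi
    · rwa [hk']
  · rintro i (hi | rfl)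
    · rw [hf i hi]; exact hle i hi
    · rw [hk']
  · rintro i (hi | rfl)
    · rw [hf i hi]; exact hstart i hi
    · exact fun _ => hok
  · rintro i (hi | rfl)
    · rw [hf i hi]; exact hfar i hi
    · rw [hk']; exact fun h => absurd h (lt_irrefl _)
  · rintro i (hi | rfl) j (hj | rfl)
    · rw [hf i hi, hf j hj]; exact h.same i hi j hj
    · rw [hf i hi, hk']
      intro he
      have := hstart i hi he; linarith [hok.2]
    · rw [hf j hj, hk']
      intro he
      have := hmax j hj; linarith
    · intro _; linarith
  · rintro i (hi | rfl) j (hj | rfl)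
    · rw [hf i hi, hf j hj]; exact h.mono i hi j hj
    · rw [hf i hi, hk']; exact fun _ => hle i hi
    · rw [hf j hj, hk']; exact fun he => (hx j hj he).ge
    · exact fun _ => le_rfl
  · rintro i (hi | rfl) j (hj | rfl)
    · rw [hf i hi, hf j hj]; exact h.gap i hi j hj
    · rw [hf i hi, hk']; exact fun _ => hgap i hi
    · rw [hf j hj, hk']
      intro he
      rw [hx j hj he]
      push_cast; linarith
    · intro _; push_cast; linarith

theorem scanBody_loopFree (src A out : ℕ) (δ : ℚ) : (scanBody src A out δ).LoopFree := by
  simp [scanBody, Prog.LoopFree]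

/-- Running time of the numbering of `n` points by cells. -/
def compressCost (n : ℕ) : ℕ := sortCost n + 2 + (n + 1) * ((scanBody 0 0 0 0).costBound + 9)

theorem compressProg_runs {src A out n : ℕ} (hAo : A ≠ out) {x : ℕ → ℝ} {s : State} {δ : ℚ}
    (hδ : 0 < δ) (hA : s.intArr A = []) (ho : s.intArr out = [])
    (hsrc : s.realArr src = tab n x) :
    Runs (compressProg src A out δ) s (compressCost n) (fun s' =>
      ∃ c : ℕ → ℤ, s'.intArr out = tab n c ∧ IsCells n δ x c) := by
  have hscan : ∀ s₀ : State, s₀.realArr src = tab n x → s₀.intReg 24 = 0 →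
      (∃ pre l : List ℕ, s₀.intArr A = (pre ++ l).map (fun k : ℕ => (k : ℤ)) ∧
        l.Perm (List.range n) ∧ l.Pairwise (fun i j => x i ≤ x j) ∧
        s₀.intReg 20 = n ∧ s₀.intReg 21 = pre.length ∧ s₀.intArr out = tab n (fun _ => 0)) →
      Runs (forLoop 27 (.reg 20) (scanBody src A out δ)) s₀
        ((n + 1) * ((scanBody 0 0 0 0).costBound + 1 + 8)) (fun s' =>
        ∃ c : ℕ → ℤ, s'.intArr out = tab n c ∧ IsCells n δ x c) := by
    rintro s₀ hsrc h24 ⟨pre, l, hA, hp, hs, h20, h21, ho⟩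
    have hlen : l.length = n := by simpa using hp.length_eq
    have hnd : l.Nodup := hp.nodup_iff.2 List.nodup_range
    have hmem : ∀ i ∈ l, i < n := fun i hi => by simpa using hp.mem_iff.1 hi
    have hmodR : ∀ y ∈ ([20, 21] : List ℕ),
        ¬ (forLoop 27 (.reg 20) (scanBody src A out δ)).Mod (.ireg y) := by
      simp [scanBody, forLoop_mod, Prog.Mod]
    have hmodA : ¬ (forLoop 27 (.reg 20) (scanBody src A out δ)).Mod (.iarr A) := by
      simp [scanBody, forLoop_mod, Prog.Mod, hAo]
    have hmodS : ¬ (forLoop 27 (.reg 20) (scanBody src A out δ)).Mod (.rarr src) := by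
      simp [scanBody, forLoop_mod, Prog.Mod]
    -- After `k` points at most `k` cells are in use; the maximum with one covers `k = 0`, when the
    -- cell counter is already zero. This gives `c i < n` in the end.
    refine Runs.mono (Runs.forLoop n (scanBody 0 0 0 0).costBound (fun k s' => ∃ f : ℕ → ℤ,
      s'.intArr out = tab n f ∧ 0 ≤ s'.intReg 24 ∧ s'.intReg 24 + 1 ≤ max 1 (k : ℤ) ∧
      ScanInv δ x f (s'.intReg 24) (s'.realReg 0) (l.take k)) ?_ ?_ ?_ ?_) le_rfl ?_
    · exact ⟨fun _ => 0, by simpa using ho, by simp [h24], by simp [h24],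
        by simp, by simp, by simp, by simp, by simp, by simp, by simp, by simp⟩
    · simp [scanBody, Prog.Mod]
    · intro i _ s' hag _
      simp only [IExpr.eval]
      rw [hag.ireg 20 (hmodR 20 (by simp)), h20]
    · rintro k hk s' hag h27 ⟨f, hf, h0, hle, hI⟩
      have hkl : k < l.length := by omega
      have h21' := hag.ireg 21 (hmodR 21 (by simp))
      have hA' := hag.iarr A hmodA
      have hs' := hag.rarr src hmodS
      have hrd : readAt (s'.intArr A) (s'.intReg 21 + k) = (l[k] : ℤ) := by
        rw [hA', hA, readAt_map_cast (i := pre.length + k) (by rw [h21', h21]; push_cast; rfl)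
          (by simp; omega)]
        simp
      have hkey : readAt (s'.realArr src) (l[k] : ℤ) = x l[k] := by
        rw [hs', hsrc, readAt_tab rfl (hmem _ (List.getElem_mem hkl))]
      have hnot : l[k] ∉ l.take k := by
        intro hh
        obtain ⟨j, hj, he⟩ := List.mem_take_iff_getElem.1 hh
        have := (hnd.getElem_inj_iff).1 he
        omega
      have hmax : ∀ i ∈ l.take k, x i ≤ x l[k] := by
        intro i hi
        obtain ⟨j, hj, rfl⟩ := List.mem_take_iff_getElem.1 hi
        exact List.pairwise_iff_getElem.1 hs _ _ _ _ (by omega)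
      have htk : l.take (k + 1) = l.take k ++ [l[k]] := by simp
      have hδ' : (0 : ℝ) < δ := by exact_mod_cast hδ
      have hstep := fun cur' o' => hI.step hδ' hnot hmax (cur' := cur') (o' := o')
      refine Prog.LoopFree.runs_of_wp (scanBody_loopFree src A out δ) ?_
      simp only [scanBody, wp_seq, wp_setInt, wp_branch, wp_setReal, wp_skip, wp_storeInt,
        BExpr.Holds, IExpr.eval, RExpr.eval, State.setReg_intReg, State.setReg_intArr,
        State.setReg_realArr, State.setReg_realReg, State.setRReg_intReg, State.setRReg_intArr,
        h27, hrd, Function.update_self, State.setRReg_realReg, State.setRReg_realArr, hkey, hf,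
        writeAt_tab rfl]
      have hne : (24 : ℕ) ≠ 23 := by norm_num
      have hne' : (23 : ℕ) ≠ 24 := by norm_num
      have hne2 : (27 : ℕ) ≠ 23 := by norm_num
      simp only [Function.update_of_ne hne, Function.update_of_ne hne', Function.update_of_ne hne2,
        Function.update_self, h27]
      rw [htk]
      refine ⟨fun hk0 => ?_, fun hk0 => ⟨fun hb => ?_, fun hb => ?_⟩⟩
      · have hk0 : k = 0 := by omega
        refine ⟨Function.update f l[k] (s'.intReg 24), by simp, by simpa using h0, ?_, ?_⟩
        · subst hk0; simpa using hle
        · simpa using hstep (s'.intReg 24) (x l[k]) h0 (Or.inl ⟨by simp [hk0], rfl⟩)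
      · refine ⟨Function.update f l[k] (s'.intReg 24 + 1), by simp [writeAt_tab rfl], ?_, ?_, ?_⟩
        · simp; omega
        · simp; omega
        · simpa [hkey] using hstep (s'.intReg 24 + 1) (x l[k]) (by omega) (Or.inr (Or.inr ⟨rfl, rfl, hb⟩))
      · refine ⟨Function.update f l[k] (s'.intReg 24), by simp, by simpa using h0, ?_, ?_⟩
        · simp; omega
        -- The current cell is occupied, and a point in it shows that its start does not exceed the
        -- new point; the failed test gives the other bound.
        · obtain he | ⟨i, hi, he⟩ := hI.last
          · exfalso
            have h3 := congrArg List.length he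
            rw [List.length_take, List.length_nil] at h3
            omega
          · have h1 := (hI.start i hi he).1
            have h2 := hmax i hi
            simpa using hstep (s'.intReg 24) _ h0 (Or.inr (Or.inl ⟨rfl, rfl, h1.trans h2,
              not_le.1 hb⟩))
    · rintro s' - ⟨c, hc, h0, hle, hI⟩
      rw [List.take_of_length_le hlen.le] at hI
      have hin : ∀ i < n, i ∈ l := fun i hi => hp.mem_iff.2 (by simpa using hi)
      refine ⟨c, hc, fun i hi => hI.nonneg i (hin i hi), fun i hi => ?_,
        fun i hi j hj => hI.same i (hin i hi) j (hin j hj),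
        fun i hi j hj => hI.mono i (hin i hi) j (hin j hj),
        fun i hi j hj => hI.gap i (hin i hi) j (hin j hj)⟩
      have := hI.le i (hin i hi)
      omega
  refine Runs.mono (Runs.seq ((sortProg_runs hAo hA ho hsrc).mono le_rfl fun s₁ hag hs₁ =>
    Runs.seq (T := 2) ⟨_, _, .setInt _ _ _, by simp [IExpr.cost], hscan _ ?_ ?_ ?_⟩)) ?_
    (fun _ _ h => h)
  · have := hag.rarr src (by
      simp [sortProg, passProg, forLoop_mod, refillProg, emitProg, Prog.Mod])
    simpa [hsrc] using this
  · simp [IExpr.eval]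
  · simpa using hs₁
  · simp only [compressCost]
    ring_nf; omega

theorem compressProg_basic (src A out : ℕ) (δ : ℚ) : (compressProg src A out δ).Basic := by
  simp [compressProg, sortProg, passProg, forLoop_basic, refillProg, emitProg, scanBody, Prog.Basic]

theorem compressProg_mod {src A out : ℕ} {δ : ℚ} {l : Loc} :
    (compressProg src A out δ).Mod l → l = .iarr A ∨ l = .iarr out ∨ l = .rreg 0 ∨
      ∃ r, 20 ≤ r ∧ r ≤ 27 ∧ l = .ireg r := by
  intro h
  cases l with
  | ireg r =>
    simp [compressProg, sortProg, passProg, forLoop_mod, refillProg, emitProg, scanBody,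
      Prog.Mod] at h ⊢
    omega
  | _ =>
    simp [compressProg, sortProg, passProg, forLoop_mod, refillProg, emitProg, scanBody,
      Prog.Mod] at h ⊢
    try tauto

end RealRAM

/-! ### Replacing a disk by four disks -/

namespace UnitDisk

/-- Points of a disk of radius `2` that lie in a common narrow cap are close to each other. -/
theorem cap_dist {u v a b c d : ℝ} (huv : u ^ 2 + v ^ 2 = 1) (hq : a ^ 2 + b ^ 2 ≤ 4)
    (hr : c ^ 2 + d ^ 2 ≤ 4) (hqw : 7 / 4 ≤ u * a + v * b) (hrw : 7 / 4 ≤ u * c + v * d) :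
    (a - c) ^ 2 + (b - d) ^ 2 ≤ 39 / 10 := by
  -- Coordinates along the axis of the cap and perpendicular to it, for both points.
  obtain ⟨x, hx⟩ : ∃ x, x = u * a + v * b := ⟨_, rfl⟩
  obtain ⟨y, hy⟩ : ∃ y, y = u * b - v * a := ⟨_, rfl⟩
  obtain ⟨z, hz⟩ : ∃ z, z = u * c + v * d := ⟨_, rfl⟩
  obtain ⟨t, ht⟩ : ∃ t, t = u * d - v * c := ⟨_, rfl⟩
  have h1 : x ^ 2 + y ^ 2 ≤ 4 := by
    have : x ^ 2 + y ^ 2 = (u ^ 2 + v ^ 2) * (a ^ 2 + b ^ 2) := by rw [hx, hy]; ring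
    rw [this, huv]; linarith
  have h2 : z ^ 2 + t ^ 2 ≤ 4 := by
    have : z ^ 2 + t ^ 2 = (u ^ 2 + v ^ 2) * (c ^ 2 + d ^ 2) := by rw [hz, ht]; ring
    rw [this, huv]; linarith
  have h3 : (a - c) ^ 2 + (b - d) ^ 2 = (x - z) ^ 2 + (y - t) ^ 2 := by
    have : (x - z) ^ 2 + (y - t) ^ 2 = (u ^ 2 + v ^ 2) * ((a - c) ^ 2 + (b - d) ^ 2) := by
      rw [hx, hy, hz, ht]; ring
    rw [this, huv]; ring
  rw [← hx] at hqw
  rw [← hz] at hrw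
  rw [h3]
  -- By the parallelogram law the left side is at most `16 - (x + z) ^ 2`, and `x + z ≥ 7 / 2` makes
  -- this at most `15 / 4`.
  nlinarith [sq_nonneg (y + t), sq_nonneg (x + z), mul_nonneg (sub_nonneg.2 hqw) (sub_nonneg.2 hrw)]

/-- Since `91 / 4 = 13 * (7 / 4)`, the conclusion places the point in the cap around the unit vector
`(-12/13, -5/13)`. For `b ≤ 0` the inequality `a * b ≥ b ^ 2` bounds the square of `12 a + 5 b`
below by `144 (a ^ 2 + b ^ 2)`; for `b ≥ 0` the ordinate is tiny and `a` is close to `-2`. -/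
theorem quadrant_bound {a b : ℝ} (h : 79 / 20 ≤ a ^ 2 + b ^ 2) (hb : b ≤ 13 / 100) (hab : a ≤ b) :
    12 * a + 5 * b ≤ -(91 / 4) := by
  rcases le_total b 0 with hb0 | hb0
  · have h1 : 144 * (79 / 20) ≤ (12 * a + 5 * b) ^ 2 := by
      nlinarith [mul_nonneg (neg_nonneg.2 hb0) (sub_nonneg.2 hab), mul_nonneg
        (neg_nonneg.2 hb0) (neg_nonneg.2 (hab.trans hb0))]
    have h2 : 12 * a + 5 * b ≤ 0 := by linarith
    generalize 12 * a + 5 * b = t at h1 h2 ⊢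
    by_contra hcon
    nlinarith
  · have h1 : b ^ 2 ≤ 17 / 1000 := by nlinarith
    have h2 : 393 / 100 ≤ a ^ 2 := by linarith
    have h3 : a ≤ -(198 / 100) := by
      by_contra hcon
      have h4 : a ≤ 13 / 100 := hab.trans hb
      nlinarith
    linarith

theorem sq_add_sq_eq_zero {x y : ℝ} (h : x ^ 2 + y ^ 2 = 0) : x = 0 ∧ y = 0 :=
  ⟨pow_eq_zero_iff two_ne_zero |>.1 (by linarith [sq_nonneg x, sq_nonneg y]),
    pow_eq_zero_iff two_ne_zero |>.1 (by linarith [sq_nonneg x, sq_nonneg y])⟩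

theorem abs_le_one_of_sq_add {x y : ℝ} (h : x ^ 2 + y ^ 2 = 1) : |x| ≤ 1 :=
  abs_le_of_sq_le_sq (by linarith [sq_nonneg y]) one_pos.le

theorem normalize_unit {x y ρ : ℝ} (hρ : 0 < ρ) (hρ2 : ρ ^ 2 = x ^ 2 + y ^ 2) :
    (x / ρ) ^ 2 + (y / ρ) ^ 2 = 1 := by
  rw [div_pow, div_pow, ← add_div, ← hρ2]
  exact div_self (by positivity)

/-- Rounding to multiples of 1/20 keeps the set of directions finite; the sign is reversed because a
direction opposite to a given displacement is wanted. -/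
theorem round_direction {z : ℝ} (hz : |z| ≤ 1) : |(-round (20 * z) : ℤ)| ≤ 20 ∧
    |((-round (20 * z) : ℤ) : ℝ) + 20 * z| ≤ 1 / 2 := by
  have h1 := abs_sub_round (20 * z)
  constructor
  · rw [abs_neg]
    have h3 : |(round (20 * z) : ℝ)| < 21 := by
      have := abs_le.1 h1; have := abs_le.1 hz
      rw [abs_lt]; constructor <;> linarith
    have h4 : |round (20 * z)| < 21 := by exact_mod_cast h3
    omega
  · push_cast
    rwa [neg_add_eq_sub]

/-- Two unit vectors, the second one of which is on the positive side of a vector nearly opposite to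
the first one, form a nearly right or obtuse angle. -/
theorem inner_le_of_opposite {f g f' g' p q : ℝ} (hf' : |f'| ≤ 1) (hg' : |g'| ≤ 1)
    (hp : |p + 20 * f| ≤ 1 / 2) (hq : |q + 20 * g| ≤ 1 / 2) (h : 0 ≤ p * f' + q * g') :
    f * f' + g * g' ≤ 1 / 20 := by
  -- The two estimates add up to `20 (f f' + g g') + (p f' + q g') ≤ 1`, and the second summand is
  -- nonnegative.
  have h4 : (p + 20 * f) * f' ≤ 1 / 2 * 1 :=
    (le_abs_self _).trans ((abs_mul _ _).trans_le (mul_le_mul hp hf' (abs_nonneg _) (by norm_num)))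
  have h5 : (q + 20 * g) * g' ≤ 1 / 2 * 1 :=
    (le_abs_self _).trans ((abs_mul _ _).trans_le (mul_le_mul hq hg' (abs_nonneg _) (by norm_num)))
  linarith

/-- The part of the boundary of a disk that is away from two directions at a nearly right or obtuse
angle is covered by two caps. -/
theorem exists_two_caps {c s : ℝ} (hcs : c ^ 2 + s ^ 2 = 1) (hs : 0 ≤ s) (hc : c ≤ 1 / 20) :
    ∃ u v u' v' : ℝ, u ^ 2 + v ^ 2 = 1 ∧ u' ^ 2 + v' ^ 2 = 1 ∧
      ∀ a b : ℝ, a ^ 2 + b ^ 2 ≤ 4 → 79 / 20 ≤ a ^ 2 + b ^ 2 → a ≤ 1 / 100 →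
        a * c + b * s ≤ 1 / 100 → 7 / 4 ≤ u * a + v * b ∨ 7 / 4 ≤ u' * a + v' * b := by
  -- If the two directions are almost opposite, the remaining boundary points are near the top and
  -- bottom of the disk, and the caps point up and down. Otherwise these points lie essentially in
  -- the third quadrant, whose halves fit into one cap each.
  by_cases h : c < -(19 / 20)
  · refine ⟨0, 1, 0, -1, by norm_num, by norm_num, fun a b h4 h5 ha hab => ?_⟩
    have hs' : s ≤ 8 / 25 := by nlinarith
    have hb2 : |b| ≤ 2 := abs_le_of_sq_le_sq (by nlinarith [sq_nonneg a]) (by norm_num)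
    rcases le_total 0 b with hb | hb
    · left
      have h1 : a * c ≤ 1 / 100 := by nlinarith [mul_nonneg hb hs]
      have h2 : -(1 / 50) ≤ a := by nlinarith
      have h3 : a ^ 2 ≤ 1 / 1000 := by nlinarith
      nlinarith
    · right
      have hb3 : -2 ≤ b := (abs_le.1 hb2).1
      have h1 : a * c ≤ 13 / 20 := by nlinarith
      have h2 : -(7 / 10) ≤ a := by nlinarith
      have h3 : a ^ 2 ≤ 1 / 2 := by nlinarith
      nlinarith
  · rw [not_lt] at h
    -- The triple 5, 12, 13 provides rational unit vectors close to the axes of the two halves of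
    -- the quadrant.
    refine ⟨-(12 / 13), -(5 / 13), -(5 / 13), -(12 / 13), by norm_num, by norm_num,
      fun a b h4 h5 ha hab => ?_⟩
    have hs' : 3 / 10 ≤ s := by nlinarith
    have ha2 : |a| ≤ 2 := abs_le_of_sq_le_sq (by nlinarith [sq_nonneg b]) (by norm_num)
    have ha3 : -2 ≤ a := (abs_le.1 ha2).1
    have hb : b ≤ 13 / 100 := by
      rcases le_total 0 c with hc0 | hc0
      · have hs2 : 9 / 10 ≤ s := by nlinarith
        have h1 : -(1 / 10) ≤ a * c := by nlinarith
        have h2 : b * s ≤ 11 / 100 := by linarith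
        by_contra hcon
        nlinarith
      · have h1 : -(1 / 100) ≤ a * c := by nlinarith
        have h2 : b * s ≤ 2 / 100 := by linarith
        by_contra hcon
        nlinarith
    rcases le_total a b with hle | hle
    · left
      have := quadrant_bound h5 hb hle
      linarith
    · right
      have := quadrant_bound (by rwa [add_comm]) (ha.trans (by norm_num)) hle
      linarith

/-- The two tests for being outside a disk whose center has been moved a little. -/
theorem outside_moved {a b x y : ℝ} (hq : a ^ 2 + b ^ 2 ≤ 4) (he : x ^ 2 + y ^ 2 ≤ 1 / 10000)
    (h : 4 < (a - x) ^ 2 + (b - y) ^ 2) {ρ : ℝ} (hρ : 0 < ρ) (hρ2 : ρ ^ 2 = x ^ 2 + y ^ 2) :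
    79 / 20 ≤ a ^ 2 + b ^ 2 ∧ a * (x / ρ) + b * (y / ρ) ≤ 1 / 100 := by
  have hρ1 : ρ ≤ 1 / 100 := by nlinarith
  have hin : a * (x / ρ) + b * (y / ρ) = (a * x + b * y) / ρ := by field_simp
  constructor
  -- Cauchy–Schwarz via Lagrange's identity: `a x + b y ≥ -2 ρ`, so moving the center changes the
  -- squared distance by at most `4 ρ + ρ ^ 2`.
  · have h1 : (a * x + b * y) ^ 2 ≤ (2 * ρ) ^ 2 := by
      have e : (a * x + b * y) ^ 2 + (a * y - b * x) ^ 2 = (a ^ 2 + b ^ 2) * ρ ^ 2 := by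
        rw [hρ2]; ring
      nlinarith [sq_nonneg (a * y - b * x), sq_nonneg ρ]
    have h2 := (abs_le.1 (abs_le_of_sq_le_sq h1 (by positivity))).1
    nlinarith
  -- Expanding the square in `h` gives `2 (a x + b y) < ρ ^ 2`, so the normalized inner product is
  -- below `ρ / 2`.
  · rw [hin, div_le_iff₀ hρ]
    nlinarith

/-- Think of `(ex i j, ey i j)` as the displacement of the candidate for direction `(i, j)` from the
center of the disk. The candidate for `(0, 0)` may be displaced arbitrarily; `(i, j)` is then chosen
as the rounded opposite of its displacement, and extremality makes the two displacements nearly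
perpendicular or worse. A point outside both moved disks satisfies the assumptions of
`exists_two_caps` in the frame of the first displacement. -/
theorem exists_caps (ex ey : ℤ → ℤ → ℝ)
    (hη : ∀ i j : ℤ, |i| ≤ 20 → |j| ≤ 20 → ex i j ^ 2 + ey i j ^ 2 ≤ 1 / 10000)
    (hext : ∀ i j : ℤ, |i| ≤ 20 → |j| ≤ 20 → 0 ≤ i * ex i j + j * ey i j) :
    ∃ i j : ℤ, |i| ≤ 20 ∧ |j| ≤ 20 ∧ ∃ u v u' v' : ℝ, u ^ 2 + v ^ 2 = 1 ∧ u' ^ 2 + v' ^ 2 = 1 ∧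
      ∀ a b : ℝ, a ^ 2 + b ^ 2 ≤ 4 → (a - ex 0 0) ^ 2 + (b - ey 0 0) ^ 2 ≤ 4 ∨
        (a - ex i j) ^ 2 + (b - ey i j) ^ 2 ≤ 4 ∨ 7 / 4 ≤ u * a + v * b ∨
        7 / 4 ≤ u' * a + v' * b := by
  obtain ⟨x, hx⟩ : ∃ x, x = ex 0 0 := ⟨_, rfl⟩
  obtain ⟨y, hy⟩ : ∃ y, y = ey 0 0 := ⟨_, rfl⟩
  have hxy : x ^ 2 + y ^ 2 ≤ 1 / 10000 := hx ▸ hy ▸ hη 0 0 (by norm_num) (by norm_num)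
  rw [← hx, ← hy]
  rcases (add_nonneg (sq_nonneg x) (sq_nonneg y)).eq_or_lt' with h0 | h0
  -- Without displacement the first moved disk is the disk itself, and the caps are arbitrary.
  · refine ⟨0, 0, by norm_num, by norm_num, 1, 0, 1, 0, by norm_num, by norm_num,
      fun a b h => Or.inl ?_⟩
    obtain ⟨hx0, hy0⟩ := sq_add_sq_eq_zero h0
    simpa [hx0, hy0] using h
  obtain ⟨ρ, hρ⟩ : ∃ ρ, ρ = √(x ^ 2 + y ^ 2) := ⟨_, rfl⟩
  have hρ0 : 0 < ρ := hρ ▸ Real.sqrt_pos.2 h0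
  have hρ2 : ρ ^ 2 = x ^ 2 + y ^ 2 := by rw [hρ, Real.sq_sqrt h0.le]
  obtain ⟨f, hf⟩ : ∃ f, f = x / ρ := ⟨_, rfl⟩
  obtain ⟨g, hg⟩ : ∃ g, g = y / ρ := ⟨_, rfl⟩
  have hfg : f ^ 2 + g ^ 2 = 1 := hf ▸ hg ▸ normalize_unit hρ0 hρ2
  obtain ⟨hi1, hi2⟩ := round_direction (abs_le_one_of_sq_add hfg)
  obtain ⟨hj1, hj2⟩ := round_direction (abs_le_one_of_sq_add ((add_comm _ _).trans hfg))
  obtain ⟨i, hi⟩ : ∃ i : ℤ, i = -round (20 * f) := ⟨_, rfl⟩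
  obtain ⟨j, hj⟩ : ∃ j : ℤ, j = -round (20 * g) := ⟨_, rfl⟩
  rw [← hi] at hi1 hi2
  rw [← hj] at hj1 hj2
  refine ⟨i, j, hi1, hj1, ?_⟩
  obtain ⟨x', hx'⟩ : ∃ x, x = ex i j := ⟨_, rfl⟩
  obtain ⟨y', hy'⟩ : ∃ y, y = ey i j := ⟨_, rfl⟩
  have hxy' : x' ^ 2 + y' ^ 2 ≤ 1 / 10000 := hx' ▸ hy' ▸ hη i j hi1 hj1
  have hdir : 0 ≤ i * x' + j * y' := hx' ▸ hy' ▸ hext i j hi1 hj1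
  rw [← hx', ← hy']
  rcases (add_nonneg (sq_nonneg x') (sq_nonneg y')).eq_or_lt' with h0' | h0'
  · refine ⟨1, 0, 1, 0, by norm_num, by norm_num, fun a b h => Or.inr (Or.inl ?_)⟩
    obtain ⟨hx0, hy0⟩ := sq_add_sq_eq_zero h0'
    simpa [hx0, hy0] using h
  obtain ⟨ρ', hρ'⟩ : ∃ ρ, ρ = √(x' ^ 2 + y' ^ 2) := ⟨_, rfl⟩
  have hρ0' : 0 < ρ' := hρ' ▸ Real.sqrt_pos.2 h0'
  have hρ2' : ρ' ^ 2 = x' ^ 2 + y' ^ 2 := by rw [hρ', Real.sq_sqrt h0'.le]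
  obtain ⟨f', hf'⟩ : ∃ f, f = x' / ρ' := ⟨_, rfl⟩
  obtain ⟨g', hg'⟩ : ∃ g, g = y' / ρ' := ⟨_, rfl⟩
  have hfg' : f' ^ 2 + g' ^ 2 = 1 := hf' ▸ hg' ▸ normalize_unit hρ0' hρ2'
  have hdir' : 0 ≤ i * f' + j * g' := by
    have : i * f' + j * g' = (i * x' + j * y') / ρ' := by rw [hf', hg']; field_simp
    rw [this]; positivity
  obtain ⟨c, hc⟩ : ∃ c, c = f * f' + g * g' := ⟨_, rfl⟩
  obtain ⟨s, hs⟩ : ∃ s, s = f * g' - g * f' := ⟨_, rfl⟩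
  have hcs : c ^ 2 + s ^ 2 = 1 := by
    have : c ^ 2 + s ^ 2 = (f ^ 2 + g ^ 2) * (f' ^ 2 + g' ^ 2) := by rw [hc, hs]; ring
    rw [this, hfg, hfg']; norm_num
  have hc20 : c ≤ 1 / 20 := hc ▸ inner_le_of_opposite (abs_le_one_of_sq_add hfg')
    (abs_le_one_of_sq_add ((add_comm _ _).trans hfg')) hi2 hj2 hdir'
  -- A reflection across the first displacement brings the second one into the upper half plane, as
  -- `exists_two_caps` demands.
  obtain ⟨σ, hσ, hσs⟩ : ∃ σ : ℝ, σ ^ 2 = 1 ∧ 0 ≤ σ * s := by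
    rcases le_total 0 s with h | h
    · exact ⟨1, by norm_num, by linarith⟩
    · exact ⟨-1, by norm_num, by linarith⟩
  obtain ⟨u, v, u', v', huv, huv', hcap⟩ := exists_two_caps (c := c) (s := σ * s)
    (by rw [mul_pow, hσ, one_mul, hcs]) hσs hc20
  -- The axes of the caps, turned back from the possibly reflected frame of `(f, g)`.
  refine ⟨u * f - σ * v * g, u * g + σ * v * f, u' * f - σ * v' * g, u' * g + σ * v' * f, ?_, ?_, ?_⟩
  · have : (u * f - σ * v * g) ^ 2 + (u * g + σ * v * f) ^ 2 =
        (u ^ 2 + σ ^ 2 * v ^ 2) * (f ^ 2 + g ^ 2) := by ring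
    rw [this, hσ, hfg, one_mul, huv]; norm_num
  · have : (u' * f - σ * v' * g) ^ 2 + (u' * g + σ * v' * f) ^ 2 =
        (u' ^ 2 + σ ^ 2 * v' ^ 2) * (f ^ 2 + g ^ 2) := by ring
    rw [this, hσ, hfg, one_mul, huv']; norm_num
  · intro a b hab
    by_cases hd : (a - x) ^ 2 + (b - y) ^ 2 ≤ 4
    · exact Or.inl hd
    by_cases hd' : (a - x') ^ 2 + (b - y') ^ 2 ≤ 4
    · exact Or.inr (Or.inl hd')
    obtain ⟨h1, h2⟩ := outside_moved hab hxy (not_le.1 hd) hρ0 hρ2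
    obtain ⟨-, h3⟩ := outside_moved hab hxy' (not_le.1 hd') hρ0' hρ2'
    rw [← hf, ← hg] at h2
    rw [← hf', ← hg'] at h3
    have hnorm : (a * f + b * g) ^ 2 + (σ * (b * f - a * g)) ^ 2 = a ^ 2 + b ^ 2 := by
      have : (a * f + b * g) ^ 2 + (σ * (b * f - a * g)) ^ 2 =
        a ^ 2 * (f ^ 2 + σ ^ 2 * g ^ 2) + b ^ 2 * (g ^ 2 + σ ^ 2 * f ^ 2) +
          2 * a * b * f * g * (1 - σ ^ 2) := by ring
      rw [this, hσ, one_mul, one_mul, hfg, add_comm (g ^ 2), hfg]; ring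
    have hinner : (a * f + b * g) * c + σ * (b * f - a * g) * (σ * s) = a * f' + b * g' := by
      have : (a * f + b * g) * c + σ * (b * f - a * g) * (σ * s) =
        (a * f + b * g) * c + σ ^ 2 * ((b * f - a * g) * s) := by ring
      rw [this, hσ, one_mul, hc, hs]
      have : (a * f + b * g) * (f * f' + g * g') + (b * f - a * g) * (f * g' - g * f') =
        (f ^ 2 + g ^ 2) * (a * f' + b * g') := by ring
      rw [this, hfg, one_mul]
    rcases hcap (a * f + b * g) (σ * (b * f - a * g)) (by rw [hnorm]; exact hab)
      (by rw [hnorm]; exact h1) h2 (by rw [hinner]; exact h3) with h | h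
    · exact Or.inr (Or.inr (Or.inl (h.trans (le_of_eq (by ring)))))
    · exact Or.inr (Or.inr (Or.inr (h.trans (le_of_eq (by ring)))))

/-- A representative close to a point of a cap dominates the cap. -/
theorem cap_dominated {u v a b c d x y : ℝ} (huv : u ^ 2 + v ^ 2 = 1) (hq : a ^ 2 + b ^ 2 ≤ 4)
    (hr : c ^ 2 + d ^ 2 ≤ 4) (hqw : 7 / 4 ≤ u * a + v * b) (hrw : 7 / 4 ≤ u * c + v * d)
    (hx : (a - x) ^ 2 + (b - y) ^ 2 ≤ 1 / 10000) : (c - x) ^ 2 + (d - y) ^ 2 ≤ 4 := by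
  have h := cap_dist huv hr hq hrw hqw
  -- Weighted inequality `|A + B|² ≤ (1 + 1/100) |A|² + 101 |B|²` with `|A|² ≤ 39 / 10` and `|B|² ≤
  -- 1 / 10000`; the right side stays below `4`.
  nlinarith [sq_nonneg ((c - a) - 100 * (a - x)), sq_nonneg ((d - b) - 100 * (b - y)),
    sq_nonneg (100 * (c - x) - 101 * (c - a)), sq_nonneg (100 * (d - y) - 101 * (d - b))]

/-! ### The shifted grids and the coreset -/

/-- The first component of a direction vector. -/
def dirX (d : ℕ) : ℤ := ((d / 41 : ℕ) : ℤ) - 20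

/-- The second component of a direction vector. -/
def dirY (d : ℕ) : ℤ := ((d % 41 : ℕ) : ℤ) - 20

/-- Horizontal offset of the `c`-th copy of a point. -/
def offX (R c : ℕ) : ℕ := if c = 2 ∨ c = 3 then 2 * R else if c = 4 then R else 0

/-- Vertical offset of the `c`-th copy of a point. -/
def offY (R c : ℕ) : ℕ := if c = 1 ∨ c = 3 then 2 * R else if c = 4 then R else 0

theorem offX_le (R c : ℕ) : offX R c ≤ 2 * R := by unfold offX; split_ifs <;> omega

theorem offY_le (R c : ℕ) : offY R c ≤ 2 * R := by unfold offY; split_ifs <;> omega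

/-- A list of points, the first `n` of which are those of `P` and the next `n'` of which are those
of `P'`, with the numbers of their columns and rows in a fine grid.  For the shift `t` of the coarse
grid, the `(5 t + c)`-th copy of a point lies in the coarse cell with number `id`; the copies with
`c < 4` are used for points of `P`, those with `c = 4` for points of `P'`. -/
structure Inst where
  N : ℕ
  R : ℕ
  n : ℕ
  n' : ℕ
  px : ℕ → ℝ
  py : ℕ → ℝ
  cx : ℕ → ℤ
  cy : ℕ → ℤ
  id : ℕ → ℕ → ℕ

namespace Inst

/-- Total number of points. -/
def tot (S : Inst) : ℕ := S.n + S.n'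

variable (S : Inst)

/-- Width of an enlarged coarse cell. -/
def width : ℕ := S.N + 2 * S.R

/-- Number of slots for candidates in a coarse cell. -/
def slots : ℕ := S.width * S.width * 1681

/-- First key of a coarse cell. -/
def keyA (i e : ℕ) : ℤ :=
  (S.cx i + ((e / 5 : ℕ) : ℤ) + (offX S.R (e % 5) : ℤ)) / (S.N : ℤ) * (S.N : ℤ) + ((e / 5 : ℕ) : ℤ)

/-- Second key of a coarse cell. -/
def keyB (i e : ℕ) : ℤ := (S.cy i + ((e / 5 : ℕ) : ℤ) + (offY S.R (e % 5) : ℤ)) / (S.N : ℤ)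

/-- Column relative to the enlarged coarse cell. -/
def relX (i e : ℕ) : ℤ := S.cx i + 2 * ((e / 5 : ℕ) : ℤ) + 2 * (S.R : ℤ) - S.keyA i e

/-- Row relative to the enlarged coarse cell. -/
def relY (i e : ℕ) : ℤ := S.cy i + ((e / 5 : ℕ) : ℤ) + 2 * (S.R : ℤ) - S.N * S.keyB i e

/-- The slot of a copy of a point inside its coarse cell. -/
def loc (i e d : ℕ) : ℕ := ((S.relX i e).toNat * S.width + (S.relY i e).toNat) * 1681 + d

/-- The global number of the slot of a copy of a point. -/
def slot (i e d : ℕ) : ℕ := S.id i e * S.slots + S.loc i e d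

/-- Squared distance. -/
def sqd (i j : ℕ) : ℝ := (S.px i - S.px j) ^ 2 + (S.py i - S.py j) ^ 2

/-- Extent of a point in a direction. -/
def val (d i : ℕ) : ℝ := dirX d * S.px i + dirY d * S.py i

/-- The properties of the fine grid and of the cell numbers. -/
structure Valid : Prop where
  N_pos : 0 < S.N
  R_le : 2 * S.R ≤ S.N
  near : ∀ i < S.tot, ∀ j < S.tot, S.sqd i j ≤ 4 → |S.cx i - S.cx j| ≤ S.R ∧ |S.cy i - S.cy j| ≤ S.R
  same : ∀ i < S.tot, ∀ j < S.tot, S.cx i = S.cx j → S.cy i = S.cy j → S.sqd i j ≤ 1 / 10000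
  sub : ∀ q < S.n', ∃ i < S.n, S.px i = S.px (S.n + q) ∧ S.py i = S.py (S.n + q)
  id_eq : ∀ i < S.tot, ∀ j < S.tot, ∀ e < 5 * S.N, ∀ e' < 5 * S.N,
    S.id i e = S.id j e' ↔ S.keyA i e = S.keyA j e' ∧ S.keyB i e = S.keyB j e'
  id_lt : ∀ i < S.tot, ∀ e < 5 * S.N, S.id i e < S.tot * (5 * S.N)

/-- A copy of a point of `P` together with a direction. -/
structure Event (i e d : ℕ) : Prop where
  i_lt : i < S.n
  e_lt : e < 5 * S.N
  e_mod : e % 5 < 4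
  d_lt : d < 1681

/-- Every slot contains an extreme one of the points that belong there. -/
structure CandSpec (cand : ℕ → ℤ) : Prop where
  extreme : ∀ i e d, S.Event i e d → ∃ i' e', S.Event i' e' d ∧ cand (S.slot i e d) = i' ∧
    S.slot i' e' d = S.slot i e d ∧ S.val d i ≤ S.val d i'
  event : ∀ σ < S.tot * (5 * S.N) * S.slots, 0 ≤ cand σ →
    ∃ i e d, S.Event i e d ∧ cand σ = i ∧ S.slot i e d = σ

/-- The candidates in the slots from `m` dominate the points of `P'` in the coarse cell `κ`. -/
def Feas (cand : ℕ → ℤ) (m : Finset ℕ) (κ : ℕ) : Prop :=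
  ∀ q < S.n', ∀ t < S.N, S.id (S.n + q) (5 * t + 4) = κ →
    ∃ j ∈ m, 0 ≤ cand (κ * S.slots + j) ∧ S.sqd (cand (κ * S.slots + j)).toNat (S.n + q) ≤ 4

/-- Every coarse cell has a smallest dominating selection. -/
def SelSpec (cand : ℕ → ℤ) (sel : ℕ → Finset ℕ) : Prop :=
  ∀ κ < S.tot * (5 * S.N), ∀ m ⊆ Finset.range S.slots, S.Feas cand m κ →
    S.Feas cand (sel κ) κ ∧ sel κ ⊆ Finset.range S.slots ∧ (sel κ).card ≤ m.card

/-- The point `i` is selected in some coarse cell for the shift `t`. -/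
def Flag (cand : ℕ → ℤ) (sel : ℕ → Finset ℕ) (i t : ℕ) : Prop :=
  ∃ c < 4, ∃ d < 1681, cand (S.slot i (5 * t + c) d) = i ∧
    S.loc i (5 * t + c) d ∈ sel (S.id i (5 * t + c))

variable {S}

/-! ### Arithmetic of cells, slots and copies -/

theorem digits_unique {a a' b b' k : ℕ} (h : a * k + b = a' * k + b') (hb : b < k) (hb' : b' < k) :
    a = a' ∧ b = b' := by
  have hk : 0 < k := by omega
  have h1 : (a * k + b) / k = a := by
    rw [add_comm, Nat.add_mul_div_right _ _ hk, Nat.div_eq_of_lt hb, zero_add]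
  have h2 : (a' * k + b') / k = a' := by
    rw [add_comm, Nat.add_mul_div_right _ _ hk, Nat.div_eq_of_lt hb', zero_add]
  have : a = a' := by rw [← h1, ← h2, h]
  subst this
  exact ⟨rfl, by omega⟩

theorem digits_lt {a b k l : ℕ} (ha : a < l) (hb : b < k) : a * k + b < l * k := by
  calc a * k + b < (a + 1) * k := by rw [add_mul]; omega
    _ ≤ l * k := Nat.mul_le_mul_right _ ha

theorem div_add_div (t c : ℕ) (hc : c < 5) : (5 * t + c) / 5 = t ∧ (5 * t + c) % 5 = c := by omega

/-- The relative column is the remainder modulo `N` of the column of the copy, plus `2R`, minus the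
offset of the copy, which is between `0` and `2R`. The summand `2t` in `relX` compensates for the
extra `t` stored in `keyA`. -/
theorem Valid.relX_bounds (hS : S.Valid) (i e : ℕ) :
    0 ≤ S.relX i e ∧ S.relX i e < S.width := by
  have hN : (0 : ℤ) < S.N := by exact_mod_cast hS.N_pos
  have h1 := Int.emod_nonneg (S.cx i + ((e / 5 : ℕ) : ℤ) + (offX S.R (e % 5) : ℤ)) hN.ne'
  have h2 := Int.emod_lt_of_pos (S.cx i + ((e / 5 : ℕ) : ℤ) + (offX S.R (e % 5) : ℤ)) hN
  have h3 := Int.emod_add_mul_ediv (S.cx i + ((e / 5 : ℕ) : ℤ) + (offX S.R (e % 5) : ℤ)) S.N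
  have h4 : ((offX S.R (e % 5) : ℕ) : ℤ) ≤ 2 * S.R := by exact_mod_cast offX_le _ _
  simp only [relX, keyA, width]
  simp only [Nat.cast_add, Nat.cast_mul, Nat.cast_ofNat]
  rw [mul_comm] at h3
  constructor <;> linarith [Int.natCast_nonneg (offX S.R (e % 5))]

theorem Valid.relY_bounds (hS : S.Valid) (i e : ℕ) :
    0 ≤ S.relY i e ∧ S.relY i e < S.width := by
  have hN : (0 : ℤ) < S.N := by exact_mod_cast hS.N_pos
  have h1 := Int.emod_nonneg (S.cy i + ((e / 5 : ℕ) : ℤ) + (offY S.R (e % 5) : ℤ)) hN.ne'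
  have h2 := Int.emod_lt_of_pos (S.cy i + ((e / 5 : ℕ) : ℤ) + (offY S.R (e % 5) : ℤ)) hN
  have h3 := Int.emod_add_mul_ediv (S.cy i + ((e / 5 : ℕ) : ℤ) + (offY S.R (e % 5) : ℤ)) S.N
  have h4 : ((offY S.R (e % 5) : ℕ) : ℤ) ≤ 2 * S.R := by exact_mod_cast offY_le _ _
  simp only [relY, keyB, width, Nat.cast_add, Nat.cast_mul, Nat.cast_ofNat]
  constructor <;> linarith [Int.natCast_nonneg (offY S.R (e % 5))]

theorem Valid.loc_lt (hS : S.Valid) (i e : ℕ) {d : ℕ} (hd : d < 1681) : S.loc i e d < S.slots := by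
  have h1 := hS.relX_bounds i e
  have h2 := hS.relY_bounds i e
  exact digits_lt (digits_lt (by omega) (by omega)) hd

theorem Valid.slot_lt (hS : S.Valid) {i e d : ℕ} (hi : i < S.tot) (he : e < 5 * S.N)
    (hd : d < 1681) : S.slot i e d < S.tot * (5 * S.N) * S.slots :=
  digits_lt (hS.id_lt i hi e he) (hS.loc_lt i e hd)

/-- The first key is a multiple of `N` plus the shift `e / 5 < N`, so the keys determine the shift.
Hence cells of different shifts never share a number, and all shifts can be treated in one memory.
-/
theorem keyA_emod {e : ℕ} (he : e < 5 * S.N) (i : ℕ) : S.keyA i e % S.N = (e / 5 : ℕ) := by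
  rw [keyA, add_comm, Int.add_mul_emod_self_right]
  exact Int.emod_eq_of_lt (by positivity) (by omega)

theorem Valid.shift_eq (hS : S.Valid) {i j e e' : ℕ} (hi : i < S.tot) (hj : j < S.tot)
    (he : e < 5 * S.N) (he' : e' < 5 * S.N) (h : S.id i e = S.id j e') : e / 5 = e' / 5 := by
  have h1 := ((hS.id_eq i hi j hj e he e' he').1 h).1
  have h2 := keyA_emod he i
  rw [h1, keyA_emod he' j] at h2
  exact_mod_cast h2.symm

/-- A slot number is a mixed radix numeral with digits for coarse cell, relative column, relative
row and direction. The cell fixes both keys and the shift, and then the relative position determines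
the fine cell. -/
theorem Valid.slot_inj (hS : S.Valid) {i j e e' d d' : ℕ} (hi : i < S.tot) (hj : j < S.tot)
    (he : e < 5 * S.N) (he' : e' < 5 * S.N) (hd : d < 1681) (hd' : d' < 1681)
    (h : S.slot i e d = S.slot j e' d') :
    S.id i e = S.id j e' ∧ d = d' ∧ S.cx i = S.cx j ∧ S.cy i = S.cy j := by
  obtain ⟨h1, h2⟩ := digits_unique h (hS.loc_lt i e hd) (hS.loc_lt j e' hd')
  obtain ⟨h3, h4⟩ := digits_unique h2 hd hd'
  have bx := hS.relX_bounds i e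
  have bx' := hS.relX_bounds j e'
  have bY := hS.relY_bounds i e
  have bY' := hS.relY_bounds j e'
  obtain ⟨h5, h6⟩ := digits_unique h3 (by omega) (by omega)
  have hA := (hS.id_eq i hi j hj e he e' he').1 h1
  have ht := hS.shift_eq hi hj he he' h1
  have hx : S.relX i e = S.relX j e' := by omega
  have hy : S.relY i e = S.relY j e' := by omega
  refine ⟨h1, h4, ?_, ?_⟩
  · simp only [relX, hA.1, ht] at hx; linarith
  · simp only [relY, hA.2, ht] at hy; linarith

/-- An interval of length at most `N` meets at most two consecutive blocks of length `N`, namely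
those of its end points. -/
theorem div_between {a x N r : ℤ} (hN : 0 < N) (hr : r ≤ N) (h1 : a ≤ x) (h2 : x ≤ a + r) :
    x / N = a / N ∨ x / N = (a + r) / N := by
  have h3 := Int.ediv_le_ediv hN h1
  have h4 := Int.ediv_le_ediv hN h2
  have h5 : (a + r) / N ≤ a / N + 1 := by
    have := Int.ediv_le_ediv hN (show a + r ≤ a + 1 * N by linarith)
    rwa [Int.add_mul_ediv_right _ _ hN.ne'] at this
  omega

/-- Every coarse cell near a point contains one of the four copies of the point. -/
theorem Valid.exists_copy (hS : S.Valid) {i j t : ℕ} (hi : i < S.tot) (hj : j < S.tot)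
    (ht : t < S.N) (h : S.sqd i j ≤ 4) : ∃ c < 4, S.id i (5 * t + c) = S.id j (5 * t + 4) := by
  have hN : (0 : ℤ) < S.N := by exact_mod_cast hS.N_pos
  have hR : (2 * S.R : ℤ) ≤ S.N := by exact_mod_cast hS.R_le
  obtain ⟨h1, h2⟩ := hS.near i hi j hj h
  rw [abs_le] at h1 h2
  -- The copy of `j` is offset by `R`, so its column lies between the columns of the copies of `i`
  -- with offsets `0` and `2R`; likewise for rows. The four combinations of end points are the four
  -- copies of `i`.
  have hx := div_between (a := S.cx i + t) (x := S.cx j + t + S.R) hN hR (by linarith) (by linarith)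
  have hy := div_between (a := S.cy i + t) (x := S.cy j + t + S.R) hN hR (by linarith) (by linarith)
  have hiff := fun c (hc : c < 5) => hS.id_eq i hi j hj (5 * t + c) (by omega) (5 * t + 4) (by omega)
  simp only [keyA, keyB, (div_add_div t 4 (by norm_num)).1,
    (div_add_div t 4 (by norm_num)).2] at hiff
  rcases hx with hx | hx <;> rcases hy with hy | hy
  · refine ⟨0, by norm_num, (hiff 0 (by norm_num)).2 ?_⟩
    simp [offX, offY, hx, hy]
  · refine ⟨1, by norm_num, (hiff 1 (by norm_num)).2 ?_⟩
    simp [(div_add_div t 1 (by norm_num)), offX, offY, hx, hy]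
  · refine ⟨2, by norm_num, (hiff 2 (by norm_num)).2 ?_⟩
    simp [(div_add_div t 2 (by norm_num)), offX, offY, hx, hy]
  · refine ⟨3, by norm_num, (hiff 3 (by norm_num)).2 ?_⟩
    simp [(div_add_div t 3 (by norm_num)), offX, offY, hx, hy]

/-! ### Replacing a point by candidates of its coarse cell -/

theorem sqd_comm (i j : ℕ) : S.sqd i j = S.sqd j i := by simp only [sqd]; ring

/-- The number of the direction `(a, b)`. -/
def dirIdx (a b : ℤ) : ℕ := (a + 20).toNat * 41 + (b + 20).toNat

theorem dirIdx_spec {a b : ℤ} (ha : |a| ≤ 20) (hb : |b| ≤ 20) :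
    dirIdx a b < 1681 ∧ dirX (dirIdx a b) = a ∧ dirY (dirIdx a b) = b := by
  rw [abs_le] at ha hb
  have h1 : (dirIdx a b) / 41 = (a + 20).toNat := by unfold dirIdx; omega
  have h2 : (dirIdx a b) % 41 = (b + 20).toNat := by unfold dirIdx; omega
  refine ⟨by unfold dirIdx; omega, ?_, ?_⟩
  · rw [dirX, h1]; omega
  · rw [dirY, h2]; omega

/-- Sharing a slot means sharing a fine cell, and fine cells have diameter at most 1/100. -/
theorem CandSpec.close (hS : S.Valid) {cand : ℕ → ℤ} (hc : S.CandSpec cand) {i e d : ℕ}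
    (h : S.Event i e d) : ∃ i' < S.n, cand (S.slot i e d) = i' ∧ S.sqd i' i ≤ 1 / 10000 ∧
      S.val d i ≤ S.val d i' := by
  obtain ⟨i', e', h', h1, h2, h3⟩ := hc.extreme i e d h
  have hi := h.i_lt
  have hi' := h'.i_lt
  obtain ⟨-, -, h4, h5⟩ := hS.slot_inj (by unfold tot; omega) (by unfold tot; omega) h'.e_lt h.e_lt
    h'.d_lt h.d_lt h2
  exact ⟨i', hi', h1, hS.same i' (by unfold tot; omega) i (by unfold tot; omega) h4 h5, h3⟩

/-- Whatever a point dominates in a coarse cell is dominated by four candidates of the cell. -/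
theorem CandSpec.replace (hS : S.Valid) {cand : ℕ → ℤ} (hc : S.CandSpec cand) {p t c : ℕ}
    (hp : p < S.n) (ht : t < S.N) (hc4 : c < 4) :
    ∃ m ⊆ Finset.range S.slots, m.card ≤ 4 ∧ ∀ q < S.n',
      S.id (S.n + q) (5 * t + 4) = S.id p (5 * t + c) → S.sqd p (S.n + q) ≤ 4 →
      ∃ j ∈ m, 0 ≤ cand (S.id p (5 * t + c) * S.slots + j) ∧
        S.sqd (cand (S.id p (5 * t + c) * S.slots + j)).toNat (S.n + q) ≤ 4 := by
  classical
  obtain ⟨κ, hκ⟩ : ∃ κ, κ = S.id p (5 * t + c) := ⟨_, rfl⟩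
  have hev : ∀ a b : ℤ, |a| ≤ 20 → |b| ≤ 20 → S.Event p (5 * t + c) (dirIdx a b) :=
    fun a b ha hb => ⟨hp, by omega, by omega, (dirIdx_spec ha hb).1⟩
  -- The choice function has to be defined for all integer pairs; outside the admissible directions
  -- its value is the irrelevant `0`.
  have hcl : ∀ a b : ℤ, ∃ i' : ℕ, |a| ≤ 20 → |b| ≤ 20 → i' < S.n ∧
      cand (S.slot p (5 * t + c) (dirIdx a b)) = i' ∧ S.sqd i' p ≤ 1 / 10000 ∧
      S.val (dirIdx a b) p ≤ S.val (dirIdx a b) i' := by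
    intro a b
    by_cases hab : |a| ≤ 20 ∧ |b| ≤ 20
    · obtain ⟨i', h1, h2⟩ := hc.close hS (hev a b hab.1 hab.2)
      exact ⟨i', fun _ _ => ⟨h1, h2⟩⟩
    · exact ⟨0, fun ha hb => absurd ⟨ha, hb⟩ hab⟩
  choose f hf using hcl
  obtain ⟨a, b, ha, hb, u, v, u', v', huv, huv', hcap⟩ := exists_caps
    (fun a b => S.px (f a b) - S.px p) (fun a b => S.py (f a b) - S.py p)
    (fun a b ha hb => (hf a b ha hb).2.2.1)
    (fun a b ha hb => by
      have h := (hf a b ha hb).2.2.2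
      simp only [val, (dirIdx_spec ha hb).2.1, (dirIdx_spec ha hb).2.2] at h
      linarith)
  -- candidates near the point itself
  have hnear : ∀ a b : ℤ, |a| ≤ 20 → |b| ≤ 20 → ∃ j < S.slots, ∀ q,
      (S.px (S.n + q) - S.px p - (S.px (f a b) - S.px p)) ^ 2 +
        (S.py (S.n + q) - S.py p - (S.py (f a b) - S.py p)) ^ 2 ≤ 4 →
      0 ≤ cand (κ * S.slots + j) ∧ S.sqd (cand (κ * S.slots + j)).toNat (S.n + q) ≤ 4 := by
    intro a b ha hb
    refine ⟨S.loc p (5 * t + c) (dirIdx a b), hS.loc_lt _ _ (dirIdx_spec ha hb).1, fun q hq => ?_⟩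
    have h2 := (hf a b ha hb).2.1
    rw [slot, ← hκ] at h2
    rw [h2]
    refine ⟨by positivity, ?_⟩
    simp only [Int.toNat_natCast, sqd]
    linarith
  -- candidates in the caps
  have hfar : ∀ u v : ℝ, u ^ 2 + v ^ 2 = 1 → ∃ m ⊆ Finset.range S.slots, m.card ≤ 1 ∧ ∀ q < S.n',
      S.id (S.n + q) (5 * t + 4) = κ → S.sqd p (S.n + q) ≤ 4 →
      7 / 4 ≤ u * (S.px (S.n + q) - S.px p) + v * (S.py (S.n + q) - S.py p) →
      ∃ j ∈ m, 0 ≤ cand (κ * S.slots + j) ∧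
        S.sqd (cand (κ * S.slots + j)).toNat (S.n + q) ≤ 4 := by
    intro u v huv
    by_cases hex : ∃ q < S.n', S.id (S.n + q) (5 * t + 4) = κ ∧ S.sqd p (S.n + q) ≤ 4 ∧
      7 / 4 ≤ u * (S.px (S.n + q) - S.px p) + v * (S.py (S.n + q) - S.py p)
    · obtain ⟨q, hq, hqκ, hqd, hqc⟩ := hex
      -- The point of `P'` found in the cap is also a point of `P`, and one of its copies lies in
      -- the coarse cell. The candidate for direction `0` from its fine cell is within 1/100 of it
      -- and thus dominates the whole cap.
      obtain ⟨i, hi, hix, hiy⟩ := hS.sub q hq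
      obtain ⟨c', hc', hid⟩ := hS.exists_copy (i := i) (j := S.n + q) (by unfold tot; omega)
        (by unfold tot; omega) ht (by simp [sqd, hix, hiy])
      have hev' : S.Event i (5 * t + c') 0 := ⟨hi, by omega, by omega, by norm_num⟩
      obtain ⟨i', hi', h1, h2, -⟩ := hc.close hS hev'
      rw [slot, hid, hqκ] at h1
      refine ⟨{S.loc i (5 * t + c') 0}, ?_, by simp, fun r hr hrκ hrd hrc => ?_⟩
      · simpa using hS.loc_lt i (5 * t + c') (d := 0) (by norm_num)
      · refine ⟨_, Finset.mem_singleton_self _, ?_⟩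
        rw [h1]
        refine ⟨by positivity, ?_⟩
        simp only [sqd, hix, hiy] at h2 hqd hrd
        have := cap_dominated (x := S.px i' - S.px p) (y := S.py i' - S.py p) huv (by linarith)
          (by linarith) hqc hrc (by linarith)
        simp only [Int.toNat_natCast, sqd]
        linarith
    · exact ⟨∅, by simp, by simp, fun q hq h1 h2 h3 => absurd ⟨q, hq, h1, h2, h3⟩ hex⟩
  obtain ⟨j₁, hj₁, hd₁⟩ := hnear 0 0 (by norm_num) (by norm_num)
  obtain ⟨j₂, hj₂, hd₂⟩ := hnear a b ha hb
  obtain ⟨m₁, hm₁, hk₁, hd₃⟩ := hfar u v huv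
  obtain ⟨m₂, hm₂, hk₂, hd₄⟩ := hfar u' v' huv'
  rw [← hκ]
  refine ⟨{j₁, j₂} ∪ (m₁ ∪ m₂), ?_, ?_, fun q hq hqκ hqd => ?_⟩
  · refine Finset.union_subset ?_ (Finset.union_subset hm₁ hm₂)
    intro x hx
    simp only [Finset.mem_insert, Finset.mem_singleton] at hx
    rcases hx with rfl | rfl <;> simpa
  · have h1 := Finset.card_union_le ({j₁, j₂} : Finset ℕ) (m₁ ∪ m₂)
    have h2 := Finset.card_union_le m₁ m₂
    have h3 : ({j₁, j₂} : Finset ℕ).card ≤ 2 := Finset.card_le_two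
    omega
  · have hqd' : (S.px (S.n + q) - S.px p) ^ 2 + (S.py (S.n + q) - S.py p) ^ 2 ≤ 4 := by
      rw [sqd_comm] at hqd; exact hqd
    rcases hcap _ _ hqd' with h | h | h | h
    · exact ⟨j₁, by simp, hd₁ q h⟩
    · exact ⟨j₂, by simp, hd₂ q h⟩
    · obtain ⟨j, hj, hh⟩ := hd₃ q hq hqκ hqd h
      exact ⟨j, by simp [hj], hh⟩
    · obtain ⟨j, hj, hh⟩ := hd₄ q hq hqκ hqd h
      exact ⟨j, by simp [hj], hh⟩

/-! ### Comparing cell selections with a solution -/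

/-- The indices in `D` dominate all points of `P'`. -/
def Dominates (S : Inst) (D : Finset ℕ) : Prop :=
  D ⊆ Finset.range S.n ∧ ∀ q < S.n', ∃ p ∈ D, S.sqd p (S.n + q) ≤ 4

/-- The cells in which a point has copies, for a given shift. -/
def cellsOf (S : Inst) (p t : ℕ) : Finset ℕ := (Finset.range 4).image fun c => S.id p (5 * t + c)

theorem mem_cellsOf {p t κ : ℕ} : κ ∈ S.cellsOf p t ↔ ∃ c < 4, S.id p (5 * t + c) = κ := by
  simp [cellsOf]

/-- The points of `D` that have a copy in the cell `κ` for the shift `t`. -/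
def touching (S : Inst) (D : Finset ℕ) (t κ : ℕ) : Finset ℕ :=
  D.filter fun p => κ ∈ S.cellsOf p t

/-- The union of the four-candidate replacements of all points of `D` with a copy in the cell is
feasible: a point of `P'` in the cell is dominated by some point of `D`, which has a copy there by
`Valid.exists_copy`. -/
theorem exists_feas (hS : S.Valid) {cand : ℕ → ℤ} (hc : S.CandSpec cand) {D : Finset ℕ}
    (hD : S.Dominates D) {t : ℕ} (ht : t < S.N) {i e : ℕ} (hi : i < S.tot) (he : e < 5 * S.N)
    (het : e / 5 = t) :
    ∃ m ⊆ Finset.range S.slots, S.Feas cand m (S.id i e) ∧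
      m.card ≤ 4 * (S.touching D t (S.id i e)).card := by
  classical
  obtain ⟨κ, hκ⟩ : ∃ κ, κ = S.id i e := ⟨_, rfl⟩
  rw [← hκ]
  have hrep : ∀ p, ∃ m ⊆ Finset.range S.slots, m.card ≤ 4 ∧ (p ∈ S.touching D t κ → ∀ q < S.n',
      S.id (S.n + q) (5 * t + 4) = κ → S.sqd p (S.n + q) ≤ 4 →
      ∃ j ∈ m, 0 ≤ cand (κ * S.slots + j) ∧
        S.sqd (cand (κ * S.slots + j)).toNat (S.n + q) ≤ 4) := by
    intro p
    by_cases hp : p ∈ S.touching D t κ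
    · simp only [touching, Finset.mem_filter, mem_cellsOf] at hp
      obtain ⟨hpD, c, hc4, hpκ⟩ := hp
      obtain ⟨m, h1, h2, h3⟩ := hc.replace hS (Finset.mem_range.1 (hD.1 hpD)) ht hc4
      rw [hpκ] at h3
      exact ⟨m, h1, h2, fun _ => h3⟩
    · exact ⟨∅, by simp, by simp, fun h => absurd h hp⟩
  choose m hm1 hm2 hm3 using hrep
  refine ⟨(S.touching D t κ).biUnion m, ?_, ?_, ?_⟩
  · exact Finset.biUnion_subset.2 fun p _ => hm1 p
  · intro q hq t' ht' hqκ
    -- Feasibility quantifies over all shifts, but the number of the cell fixes the shift.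
    have htt : t' = t := by
      have := hS.shift_eq (i := S.n + q) (by unfold tot; omega) hi (by omega) he
        (hqκ.trans hκ)
      omega
    subst htt
    obtain ⟨p, hpD, hpq⟩ := hD.2 q hq
    have hpn := Finset.mem_range.1 (hD.1 hpD)
    obtain ⟨c, hc4, hid⟩ := hS.exists_copy (i := p) (j := S.n + q) (by unfold tot; omega)
      (by unfold tot; omega) ht hpq
    have hpt : p ∈ S.touching D t' κ := by
      simp only [touching, Finset.mem_filter, mem_cellsOf]
      exact ⟨hpD, c, hc4, hid.trans hqκ⟩
    obtain ⟨j, hj, hh⟩ := hm3 p hpt q hq hqκ hpq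
    exact ⟨j, Finset.mem_biUnion.2 ⟨p, hpt, hj⟩, hh⟩
  · refine Finset.card_biUnion_le.trans ((Finset.sum_le_card_nsmul _ _ 4 fun p _ => hm2 p).trans ?_)
    simp [mul_comm]

theorem dominates_all (hS : S.Valid) : S.Dominates (Finset.range S.n) := by
  refine ⟨subset_rfl, fun q hq => ?_⟩
  obtain ⟨i, hi, hx, hy⟩ := hS.sub q hq
  exact ⟨i, by simpa using hi, by simp [sqd, hx, hy]⟩

/-- The selected points dominate `P'`, for every shift. -/
theorem flag_dominates (hS : S.Valid) {cand : ℕ → ℤ} (hc : S.CandSpec cand) {sel : ℕ → Finset ℕ}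
    (hsel : S.SelSpec cand sel) {t : ℕ} (ht : t < S.N) {q : ℕ} (hq : q < S.n') :
    ∃ i < S.n, S.Flag cand sel i t ∧ S.sqd i (S.n + q) ≤ 4 := by
  have hqt : S.n + q < S.tot := by unfold tot; omega
  -- All of `P` is a solution since `P' ⊆ P`; it serves only to show that the cell has some feasible
  -- selection.
  obtain ⟨m, hm, hf, -⟩ := exists_feas hS hc (dominates_all hS) ht hqt
    (e := 5 * t + 4) (by omega) (by omega)
  have hlt := hS.id_lt (S.n + q) hqt (5 * t + 4) (by omega)
  obtain ⟨hfs, hsub, -⟩ := hsel _ hlt m hm hf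
  obtain ⟨j, hj, h0, hd⟩ := hfs q hq t ht rfl
  have hjK := Finset.mem_range.1 (hsub hj)
  obtain ⟨i, e, d, hev, h1, h2⟩ := hc.event _ (digits_lt hlt hjK) h0
  rw [h1] at hd
  have hi := hev.i_lt
  obtain ⟨h3, h4⟩ := digits_unique h2 (hS.loc_lt i e hev.d_lt) hjK
  have h5 := hS.shift_eq (i := i) (j := S.n + q) (by unfold tot; omega) hqt hev.e_lt (by omega) h3
  have he : e = 5 * t + e % 5 := by omega
  refine ⟨i, hi, ⟨e % 5, hev.e_mod, d, hev.d_lt, ?_, ?_⟩, by simpa using hd⟩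
  · rw [← he, h2, h1]
  · rw [← he, h3, h4]; exact hj

/-! ### Averaging over the shifts -/

/-- If a multiple of `N` lies in `(a + t, a + t + r]`, the remainder of `a + t + r` modulo `N` is
less than `r`. Different shifts below `N` have different remainders. -/
theorem card_bad_shifts {N r : ℕ} (hN : 0 < N) (a : ℤ) :
    ((Finset.range N).filter fun t : ℕ => (a + t) / (N : ℤ) ≠ (a + t + r) / (N : ℤ)).card ≤ r := by
  have hN' : (0 : ℤ) < N := by exact_mod_cast hN
  refine (Finset.card_le_card_of_injOn (t := Finset.range r)
    (fun t : ℕ => ((a + t + r) % (N : ℤ)).toNat) ?_ ?_).trans_eq (Finset.card_range r)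
  · intro t ht
    simp only [Finset.coe_filter, Set.mem_ofPred_eq, Finset.mem_range] at ht
    simp only [Finset.coe_range, Set.mem_Iio]
    have h1 := Int.emod_nonneg (a + t + r) hN'.ne'
    have h2 := Int.emod_add_mul_ediv (a + t + r) N
    have h3 := Int.emod_add_mul_ediv (a + t) N
    have h4 := Int.emod_lt_of_pos (a + t) hN'
    have h5 := Int.ediv_le_ediv hN' (show a + t ≤ a + t + r by linarith)
    have h6 : (a + t) / (N : ℤ) + 1 ≤ (a + t + r) / (N : ℤ) := lt_of_le_of_ne h5 ht.2
    have h7 := mul_le_mul_of_nonneg_left h6 hN'.le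
    have h8 : (a + t + r) % (N : ℤ) < r := by linarith
    omega
  · intro t ht t' ht' h
    simp only [Finset.coe_filter, Set.mem_ofPred_eq, Finset.mem_range] at ht ht'
    have h1 := Int.emod_nonneg (a + t + r) hN'.ne'
    have h2 := Int.emod_nonneg (a + t' + r) hN'.ne'
    have h3 : (a + t + r) % (N : ℤ) = (a + t' + r) % (N : ℤ) := by simp only at h; omega
    have h4 : (N : ℤ) ∣ (a + t + r) - (a + t' + r) := Int.ModEq.dvd (Int.ModEq.symm h3)
    have h5 : (N : ℤ) ∣ (t : ℤ) - t' := by simpa using h4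
    have h6 := Int.eq_zero_of_abs_lt_dvd h5 (by rw [abs_lt]; constructor <;> omega)
    omega

/-- Unless a line of the shifted grid separates the corners in at least one direction, all four
copies have the same keys. In the other cases the trivial bound `4 = 1 + 3` is enough. -/
theorem card_cellsOf_le (hS : S.Valid) {p t : ℕ} (hp : p < S.tot) (ht : t < S.N) :
    (S.cellsOf p t).card ≤ 1 +
      (3 * (if (S.cx p + t) / (S.N : ℤ) ≠ (S.cx p + t + (2 * S.R : ℕ)) / (S.N : ℤ) then 1 else 0) +
      3 * (if (S.cy p + t) / (S.N : ℤ) ≠ (S.cy p + t + (2 * S.R : ℕ)) / (S.N : ℤ) then 1 else 0)) := by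
  have h4 : (S.cellsOf p t).card ≤ 4 := Finset.card_image_le.trans (by simp)
  split_ifs with hx hy hy
  · omega
  · omega
  · omega
  · rw [not_not] at hx hy
    refine (Finset.card_le_one.2 ?_).trans (by omega)
    simp only [cellsOf, Finset.mem_image, Finset.mem_range]
    rintro _ ⟨c, hc, rfl⟩ _ ⟨c', hc', rfl⟩
    rw [hS.id_eq p hp p hp _ (by omega) _ (by omega)]
    have hoff : ∀ c < 4, (S.cx p + t + (offX S.R c : ℤ)) / (S.N : ℤ) = (S.cx p + t) / (S.N : ℤ) ∧
        (S.cy p + t + (offY S.R c : ℤ)) / (S.N : ℤ) = (S.cy p + t) / (S.N : ℤ) := by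
      intro c hc
      interval_cases c <;> simp_all [offX, offY]
    simp only [keyA, keyB, div_add_div t c (by omega), div_add_div t c' (by omega),
      hoff c hc, hoff c' hc', and_self]

/-- In each of the two directions at most `2R` shifts are bad, and each costs at most three
additional cells: `2 * 3 * 2R = 12R`. -/
theorem sum_card_cellsOf_le (hS : S.Valid) {p : ℕ} (hp : p < S.tot) :
    ∑ t ∈ Finset.range S.N, (S.cellsOf p t).card ≤ S.N + 12 * S.R := by
  refine (Finset.sum_le_sum fun t ht => card_cellsOf_le hS hp (Finset.mem_range.1 ht)).trans ?_
  rw [Finset.sum_add_distrib, Finset.sum_add_distrib, ← Finset.mul_sum, ← Finset.mul_sum,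
    ← Finset.card_filter, ← Finset.card_filter]
  have h1 := card_bad_shifts (r := 2 * S.R) hS.N_pos (S.cx p)
  have h2 := card_bad_shifts (r := 2 * S.R) hS.N_pos (S.cy p)
  simp only [Finset.sum_const, Finset.card_range, smul_eq_mul, mul_one]
  omega

/-- The selected points for the shift `t`. -/
noncomputable def flagged (S : Inst) (cand : ℕ → ℤ) (sel : ℕ → Finset ℕ) (t : ℕ) : Finset ℕ :=
  open Classical in (Finset.range S.n).filter fun i => S.Flag cand sel i t

/-- Every selected point is read off from a selected slot of one of its cells, so the sizes of the
selections bound the count. Each selection is at most four times the number of points of `D`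
touching its cell, and exchanging the sums counts instead the cells touched by each point. -/
theorem card_flagged_le (hS : S.Valid) {cand : ℕ → ℤ} (hc : S.CandSpec cand) {sel : ℕ → Finset ℕ}
    (hsel : S.SelSpec cand sel) {D : Finset ℕ} (hD : S.Dominates D) {t : ℕ} (ht : t < S.N) :
    (S.flagged cand sel t).card ≤ 4 * ∑ p ∈ D, (S.cellsOf p t).card := by
  classical
  obtain ⟨C, hC⟩ : ∃ C, C = (Finset.range S.n).biUnion fun i => S.cellsOf i t := ⟨_, rfl⟩
  have h1 : S.flagged cand sel t ⊆ (C.biUnion fun κ => (sel κ).image fun j => κ * S.slots + j).image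
      fun σ => (cand σ).toNat := by
    intro i hi
    simp only [flagged, Finset.mem_filter, Finset.mem_range] at hi
    obtain ⟨hin, c, hc4, d, hd, h2, h3⟩ := hi
    rw [Finset.mem_image]
    refine ⟨S.slot i (5 * t + c) d, ?_, by rw [h2]; simp⟩
    rw [Finset.mem_biUnion]
    refine ⟨S.id i (5 * t + c), ?_, Finset.mem_image.2 ⟨_, h3, rfl⟩⟩
    rw [hC, Finset.mem_biUnion]
    exact ⟨i, by simpa using hin, Finset.mem_image.2 ⟨c, by simpa using hc4, rfl⟩⟩
  have h2 : ∀ κ ∈ C, (sel κ).card ≤ 4 * (S.touching D t κ).card := by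
    intro κ hκ
    rw [hC, Finset.mem_biUnion] at hκ
    obtain ⟨i, hi, hκ⟩ := hκ
    obtain ⟨c, hc4, rfl⟩ := Finset.mem_image.1 hκ
    rw [Finset.mem_range] at hi hc4
    have hit : i < S.tot := by unfold tot; omega
    obtain ⟨m, hm, hf, hcard⟩ := exists_feas hS hc hD ht hit (e := 5 * t + c) (by omega) (by omega)
    exact (hsel _ (hS.id_lt i hit _ (by omega)) m hm hf).2.2.trans hcard
  calc (S.flagged cand sel t).card
      ≤ (C.biUnion fun κ => (sel κ).image fun j => κ * S.slots + j).card :=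
        (Finset.card_le_card h1).trans Finset.card_image_le
    _ ≤ ∑ κ ∈ C, (sel κ).card :=
        Finset.card_biUnion_le.trans (Finset.sum_le_sum fun κ _ => Finset.card_image_le)
    _ ≤ ∑ κ ∈ C, 4 * (S.touching D t κ).card := Finset.sum_le_sum h2
    _ = 4 * ∑ κ ∈ C, ∑ p ∈ D, if κ ∈ S.cellsOf p t then 1 else 0 := by
        rw [← Finset.mul_sum]
        simp only [touching, Finset.card_filter]
    _ = 4 * ∑ p ∈ D, (C.filter fun κ => κ ∈ S.cellsOf p t).card := by
        rw [Finset.sum_comm]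
        simp only [Finset.card_filter]
    _ ≤ 4 * ∑ p ∈ D, (S.cellsOf p t).card := by
        refine Nat.mul_le_mul_left _ (Finset.sum_le_sum fun p _ => Finset.card_le_card ?_)
        exact fun κ hκ => (Finset.mem_filter.1 hκ).2

/-- The best shift is nearly four times as good as any solution. -/
theorem card_best_le (hS : S.Valid) {cand : ℕ → ℤ} (hc : S.CandSpec cand) {sel : ℕ → Finset ℕ}
    (hsel : S.SelSpec cand sel) {D : Finset ℕ} (hD : S.Dominates D) {t : ℕ}
    (hmin : ∀ t' < S.N, (S.flagged cand sel t).card ≤ (S.flagged cand sel t').card) :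
    S.N * (S.flagged cand sel t).card ≤ 4 * (D.card * (S.N + 12 * S.R)) := by
  -- The minimum over the shifts is at most the average.
  calc S.N * (S.flagged cand sel t).card
      = ∑ _t' ∈ Finset.range S.N, (S.flagged cand sel t).card := by simp
    _ ≤ ∑ t' ∈ Finset.range S.N, 4 * ∑ p ∈ D, (S.cellsOf p t').card :=
        Finset.sum_le_sum fun t' ht' => (hmin t' (Finset.mem_range.1 ht')).trans
          (card_flagged_le hS hc hsel hD (Finset.mem_range.1 ht'))
    _ = 4 * ∑ p ∈ D, ∑ t' ∈ Finset.range S.N, (S.cellsOf p t').card := by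
        rw [← Finset.mul_sum, Finset.sum_comm]
    _ ≤ 4 * ∑ _p ∈ D, (S.N + 12 * S.R) := by
        refine Nat.mul_le_mul_left _ (Finset.sum_le_sum fun p hp => sum_card_cellsOf_le hS ?_)
        have := Finset.mem_range.1 (hD.1 hp)
        unfold tot; omega
    _ = 4 * (D.card * (S.N + 12 * S.R)) := by simp

end Inst

/-! ### The main program -/

open RealRAM

/-- The memory holds the points, the fine grid, and the keys and numbers of the coarse cells. -/
structure Ready (S : Inst) (s : State) : Prop where
  xs : s.realArr 0 = tab S.tot S.px
  ys : s.realArr 1 = tab S.tot S.py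
  n : s.intReg 10 = S.n
  tot : s.intReg 11 = S.tot
  cx : s.intArr 0 = tab S.tot S.cx
  cy : s.intArr 1 = tab S.tot S.cy
  keyA : s.intArr 2 = tab (S.tot * (5 * S.N)) fun j => S.keyA (j / (5 * S.N)) (j % (5 * S.N))
  keyB : s.intArr 3 = tab (S.tot * (5 * S.N)) fun j => S.keyB (j / (5 * S.N)) (j % (5 * S.N))
  id : s.intArr 4 = tab (S.tot * (5 * S.N)) fun j => ((S.id (j / (5 * S.N)) (j % (5 * S.N)) : ℕ) : ℤ)

theorem Ready.setReg {S : Inst} {s : State} (h : Ready S s) {x : ℕ} (hx : x < 10) (v : ℤ) :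
    Ready S (s.setReg x v) := by
  have h10 : (10 : ℕ) ≠ x := by omega
  have h11 : (11 : ℕ) ≠ x := by omega
  exact ⟨h.xs, h.ys, by simpa [h10] using h.n, by simpa [h11] using h.tot, h.cx, h.cy, h.keyA,
    h.keyB, h.id⟩

theorem Ready.setIArr {S : Inst} {s : State} (h : Ready S s) {a : ℕ} (ha : 5 ≤ a) (v : List ℤ) :
    Ready S (s.setIArr a v) := by
  have h0 : (0 : ℕ) ≠ a := by omega
  have h1 : (1 : ℕ) ≠ a := by omega
  have h2 : (2 : ℕ) ≠ a := by omega
  have h3 : (3 : ℕ) ≠ a := by omega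
  have h4 : (4 : ℕ) ≠ a := by omega
  exact ⟨h.xs, h.ys, h.n, h.tot, by simpa [h0] using h.cx, by simpa [h1] using h.cy,
    by simpa [h2] using h.keyA, by simpa [h3] using h.keyB, by simpa [h4] using h.id⟩

theorem Ready.setRArr {S : Inst} {s : State} (h : Ready S s) {a : ℕ} (ha : 2 ≤ a) (v : List ℝ) :
    Ready S (s.setRArr a v) := by
  have h0 : (0 : ℕ) ≠ a := by omega
  have h1 : (1 : ℕ) ≠ a := by omega
  exact ⟨by simpa [h0] using h.xs, by simpa [h1] using h.ys, h.n, h.tot, h.cx, h.cy, h.keyA, h.keyB,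
    h.id⟩

theorem readAt_tab_pair {α : Type} [Zero α] {n k : ℕ} {f : ℕ → ℕ → α} {z : ℤ} {i e : ℕ}
    (hz : z = i * k + e) (hi : i < n) (he : e < k) :
    readAt (tab (n * k) fun j => f (j / k) (j % k)) z = f i e := by
  rw [readAt_tab (i := i * k + e) (by rw [hz]; push_cast; ring) (Inst.digits_lt hi he)]
  congr 1
  · rw [add_comm, Nat.add_mul_div_right _ _ (by omega), Nat.div_eq_of_lt he, zero_add]
  · rw [add_comm, Nat.add_mul_mod_self_right, Nat.mod_eq_of_lt he]

/-- The index of copy `e` of the point with index `i`. -/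
def copyIdx (N : ℕ) (i : IExpr) (e : ℕ) : IExpr := .add (.mul i (.const (5 * N : ℕ))) (.const e)

/-- Number of slots in a coarse cell. -/
def slotsOf (N R : ℕ) : ℕ := (N + 2 * R) * (N + 2 * R) * 1681

/-- The first slot of copy `e` of the point with index `reg 0`. -/
def slotExpr (N R e : ℕ) : IExpr :=
  .add (.mul (.get 4 (copyIdx N (.reg 0) e)) (.const (slotsOf N R)))
    (.mul (.add
      (.mul (.sub (.add (.get 0 (.reg 0)) (.const (2 * (e / 5) + 2 * R : ℕ)))
        (.get 2 (copyIdx N (.reg 0) e))) (.const (N + 2 * R : ℕ)))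
      (.sub (.add (.get 1 (.reg 0)) (.const (e / 5 + 2 * R : ℕ)))
        (.mul (.const N) (.get 3 (copyIdx N (.reg 0) e))))) (.const 1681))

theorem Ready.read_id {S : Inst} {s : State} (h : Ready S s) {z : ℤ} {i e : ℕ}
    (hz : z = i * (5 * S.N : ℕ) + e) (hi : i < S.tot) (he : e < 5 * S.N) :
    readAt (s.intArr 4) z = S.id i e := by
  rw [h.id]
  exact readAt_tab_pair (f := fun i e => ((S.id i e : ℕ) : ℤ)) hz hi he

theorem Ready.slotExpr_eval {S : Inst} (hS : S.Valid) {s : State} (h : Ready S s) {i e : ℕ}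
    (h0 : s.intReg 0 = i) (hi : i < S.tot) (he : e < 5 * S.N) :
    (slotExpr S.N S.R e).eval s = S.slot i e 0 := by
  have hx := hS.relX_bounds i e
  have hy := hS.relY_bounds i e
  have hA : readAt (s.intArr 2) ((i : ℤ) * (5 * S.N : ℕ) + e) = S.keyA i e := by
    rw [h.keyA]; exact readAt_tab_pair rfl hi he
  have hB : readAt (s.intArr 3) ((i : ℤ) * (5 * S.N : ℕ) + e) = S.keyB i e := by
    rw [h.keyB]; exact readAt_tab_pair rfl hi he
  simp only [slotExpr, copyIdx, IExpr.eval, h0, h.read_id rfl hi he, hA, hB, h.cx, h.cy,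
    readAt_tab rfl hi, Inst.slot, Inst.loc, Inst.slots, slotsOf, Inst.width]
  have e1 : S.cx i + ((2 * (e / 5) + 2 * S.R : ℕ) : ℤ) - S.keyA i e = S.relX i e := by
    rw [Inst.relX]; push_cast; ring
  have e2 : S.cy i + ((e / 5 + 2 * S.R : ℕ) : ℤ) - (S.N : ℤ) * S.keyB i e = S.relY i e := by
    rw [Inst.relY]; push_cast; ring
  rw [e1, e2]
  push_cast
  rw [Int.toNat_of_nonneg hx.1, Int.toNat_of_nonneg hy.1]
  ring

theorem slot_add (S : Inst) (i e d : ℕ) : S.slot i e d = S.slot i e 0 + d := by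
  simp [Inst.slot, Inst.loc]; ring

/-! #### Collecting the candidates -/

/-- Extent of the point with index `i` in direction `d`. -/
def valExpr (d : ℕ) (i : IExpr) : RExpr :=
  .add (.mul (.const (dirX d)) (.get 0 i)) (.mul (.const (dirY d)) (.get 1 i))

theorem Ready.valExpr_eval {S : Inst} {s : State} (h : Ready S s) {ie : IExpr} {i d : ℕ}
    (hi : ie.eval s = i) (hit : i < S.tot) : (valExpr d ie).eval s = S.val d i := by
  simp [valExpr, RExpr.eval, hi, h.xs, h.ys, readAt_tab rfl hit, Inst.val]

/-- Put the point `reg 0` into the slot `reg 1 + d` if it is more extreme than the candidate. -/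
def insertProg (d : ℕ) : Prog :=
  .branch (.and (.leInt (.const 0) (.get 5 (.add (.reg 1) (.const d))))
      (.leReal (valExpr d (.reg 0)) (valExpr d (.get 5 (.add (.reg 1) (.const d))))))
    .skip (.storeInt 5 (.add (.reg 1) (.const d)) (.reg 0))

/-- Insert copy `e` of the point `reg 0` in all directions. -/
def insertCopy (N R e : ℕ) : Prog :=
  if e % 5 < 4 then
    .seq (.setInt 1 (slotExpr N R e)) (seqList ((List.range 1681).map insertProg))
  else .skip

/-- Insert all copies of the point `reg 0`. -/
def insertBody (N R : ℕ) : Prog := seqList ((List.range (5 * N)).map (insertCopy N R))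

/-- Allocate the slots and collect the candidates. -/
def collectProg (N R : ℕ) : Prog :=
  .seq (forLoop 0 (.mul (.lenInt 4) (.const (slotsOf N R)))
    (.seq (.pushInt 5 (.const (-1))) (.pushInt 7 (.const 0)))) <|
  forLoop 0 (.reg 10) (insertBody N R)

theorem insertCopy_loopFree (N R e : ℕ) : (insertCopy N R e).LoopFree := by
  unfold insertCopy
  split_ifs
  · rw [Prog.loopFree_seq, seqList_loopFree]
    refine ⟨trivial, fun p hp => ?_⟩
    obtain ⟨d, -, rfl⟩ := List.mem_map.1 hp
    simp [insertProg, Prog.LoopFree]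
  · trivial

theorem insertBody_loopFree (N R : ℕ) : (insertBody N R).LoopFree :=
  seqList_loopFree.2 (by simp [insertCopy_loopFree])

theorem insertCopy_mod {N R e : ℕ} {l : Loc} (h : (insertCopy N R e).Mod l) :
    l = .ireg 1 ∨ l = .iarr 5 := by
  unfold insertCopy at h
  split_ifs at h
  · simp only [Prog.Mod, seqList_mod, List.mem_map, List.mem_range] at h
    rcases h with h | ⟨_, ⟨d, -, rfl⟩, h⟩
    · exact Or.inl h
    · simp only [insertProg, Prog.Mod, false_or] at h
      exact Or.inr h
  · exact h.elim

theorem insertBody_mod {N R : ℕ} {l : Loc} (h : (insertBody N R).Mod l) :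
    l = .ireg 1 ∨ l = .iarr 5 := by
  rw [insertBody, seqList_mod] at h
  obtain ⟨p, hp, h⟩ := h
  obtain ⟨e, -, rfl⟩ := List.mem_map.1 hp
  exact insertCopy_mod h

/-- The slots contain extreme points among the processed copies. -/
structure CandInv (S : Inst) (Ev : ℕ → ℕ → ℕ → Prop) (cand : ℕ → ℤ) : Prop where
  extreme : ∀ i e d, Ev i e d → ∃ i' e', Ev i' e' d ∧ cand (S.slot i e d) = i' ∧
    S.slot i' e' d = S.slot i e d ∧ S.val d i ≤ S.val d i'
  event : ∀ σ < S.tot * (5 * S.N) * S.slots, 0 ≤ cand σ →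
    ∃ i e d, Ev i e d ∧ cand σ = i ∧ S.slot i e d = σ

theorem CandInv.congr {S : Inst} {Ev Ev' : ℕ → ℕ → ℕ → Prop} {cand : ℕ → ℤ} (h : CandInv S Ev cand)
    (hE : ∀ i e d, Ev i e d ↔ Ev' i e d) : CandInv S Ev' cand := by
  have : Ev = Ev' := by ext i e d; exact hE i e d
  exact this ▸ h

-- If the old candidate is kept, it witnesses the bound for the new event as well. If it is
-- replaced, the new point is more extreme than the old candidate, hence than every earlier event of
-- that slot. By `slot_inj`, events in one slot have the same direction, so the values are
-- comparable.
open Classical in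
theorem CandInv.step {S : Inst} (hS : S.Valid) {Ev : ℕ → ℕ → ℕ → Prop} {cand : ℕ → ℤ}
    (h : CandInv S Ev cand) (hEv : ∀ i e d, Ev i e d → S.Event i e d) {i e d : ℕ}
    (hi : S.Event i e d) :
    CandInv S (fun i' e' d' => Ev i' e' d' ∨ (i' = i ∧ e' = e ∧ d' = d))
      (if 0 ≤ cand (S.slot i e d) ∧ S.val d i ≤ S.val d (cand (S.slot i e d)).toNat then cand
        else Function.update cand (S.slot i e d) i) := by
  have ht : ∀ {i e d}, S.Event i e d → i < S.tot := fun h => by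
    have := h.i_lt; unfold Inst.tot; omega
  split_ifs with hc
  · obtain ⟨i₁, e₁, d₁, h1, h2, h3⟩ := h.event _ (hS.slot_lt (ht hi) hi.e_lt hi.d_lt) hc.1
    have hd := (hS.slot_inj (ht (hEv _ _ _ h1)) (ht hi) (hEv _ _ _ h1).e_lt hi.e_lt
      (hEv _ _ _ h1).d_lt hi.d_lt h3).2.1
    subst hd
    refine ⟨?_, ?_⟩
    · rintro i' e' d' (h' | ⟨rfl, rfl, rfl⟩)
      · obtain ⟨i'', e'', ha, hb⟩ := h.extreme i' e' d' h'
        exact ⟨i'', e'', Or.inl ha, hb⟩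
      · refine ⟨i₁, e₁, Or.inl h1, h2, h3, ?_⟩
        have := hc.2
        rwa [h2, Int.toNat_natCast] at this
    · intro σ hσ h0
      obtain ⟨i', e', d', ha, hb⟩ := h.event σ hσ h0
      exact ⟨i', e', d', Or.inl ha, hb⟩
  · refine ⟨?_, ?_⟩
    · rintro i' e' d' (h' | ⟨rfl, rfl, rfl⟩)
      · by_cases hs : S.slot i' e' d' = S.slot i e d
        · have hd := (hS.slot_inj (ht (hEv _ _ _ h')) (ht hi) (hEv _ _ _ h').e_lt hi.e_lt
            (hEv _ _ _ h').d_lt hi.d_lt hs).2.1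
          subst hd
          refine ⟨i, e, Or.inr ⟨rfl, rfl, rfl⟩, by rw [hs, Function.update_self], hs.symm, ?_⟩
          obtain ⟨i'', e'', -, hb, -, hv⟩ := h.extreme i' e' d' h'
          rw [hs] at hb
          rw [hb, Int.toNat_natCast] at hc
          by_contra hcon
          exact hc ⟨by positivity, (not_le.1 hcon).le.trans hv⟩
        · obtain ⟨i'', e'', ha, hb, hc⟩ := h.extreme i' e' d' h'
          exact ⟨i'', e'', Or.inl ha, by rwa [Function.update_of_ne hs], hc⟩
      · exact ⟨i', e', Or.inr ⟨rfl, rfl, rfl⟩, Function.update_self _ _ _, rfl, le_rfl⟩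
    · intro σ hσ h0
      by_cases hs : σ = S.slot i e d
      · exact ⟨i, e, d, Or.inr ⟨rfl, rfl, rfl⟩, by rw [hs, Function.update_self], hs.symm⟩
      · rw [Function.update_of_ne hs] at h0 ⊢
        obtain ⟨i', e', d', ha, hb⟩ := h.event σ hσ h0
        exact ⟨i', e', d', Or.inl ha, hb⟩

/-- The events before the copy `e` of point `i` in direction `d`. -/
def Before (S : Inst) (i e d : ℕ) (i₁ e₁ d₁ : ℕ) : Prop :=
  S.Event i₁ e₁ d₁ ∧ (i₁ < i ∨ i₁ = i ∧ (e₁ < e ∨ e₁ = e ∧ d₁ < d))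

/-- Memory while the candidates are collected. -/
def CollectMem (S : Inst) (i e d : ℕ) (s : State) : Prop :=
  Ready S s ∧ ∃ cand : ℕ → ℤ, s.intArr 5 = tab (S.tot * (5 * S.N) * S.slots) cand ∧
    CandInv S (Before S i e d) cand

theorem insertProg_wp {S : Inst} (hS : S.Valid) {s : State} {i e d : ℕ} (hev : S.Event i e d)
    (h : CollectMem S i e d s) (h0 : s.intReg 0 = i) (h1 : s.intReg 1 = S.slot i e 0) :
    (insertProg d).WP (fun s' => CollectMem S i e (d + 1) s' ∧ s'.intReg 0 = i ∧
      s'.intReg 1 = S.slot i e 0) s := by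
  obtain ⟨hR, cand, hcand, hI⟩ := h
  have hit : i < S.tot := by have := hev.i_lt; unfold Inst.tot; omega
  have hslt := hS.slot_lt hit hev.e_lt hev.d_lt
  have hz : s.intReg 1 + (d : ℤ) = (S.slot i e d : ℕ) := by rw [h1, slot_add S i e d]; push_cast; rfl
  have hget : (IExpr.get 5 (.add (.reg 1) (.const d))).eval s = cand (S.slot i e d) := by
    simp only [IExpr.eval, hz, hcand]
    exact readAt_tab rfl hslt
  have hB : ∀ i' e' d', (Before S i e d i' e' d' ∨ (i' = i ∧ e' = e ∧ d' = d)) ↔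
      Before S i e (d + 1) i' e' d' := by
    intro i' e' d'
    unfold Before
    constructor
    · rintro (⟨h1, h2⟩ | ⟨rfl, rfl, rfl⟩)
      · exact ⟨h1, by omega⟩
      · exact ⟨hev, by omega⟩
    · rintro ⟨h1, h2⟩
      by_cases h3 : i' = i ∧ e' = e ∧ d' = d
      · exact Or.inr h3
      · exact Or.inl ⟨h1, by omega⟩
  have hstep := (hI.step hS (fun _ _ _ h => h.1) hev).congr hB
  have hH : (BExpr.and (.leInt (.const 0) (.get 5 (.add (.reg 1) (.const d))))
      (.leReal (valExpr d (.reg 0)) (valExpr d (.get 5 (.add (.reg 1) (.const d)))))).Holds s ↔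
      0 ≤ cand (S.slot i e d) ∧ S.val d i ≤ S.val d (cand (S.slot i e d)).toNat := by
    simp only [BExpr.Holds, hget]
    -- The comparison of extents is meaningful only if the slot is occupied; then its entry is the
    -- index of a point by `event`.
    refine and_congr_right fun hc => ?_
    have hc' : 0 ≤ cand (S.slot i e d) := hc
    obtain ⟨i', e', d', hE, hi', -⟩ := hI.event _ hslt hc'
    have hi't : i' < S.tot := by have := hE.1.i_lt; unfold Inst.tot; omega
    rw [hR.valExpr_eval (ie := .reg 0) (i := i) h0 hit, hR.valExpr_eval (hget.trans hi') hi't, hi',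
      Int.toNat_natCast]
  rw [insertProg, wp_branch, hH]
  refine ⟨fun hc => ?_, fun hc => ?_⟩
  · rw [if_pos hc] at hstep
    exact ⟨⟨hR, cand, hcand, hstep⟩, h0, h1⟩
  · rw [if_neg hc] at hstep
    rw [wp_storeInt]
    refine ⟨⟨hR.setIArr (by norm_num) _, _, ?_, hstep⟩, by simpa using h0, by simpa using h1⟩
    simp only [State.setIArr_intArr, Function.update_self, IExpr.eval, hz, h0, hcand]
    exact writeAt_tab rfl _

theorem insertBody_wp {S : Inst} (hS : S.Valid) {s : State} {i : ℕ} (hi : i < S.n)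
    (h : CollectMem S i 0 0 s) (h0 : s.intReg 0 = i) :
    (insertBody S.N S.R).WP (CollectMem S (i + 1) 0 0) s := by
  have hit : i < S.tot := by unfold Inst.tot; omega
  have key := wp_seqList_range (insertCopy S.N S.R)
    (fun e s => CollectMem S i e 0 s ∧ s.intReg 0 = i) (n := 5 * S.N) (s := s) ⟨h, h0⟩ ?_
  · refine Prog.WP.mono key ?_
    rintro s' ⟨⟨hR, cand, hcand, hI⟩, -⟩
    refine ⟨hR, cand, hcand, hI.congr fun i' e' d' => ?_⟩
    unfold Before
    refine and_congr_right fun hev => ?_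
    have := hev.e_lt
    omega
  · rintro e he s ⟨hM, h0⟩
    have hnext : ∀ s, CollectMem S i e 1681 s → CollectMem S i (e + 1) 0 s := by
      rintro s ⟨hR, cand, hcand, hI⟩
      refine ⟨hR, cand, hcand, hI.congr fun i' e' d' => ?_⟩
      unfold Before
      refine and_congr_right fun hev => ?_
      have := hev.d_lt
      omega
    unfold insertCopy
    split_ifs with h4
    · rw [wp_seq, wp_setInt, hM.1.slotExpr_eval hS h0 hit he]
      have hd := wp_seqList_range insertProg (fun d s => CollectMem S i e d s ∧ s.intReg 0 = i ∧
        s.intReg 1 = S.slot i e 0) (n := 1681) (s := s.setReg 1 (S.slot i e 0)) ?_ ?_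
      · exact Prog.WP.mono hd fun s' hs' => ⟨hnext s' hs'.1, hs'.2.1⟩
      · obtain ⟨hR, cand, hcand, hI⟩ := hM
        exact ⟨⟨hR.setReg (by norm_num) _, cand, hcand, hI⟩, by simpa using h0, by simp⟩
      · rintro d hd s ⟨hM, h0, h1⟩
        exact insertProg_wp hS ⟨hi, he, h4, hd⟩ hM h0 h1
    -- Copies with residue `4` serve the points of `P'` only and cause no events.
    · obtain ⟨hR, cand, hcand, hI⟩ := hM
      refine ⟨⟨hR, cand, hcand, hI.congr fun i' e' d' => ?_⟩, h0⟩
      unfold Before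
      refine and_congr_right fun hev => ?_
      have h5 := hev.e_mod
      have : e' ≠ e := by rintro rfl; exact h4 h5
      omega

/-- Running time of the collection of candidates, per point. -/
def collectCost (N R : ℕ) : ℕ :=
  (5 * N * slotsOf N R + 1) * 15 + ((insertBody N R).costBound + 9)

theorem collectProg_runs {S : Inst} (hS : S.Valid) {s : State} (h : Ready S s)
    (h5 : s.intArr 5 = []) (h7 : s.intArr 7 = []) :
    Runs (collectProg S.N S.R) s (collectCost S.N S.R * (S.tot + 1)) (fun s' => Ready S s' ∧
      s'.intArr 7 = tab (S.tot * (5 * S.N) * S.slots) (fun _ => 0) ∧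
      ∃ cand : ℕ → ℤ, s'.intArr 5 = tab (S.tot * (5 * S.N) * S.slots) cand ∧
        S.CandSpec cand) := by
  have hK : slotsOf S.N S.R = S.slots := rfl
  have h1 : Runs (forLoop 0 (.mul (.lenInt 4) (.const (slotsOf S.N S.R)))
      (.seq (.pushInt 5 (.const (-1))) (.pushInt 7 (.const 0)))) s
      ((S.tot * (5 * S.N) * S.slots + 1) * (4 + 3 + 8)) (fun s' => Ready S s' ∧
        s'.intArr 5 = tab (S.tot * (5 * S.N) * S.slots) (fun _ => -1) ∧
        s'.intArr 7 = tab (S.tot * (5 * S.N) * S.slots) (fun _ => 0)) := by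
    refine Runs.forLoop _ 4 (fun i s' => Ready S s' ∧ s'.intArr 5 = tab i (fun _ => -1) ∧
        s'.intArr 7 = tab i (fun _ => 0)) ?_ ?_ ?_ ?_
    · exact ⟨h.setReg (by norm_num) _, by simpa using h5, by simpa using h7⟩
    · simp [Prog.Mod]
    · rintro i - s' - ⟨hR, -⟩
      simp [IExpr.eval, hR.id, hK]
    · rintro i - s' - - ⟨hR, h5, h7⟩
      refine Prog.LoopFree.runs_of_wp (p := .seq (.pushInt 5 (.const (-1)))
        (.pushInt 7 (.const 0))) ⟨trivial, trivial⟩ ?_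
      simp only [wp_seq, wp_pushInt]
      refine ⟨((hR.setIArr (by norm_num) _).setIArr (by norm_num) _).setReg (by norm_num) _, ?_, ?_⟩
      · simp [h5, IExpr.eval, tab_succ]
      · simp [h7, IExpr.eval, tab_succ]
  have h2 : ∀ s₁ : State, Ready S s₁ →
      s₁.intArr 5 = tab (S.tot * (5 * S.N) * S.slots) (fun _ => -1) →
      s₁.intArr 7 = tab (S.tot * (5 * S.N) * S.slots) (fun _ => 0) →
      Runs (forLoop 0 (.reg 10) (insertBody S.N S.R)) s₁
        ((S.n + 1) * ((insertBody S.N S.R).costBound + 1 + 8)) (fun s' => Ready S s' ∧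
        s'.intArr 7 = tab (S.tot * (5 * S.N) * S.slots) (fun _ => 0) ∧
        ∃ cand : ℕ → ℤ, s'.intArr 5 = tab (S.tot * (5 * S.N) * S.slots) cand ∧
          S.CandSpec cand) := by
    intro s₁ hR h5 h7
    refine Runs.mono (Runs.forLoop S.n (insertBody S.N S.R).costBound
      (fun i s' => CollectMem S i 0 0 s') ?_ ?_ ?_ ?_) le_rfl ?_
    -- The initial entry `-1` marks an empty slot, so initially no slot claims an event.
    · refine ⟨hR.setReg (by norm_num) _, _, h5, ?_, ?_⟩
      · rintro i e d ⟨-, h⟩; omega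
      · intro σ _ h; norm_num at h
    · intro h; have := insertBody_mod h; simp at this
    · rintro i - s' - ⟨hR, -⟩
      exact hR.n
    · rintro i hi s' - h0 hM
      refine Prog.LoopFree.runs_of_wp (insertBody_loopFree _ _) ?_
      refine (insertBody_wp hS hi hM h0).mono ?_
      rintro s'' ⟨hR, cand, hcand, hI⟩
      exact ⟨hR.setReg (by norm_num) _, cand, hcand, hI⟩
    · rintro s' hag ⟨hR, cand, hcand, hI⟩
      refine ⟨hR, ?_, cand, hcand, ?_, ?_⟩
      · rw [hag.iarr 7, h7]
        intro h
        rcases forLoop_mod.1 h with h | h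
        · simp at h
        · have := insertBody_mod h; simp at this
      · intro i e d hev
        obtain ⟨i', e', h1, h2⟩ := hI.extreme i e d ⟨hev, Or.inl hev.i_lt⟩
        exact ⟨i', e', h1.1, h2⟩
      · intro σ hσ h0
        obtain ⟨i, e, d, h1, h2⟩ := hI.event σ hσ h0
        exact ⟨i, e, d, h1.1, h2⟩
  refine Runs.mono (Runs.seq (h1.mono le_rfl fun s₁ _ hs₁ => h2 s₁ hs₁.1 hs₁.2.1 hs₁.2.2)) ?_
    (fun _ _ h => h)
  have e1 : (S.tot * (5 * S.N) * S.slots + 1) ≤ (5 * S.N * slotsOf S.N S.R + 1) * (S.tot + 1) := by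
    rw [hK]; ring_nf; omega
  have e2 : S.n + 1 ≤ S.tot + 1 := by unfold Inst.tot; omega
  have e3 := Nat.mul_le_mul_right 15 e1
  have e4 := Nat.mul_le_mul_right ((insertBody S.N S.R).costBound + 9) e2
  unfold collectCost
  refine le_trans (le_of_eq ?_) ((add_le_add e3 e4).trans (le_of_eq ?_)) <;> ring

/-- Definition by cases. -/
noncomputable def pick {α : Type} (P : Prop) (a b : α) : α := open Classical in if P then a else b

theorem pick_pos {α : Type} {P : Prop} (h : P) (a b : α) : pick P a b = a := if_pos h

theorem pick_neg {α : Type} {P : Prop} (h : ¬ P) (a b : α) : pick P a b = b := if_neg h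

/-! #### Trying all selections -/

/-- Squared distance of two points given by their indices. -/
def sqdExpr (a b : IExpr) : RExpr :=
  .add (.mul (.sub (.get 0 a) (.get 0 b)) (.sub (.get 0 a) (.get 0 b)))
    (.mul (.sub (.get 1 a) (.get 1 b)) (.sub (.get 1 a) (.get 1 b)))

/-- The candidate in slot `j` of the cell `reg 1`. -/
def candExpr (K j : ℕ) : IExpr := .get 5 (.add (.mul (.reg 1) (.const K)) (.const j))

/-- Set `reg 2` to `1` if the point with index `reg 10 + reg 0` is dominated by the candidate in
slot `j` of the cell `reg 1`. -/
def checkSlot (K j : ℕ) : Prog :=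
  .branch (.and (.leInt (.const 0) (candExpr K j))
      (.leReal (sqdExpr (candExpr K j) (.add (.reg 10) (.reg 0))) (.const 4)))
    (.setInt 2 (.const 1)) .skip

/-- Mark the cell of the point with index `reg 10 + reg 0` for the shift `t` as infeasible if the
point is not dominated by the selection `m`. -/
noncomputable def checkShift (N K : ℕ) (m : Finset ℕ) (t : ℕ) : Prog :=
  .seq (.setInt 1 (.get 4 (copyIdx N (.add (.reg 10) (.reg 0)) (5 * t + 4)))) <|
  .seq (.setInt 2 (.const 0)) <| .seq (seqList (m.toList.map (checkSlot K))) <|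
  .branch (.leInt (.reg 2) (.const 0)) (.storeInt 6 (.reg 1) (.const 0)) .skip

/-- All shifts. -/
noncomputable def checkBody (N K : ℕ) (m : Finset ℕ) : Prog :=
  seqList ((List.range N).map (checkShift N K m))

/-- Replace the selection in the cell `reg 0` by `m`. -/
def copyMask (K : ℕ) (m : Finset ℕ) : Prog :=
  seqList ((List.range K).map fun j : ℕ =>
    Prog.storeInt 7 (.add (.mul (.reg 0) (.const (K : ℤ))) (.const (j : ℤ)))
      (.const (if j ∈ m then 1 else 0)))

/-- Replace the selection by `m` in all cells where it is feasible. -/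
noncomputable def maskProg (N K : ℕ) (m : Finset ℕ) : Prog :=
  .seq (forLoop 0 (.lenInt 4) (.storeInt 6 (.reg 0) (.const 1))) <|
  .seq (forLoop 0 (.sub (.reg 11) (.reg 10)) (checkBody N K m)) <|
  forLoop 0 (.lenInt 4) (.branch (.ltInt (.const 0) (.get 6 (.reg 0))) (copyMask K m) .skip)

/-- All selections, the larger ones first. -/
noncomputable def masks (K : ℕ) : List (Finset ℕ) :=
  (List.range (K + 1)).reverse.flatMap fun k => ((Finset.range K).powersetCard k).toList

/-- Determine a smallest feasible selection for each cell. -/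
noncomputable def selectProg (N K : ℕ) : Prog :=
  .seq (forLoop 0 (.lenInt 4) (.pushInt 6 (.const 0))) (seqList ((masks K).map (maskProg N K)))

theorem mem_masks {K : ℕ} {m : Finset ℕ} : m ∈ masks K ↔ m ⊆ Finset.range K := by
  simp only [masks, List.mem_flatMap, List.mem_reverse, List.mem_range, Finset.mem_toList,
    Finset.mem_powersetCard]
  constructor
  · rintro ⟨k, -, h, -⟩; exact h
  · intro h
    have := Finset.card_le_card h
    rw [Finset.card_range] at this
    exact ⟨m.card, by omega, h, rfl⟩

/-- Since the sizes never increase, simply overwriting the selection by each feasible one leaves a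
smallest feasible selection at the end, without any comparison of sizes. -/
theorem masks_pairwise (K : ℕ) : (masks K).Pairwise fun m m' => m'.card ≤ m.card := by
  rw [masks, List.pairwise_flatMap]
  constructor
  · intro k _
    refine List.Pairwise.imp_of_mem (R := fun _ _ => True) ?_ (List.pairwise_of_forall fun _ _ => trivial)
    intro a b ha hb _
    simp only [Finset.mem_toList, Finset.mem_powersetCard] at ha hb
    omega
  · rw [List.pairwise_reverse]
    refine List.pairwise_lt_range.imp ?_
    intro a b hab x hx y hy
    simp only [Finset.mem_toList, Finset.mem_powersetCard] at hx hy
    omega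

theorem checkSlot_loopFree (K j : ℕ) : (checkSlot K j).LoopFree := by
  simp [checkSlot, Prog.LoopFree]

theorem checkShift_loopFree (N K : ℕ) (m : Finset ℕ) (t : ℕ) : (checkShift N K m t).LoopFree := by
  simp [checkShift, Prog.LoopFree, seqList_loopFree, checkSlot_loopFree]

theorem checkBody_loopFree (N K : ℕ) (m : Finset ℕ) : (checkBody N K m).LoopFree := by
  simp [checkBody, seqList_loopFree, checkShift_loopFree]

theorem copyMask_loopFree (K : ℕ) (m : Finset ℕ) : (copyMask K m).LoopFree := by
  simp [copyMask, seqList_loopFree, Prog.LoopFree]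

theorem checkBody_mod {N K : ℕ} {m : Finset ℕ} {l : Loc} (h : (checkBody N K m).Mod l) :
    l = .ireg 1 ∨ l = .ireg 2 ∨ l = .iarr 6 := by
  simp only [checkBody, seqList_mod, List.mem_map] at h
  obtain ⟨_, ⟨t, -, rfl⟩, h⟩ := h
  simp only [checkShift, Prog.Mod, seqList_mod, List.mem_map] at h
  rcases h with h | h | ⟨_, ⟨j, -, rfl⟩, h⟩ | h
  · exact Or.inl h
  · exact Or.inr (Or.inl h)
  · simp only [checkSlot, Prog.Mod, or_false] at h
    exact Or.inr (Or.inl h)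
  · simp only [or_false] at h
    exact Or.inr (Or.inr h)

theorem copyMask_mod {K : ℕ} {m : Finset ℕ} {l : Loc} (h : (copyMask K m).Mod l) :
    l = .iarr 7 := by
  simp only [copyMask, seqList_mod, List.mem_map] at h
  obtain ⟨_, ⟨t, -, rfl⟩, h⟩ := h
  exact h

/-- The candidates in the slots from `m` dominate the point `q` of `P'`. -/
def Dom (S : Inst) (cand : ℕ → ℤ) (m : Finset ℕ) (κ q : ℕ) : Prop :=
  ∃ j ∈ m, 0 ≤ cand (κ * S.slots + j) ∧ S.sqd (cand (κ * S.slots + j)).toNat (S.n + q) ≤ 4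

/-- Memory while selections are tried. -/
structure MaskMem (S : Inst) (cand : ℕ → ℤ) (s : State) : Prop where
  ready : Ready S s
  cand : s.intArr 5 = tab (S.tot * (5 * S.N) * S.slots) cand

theorem MaskMem.setReg {S : Inst} {cand : ℕ → ℤ} {s : State} (h : MaskMem S cand s) {x : ℕ}
    (hx : x < 10) (v : ℤ) : MaskMem S cand (s.setReg x v) :=
  ⟨h.ready.setReg hx v, h.cand⟩

theorem MaskMem.setIArr {S : Inst} {cand : ℕ → ℤ} {s : State} (h : MaskMem S cand s) {a : ℕ}
    (ha : 6 ≤ a) (v : List ℤ) : MaskMem S cand (s.setIArr a v) := by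
  have h5 : (5 : ℕ) ≠ a := by omega
  exact ⟨h.ready.setIArr (by omega) v, by simpa [h5] using h.cand⟩

theorem Ready.sqdExpr_eval {S : Inst} {s : State} (h : Ready S s) {a b : IExpr} {i j : ℕ}
    (ha : a.eval s = i) (hb : b.eval s = j) (hi : i < S.tot) (hj : j < S.tot) :
    (sqdExpr a b).eval s = S.sqd i j := by
  simp only [sqdExpr, RExpr.eval, ha, hb, h.xs, h.ys, readAt_tab rfl hi, readAt_tab rfl hj,
    Inst.sqd]
  ring

theorem checkSlot_wp {S : Inst} {cand : ℕ → ℤ} (hc : S.CandSpec cand) {s : State} {q κ j : ℕ}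
    (h : MaskMem S cand s) (h0 : s.intReg 0 = q) (hq : q < S.n') (h1 : s.intReg 1 = κ)
    (hκ : κ < S.tot * (5 * S.N)) (hj : j < S.slots) {P : Prop}
    (h2 : s.intReg 2 = pick P 1 0) :
    (checkSlot S.slots j).WP (fun s' => MaskMem S cand s' ∧ s'.intReg 0 = q ∧ s'.intReg 1 = κ ∧
      s'.intArr 6 = s.intArr 6 ∧ s'.intReg 2 = pick (P ∨ (0 ≤ cand (κ * S.slots + j) ∧
        S.sqd (cand (κ * S.slots + j)).toNat (S.n + q) ≤ 4)) 1 0) s := by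
  have hlt := Inst.digits_lt hκ hj
  have hget : (candExpr S.slots j).eval s = cand (κ * S.slots + j) := by
    simp only [candExpr, IExpr.eval, h1, h.cand]
    exact readAt_tab (by push_cast; rfl) hlt
  have hH : (BExpr.and (.leInt (.const 0) (candExpr S.slots j))
      (.leReal (sqdExpr (candExpr S.slots j) (.add (.reg 10) (.reg 0))) (.const 4))).Holds s ↔
      (0 ≤ cand (κ * S.slots + j) ∧ S.sqd (cand (κ * S.slots + j)).toNat (S.n + q) ≤ 4) := by
    simp only [BExpr.Holds, hget]
    refine and_congr_right fun hc0 => ?_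
    obtain ⟨i, e, d, hE, hi, -⟩ := hc.event _ hlt hc0
    have hit : i < S.tot := by have := hE.i_lt; unfold Inst.tot; omega
    rw [h.ready.sqdExpr_eval (hget.trans hi) (j := S.n + q)
      (by simp [IExpr.eval, h.ready.n, h0]) hit (by unfold Inst.tot; omega), hi, Int.toNat_natCast]
    simp [RExpr.eval]
  rw [checkSlot, wp_branch, hH]
  refine ⟨fun hh => ?_, fun hh => ?_⟩
  · rw [wp_setInt]
    exact ⟨h.setReg (by norm_num) _, by simpa using h0, by simpa using h1, by simp,
      by rw [pick_pos (Or.inr hh)]; simp [IExpr.eval]⟩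
  · rw [wp_skip]
    exact ⟨h, h0, h1, rfl, by simp only [hh, or_false, h2]⟩

/-- Flags are only ever cleared. For cells other than that of the tested point the implication holds
vacuously, so their flags keep the value `f κ`. -/
theorem checkShift_wp {S : Inst} (hS : S.Valid) {cand : ℕ → ℤ} (hc : S.CandSpec cand) {s : State}
    {q t : ℕ} {m : Finset ℕ} (hm : m ⊆ Finset.range S.slots)
    (h : MaskMem S cand s) (h0 : s.intReg 0 = q) (hq : q < S.n') (ht : t < S.N) {f : ℕ → ℤ}
    (h6 : s.intArr 6 = tab (S.tot * (5 * S.N)) f) :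
    (checkShift S.N S.slots m t).WP (fun s' => MaskMem S cand s' ∧ s'.intReg 0 = q ∧
      s'.intArr 6 = tab (S.tot * (5 * S.N)) (fun κ =>
        pick (S.id (S.n + q) (5 * t + 4) = κ → Dom S cand m κ q) (f κ) 0)) s := by
  have hqt : S.n + q < S.tot := by unfold Inst.tot; omega
  obtain ⟨κ, hκ⟩ : ∃ κ, κ = S.id (S.n + q) (5 * t + 4) := ⟨_, rfl⟩
  have hκlt : κ < S.tot * (5 * S.N) := hκ ▸ hS.id_lt _ hqt _ (by omega)
  have hid : (IExpr.get 4 (copyIdx S.N (.add (.reg 10) (.reg 0)) (5 * t + 4))).eval s = κ := by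
    simp only [IExpr.eval, copyIdx, h.ready.n, h0]
    rw [hκ]
    exact h.ready.read_id (by push_cast; ring) hqt (by omega)
  rw [checkShift, wp_seq, wp_setInt, hid, wp_seq, wp_setInt, wp_seq]
  have key := wp_seqList (checkSlot S.slots) (l := m.toList)
    (s := (s.setReg 1 κ).setReg 2 (IExpr.eval (s.setReg 1 κ) (.const 0)))
    (fun pre s' => MaskMem S cand s' ∧ s'.intReg 0 = q ∧ s'.intReg 1 = κ ∧
      s'.intArr 6 = tab (S.tot * (5 * S.N)) f ∧
      s'.intReg 2 = pick (∃ j ∈ pre, 0 ≤ cand (κ * S.slots + j) ∧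
        S.sqd (cand (κ * S.slots + j)).toNat (S.n + q) ≤ 4) 1 0) ?_ ?_
  · refine Prog.WP.mono key ?_
    rintro s' ⟨hM, h0, h1, h6, h2⟩
    have hD : (∃ j ∈ m.toList, 0 ≤ cand (κ * S.slots + j) ∧
        S.sqd (cand (κ * S.slots + j)).toNat (S.n + q) ≤ 4) ↔ Dom S cand m κ q := by
      simp [Dom]
    rw [hD] at h2
    have hneg : ∀ k, (S.id (S.n + q) (5 * t + 4) = k → Dom S cand m k q) ↔
        ¬ (k = κ ∧ ¬ Dom S cand m κ q) := by
      intro k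
      rw [← hκ]
      constructor
      · rintro h ⟨rfl, h'⟩; exact h' (h rfl)
      · rintro h rfl; by_contra h'; exact h ⟨rfl, h'⟩
    rw [wp_branch]
    simp only [BExpr.Holds, IExpr.eval, h2]
    refine ⟨fun hh => ?_, fun hh => ?_⟩
    · have hd : ¬ Dom S cand m κ q := by
        intro hd; rw [pick_pos hd] at hh; norm_num at hh
      rw [wp_storeInt]
      refine ⟨hM.setIArr (by norm_num) _, by simpa using h0, ?_⟩
      simp only [State.setIArr_intArr, Function.update_self, IExpr.eval, h1, h6]
      rw [writeAt_tab rfl]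
      refine tab_congr fun k _ => ?_
      rw [Function.update_apply]
      split_ifs with hk
      · rw [pick_neg fun h => (hneg k).1 h ⟨hk, hd⟩]
      · rw [pick_pos ((hneg k).2 fun h => hk h.1)]
    · have hd : Dom S cand m κ q := by
        by_contra hd; rw [pick_neg hd] at hh; norm_num at hh
      rw [wp_skip]
      refine ⟨hM, h0, h6.trans (tab_congr fun k _ => ?_)⟩
      rw [pick_pos ((hneg k).2 fun h => h.2 hd)]
  · exact ⟨(h.setReg (by norm_num) _).setReg (by norm_num) _, by simpa using h0, by simp,
      by simpa using h6, by rw [pick_neg (by simp)]; simp [IExpr.eval]⟩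
  · rintro pre j post hl s' ⟨hM, h0, h1, h6, h2⟩
    have hj : j ∈ m := by
      rw [← Finset.mem_toList, hl]; simp
    refine (checkSlot_wp hc hM h0 hq h1 hκlt (Finset.mem_range.1 (hm hj)) h2).mono ?_
    rintro s'' ⟨hM, h0, h1, h6', h2⟩
    refine ⟨hM, h0, h1, h6'.trans h6, h2.trans ?_⟩
    congr 1
    simp [or_and_right, exists_or]

theorem checkBody_wp {S : Inst} (hS : S.Valid) {cand : ℕ → ℤ} (hc : S.CandSpec cand) {s : State}
    {q : ℕ} {m : Finset ℕ} (hm : m ⊆ Finset.range S.slots)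
    (h : MaskMem S cand s) (h0 : s.intReg 0 = q) (hq : q < S.n') {f : ℕ → ℤ}
    (h6 : s.intArr 6 = tab (S.tot * (5 * S.N)) f) :
    (checkBody S.N S.slots m).WP (fun s' => MaskMem S cand s' ∧
      s'.intArr 6 = tab (S.tot * (5 * S.N)) (fun κ =>
        pick (∀ t < S.N, S.id (S.n + q) (5 * t + 4) = κ → Dom S cand m κ q) (f κ) 0)) s := by
  refine Prog.WP.mono (wp_seqList_range (checkShift S.N S.slots m) (fun T s' => MaskMem S cand s' ∧
    s'.intReg 0 = q ∧ s'.intArr 6 = tab (S.tot * (5 * S.N)) (fun κ =>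
      pick (∀ t < T, S.id (S.n + q) (5 * t + 4) = κ → Dom S cand m κ q) (f κ) 0)) ?_ ?_) ?_
  · exact ⟨h, h0, h6.trans (tab_congr fun κ _ => by rw [pick_pos (by simp)])⟩
  · rintro t ht s' ⟨hM, h0, h6⟩
    refine (checkShift_wp hS hc hm hM h0 hq ht h6).mono ?_
    rintro s'' ⟨hM, h0, h6⟩
    refine ⟨hM, h0, h6.trans (tab_congr fun κ _ => ?_)⟩
    simp only [Nat.lt_succ_iff_lt_or_eq]
    by_cases h1 : S.id (S.n + q) (5 * t + 4) = κ → Dom S cand m κ q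
    · rw [pick_pos h1]
      congr 1
      refine propext ⟨fun h2 t' ht' => ?_, fun h2 t' ht' => h2 t' (Or.inl ht')⟩
      rcases ht' with ht' | rfl
      · exact h2 t' ht'
      · exact h1
    · rw [pick_neg h1, pick_neg fun h2 => h1 (h2 t (Or.inr rfl))]
  · rintro s' ⟨hM, -, h6⟩
    exact ⟨hM, h6⟩

/-- Bit table of a family of selections. -/
def bitTab (S : Inst) (sel : ℕ → Finset ℕ) : List ℤ :=
  tab (S.tot * (5 * S.N) * S.slots) fun z => if z % S.slots ∈ sel (z / S.slots) then 1 else 0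

/-- The invariant says that the first `J` bits of the block of the cell already show `m`, and that
everything else is as before. After the last bit, lying in the block is the same as having quotient
`κ`. -/
theorem copyMask_wp {S : Inst} {cand : ℕ → ℤ} {s : State} {κ : ℕ} {m : Finset ℕ}
    (h : MaskMem S cand s) (h0 : s.intReg 0 = κ) {sel : ℕ → Finset ℕ}
    (h7 : s.intArr 7 = bitTab S sel) :
    (copyMask S.slots m).WP (fun s' => MaskMem S cand s' ∧ s'.intArr 6 = s.intArr 6 ∧
      s'.intArr 7 = bitTab S (Function.update sel κ m)) s := by
  unfold copyMask
  refine Prog.WP.mono (wp_seqList_range _ (fun J s' => MaskMem S cand s' ∧ s'.intReg 0 = κ ∧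
    s'.intArr 6 = s.intArr 6 ∧ s'.intArr 7 = tab (S.tot * (5 * S.N) * S.slots) fun z =>
      if κ * S.slots ≤ z ∧ z < κ * S.slots + J then (if z - κ * S.slots ∈ m then 1 else 0)
      else if z % S.slots ∈ sel (z / S.slots) then 1 else 0) ?_ ?_) ?_
  · refine ⟨h, h0, rfl, h7.trans (tab_congr fun z _ => ?_)⟩
    have hz : ¬ (κ * S.slots ≤ z ∧ z < κ * S.slots + 0) := by omega
    rw [if_neg hz]
  · rintro j hj s' ⟨hM, h0, h6, h7⟩
    rw [wp_storeInt]
    refine ⟨hM.setIArr (by norm_num) _, by simpa using h0, by simpa using h6, ?_⟩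
    simp only [State.setIArr_intArr, Function.update_self, IExpr.eval, h0, h7]
    rw [writeAt_tab (i := κ * S.slots + j) (by push_cast; rfl)]
    refine tab_congr fun z _ => ?_
    rw [Function.update_apply]
    by_cases hz : z = κ * S.slots + j
    · subst hz
      have hz : κ * S.slots ≤ κ * S.slots + j ∧ κ * S.slots + j < κ * S.slots + (j + 1) := by omega
      rw [if_pos rfl, if_pos hz, Nat.add_sub_cancel_left]
    · rw [if_neg hz]
      congr 1
      refine propext ⟨fun h => by omega, fun h => by omega⟩
  · rintro s' ⟨hM, -, h6, h7⟩
    refine ⟨hM, h6, h7.trans (tab_congr fun z hz => ?_)⟩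
    have hK : 0 < S.slots := by
      rcases Nat.eq_zero_or_pos S.slots with h | h
      · rw [h, mul_zero] at hz; omega
      · exact h
    have h1 := Nat.mod_add_div z S.slots
    have h2 := Nat.mod_lt z hK
    by_cases hd : z / S.slots = κ
    · rw [mul_comm, hd] at h1
      rw [if_pos (by omega), hd, Function.update_self]
      have : z - κ * S.slots = z % S.slots := by omega
      rw [this]
    · rw [Function.update_of_ne hd, if_neg]
      rintro ⟨h3, h4⟩
      apply hd
      rw [Nat.div_eq_iff hK]
      have h5 : κ * S.slots + S.slots = (κ + 1) * S.slots := by ring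
      omega

/-- Running time for one selection, per point. -/
noncomputable def maskCost (N R : ℕ) (m : Finset ℕ) : ℕ :=
  (5 * N + 1) * 13 + ((checkBody N (slotsOf N R) m).costBound + 11) +
    (5 * N + 1) * ((copyMask (slotsOf N R) m).costBound + 20)

/-- A fixed selection is tested in all cells at once. Every cell is first presumed feasible, each
point of `P'` then refutes its cells in which it is undominated, and the selection is written into
the cells that remain. This costs constant time per point and per cell, as `m` is unrolled into the
program. -/
theorem maskProg_runs {S : Inst} (hS : S.Valid) {cand : ℕ → ℤ} (hc : S.CandSpec cand) {s : State}
    {m : Finset ℕ} (hm : m ⊆ Finset.range S.slots) (h : MaskMem S cand s) {f : ℕ → ℤ}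
    (h6 : s.intArr 6 = tab (S.tot * (5 * S.N)) f) {sel : ℕ → Finset ℕ}
    (h7 : s.intArr 7 = bitTab S sel) :
    Runs (maskProg S.N S.slots m) s (maskCost S.N S.R m * (S.tot + 1)) (fun s' =>
      MaskMem S cand s' ∧ (∃ f : ℕ → ℤ, s'.intArr 6 = tab (S.tot * (5 * S.N)) f) ∧
      ∃ sel' : ℕ → Finset ℕ, s'.intArr 7 = bitTab S sel' ∧ ∀ κ < S.tot * (5 * S.N),
        sel' κ = pick (S.Feas cand m κ) m (sel κ)) := by
  have hK : slotsOf S.N S.R = S.slots := rfl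
  obtain ⟨M, hM⟩ : ∃ M, M = S.tot * (5 * S.N) := ⟨_, rfl⟩
  have r1 : Runs (forLoop 0 (.lenInt 4) (.storeInt 6 (.reg 0) (.const 1))) s
      ((M + 1) * (3 + 1 + 8)) (fun s' => MaskMem S cand s' ∧ s'.intArr 7 = bitTab S sel ∧
        s'.intArr 6 = tab M fun _ => 1) := by
    refine Runs.mono (Runs.forLoop M 3 (fun i s' => MaskMem S cand s' ∧ s'.intArr 7 = bitTab S sel ∧
      s'.intArr 6 = tab M fun κ => if κ < i then 1 else f κ) ?_ ?_ ?_ ?_) le_rfl ?_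
    · exact ⟨h.setReg (by norm_num) _, by simpa using h7, by simpa [hM] using h6⟩
    · simp [Prog.Mod]
    · rintro i - s' - ⟨hR, -⟩
      simp [IExpr.eval, hR.ready.id, hM]
    · rintro i hi s' - h0 ⟨hR, h7, h6⟩
      refine Prog.LoopFree.runs_of_wp (p := .storeInt 6 (.reg 0) (.const 1)) trivial ?_
      rw [wp_storeInt]
      refine ⟨(hR.setIArr (by norm_num) _).setReg (by norm_num) _, by simpa using h7, ?_⟩
      simp only [State.setReg_intArr, State.setIArr_intArr, Function.update_self, IExpr.eval, h0, h6]
      rw [writeAt_tab rfl]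
      refine tab_congr fun z _ => ?_
      rw [Function.update_apply]
      by_cases hz : z = i
      · simp [hz]
      · have : z < i + 1 ↔ z < i := by omega
        simp [hz, this]
    · rintro s' - ⟨hR, h7, h6⟩
      exact ⟨hR, h7, h6.trans (tab_congr fun z hz => if_pos hz)⟩
  have r2 : ∀ s₁, MaskMem S cand s₁ → s₁.intArr 7 = bitTab S sel → s₁.intArr 6 = tab M (fun _ => 1) →
      Runs (forLoop 0 (.sub (.reg 11) (.reg 10)) (checkBody S.N S.slots m)) s₁
        ((S.n' + 1) * ((checkBody S.N S.slots m).costBound + 3 + 8)) (fun s' =>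
        MaskMem S cand s' ∧ s'.intArr 7 = bitTab S sel ∧
        s'.intArr 6 = tab M fun κ => pick (S.Feas cand m κ) 1 0) := by
    intro s₁ h h7 h6
    refine Runs.mono (Runs.forLoop S.n' (checkBody S.N S.slots m).costBound
      (fun i s' => MaskMem S cand s' ∧ s'.intArr 7 = bitTab S sel ∧ s'.intArr 6 = tab M fun κ =>
        pick (∀ q < i, ∀ t < S.N, S.id (S.n + q) (5 * t + 4) = κ → Dom S cand m κ q) 1 0)
      ?_ ?_ ?_ ?_) le_rfl ?_
    · exact ⟨h.setReg (by norm_num) _, by simpa using h7,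
        h6.trans (tab_congr fun κ _ => by rw [pick_pos (by simp)])⟩
    · intro h; have := checkBody_mod h; simp at this
    · rintro i - s' - ⟨hR, -⟩
      simp [IExpr.eval, hR.ready.n, hR.ready.tot, Inst.tot]
    · rintro q hq s' - h0 ⟨hR, h7, h6⟩
      refine Runs.mono (Prog.LoopFree.runs_of_wp (checkBody_loopFree _ _ _)
        (checkBody_wp hS hc hm hR h0 hq (hM ▸ h6))) le_rfl ?_
      rintro s'' hag ⟨hR', h6'⟩
      refine ⟨hR'.setReg (by norm_num) _, ?_, ?_⟩
      · rw [State.setReg_intArr, hag.iarr 7, h7]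
        intro h; have := checkBody_mod h; simp at this
      · rw [State.setReg_intArr, h6', hM]
        refine tab_congr fun κ _ => ?_
        simp only [Nat.lt_succ_iff_lt_or_eq]
        by_cases h1 : ∀ t < S.N, S.id (S.n + q) (5 * t + 4) = κ → Dom S cand m κ q
        · rw [pick_pos h1]
          congr 1
          refine propext ⟨fun h2 t' ht' => ?_, fun h2 t' ht' => h2 t' (Or.inl ht')⟩
          rcases ht' with ht' | rfl
          · exact h2 t' ht'
          · exact h1
        · rw [pick_neg h1, pick_neg fun h2 => h1 (h2 q (Or.inr rfl))]
    · rintro s' - ⟨hR, h7, h6⟩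
      exact ⟨hR, h7, h6⟩
  have r3 : ∀ s₁, MaskMem S cand s₁ → s₁.intArr 7 = bitTab S sel →
      s₁.intArr 6 = tab M (fun κ => pick (S.Feas cand m κ) 1 0) →
      Runs (forLoop 0 (.lenInt 4) (.branch (.ltInt (.const 0) (.get 6 (.reg 0)))
        (copyMask S.slots m) .skip)) s₁
        ((M + 1) * (((copyMask S.slots m).costBound + 10) + 1 + 8)) (fun s' =>
        MaskMem S cand s' ∧ (∃ f : ℕ → ℤ, s'.intArr 6 = tab M f) ∧
        ∃ sel' : ℕ → Finset ℕ, s'.intArr 7 = bitTab S sel' ∧ ∀ κ < M,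
          sel' κ = pick (S.Feas cand m κ) m (sel κ)) := by
    intro s₁ h h7 h6
    refine Runs.mono (Runs.forLoop M ((copyMask S.slots m).costBound + 10)
      (fun i s' => MaskMem S cand s' ∧
        s'.intArr 6 = tab M (fun κ => pick (S.Feas cand m κ) 1 0) ∧
        s'.intArr 7 = bitTab S (fun κ => pick (κ < i ∧ S.Feas cand m κ) m (sel κ)))
      ?_ ?_ ?_ ?_) le_rfl ?_
    · refine ⟨h.setReg (by norm_num) _, by simpa using h6, h7.trans ?_⟩
      congr 1
      ext1 κ
      rw [pick_neg (by simp)]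
    · intro h
      simp only [Prog.Mod, or_false] at h
      have := copyMask_mod h; simp at this
    · rintro i - s' - ⟨hR, -⟩
      simp [IExpr.eval, hR.ready.id, hM]
    · rintro i hi s' - h0 ⟨hR, h6, h7⟩
      refine Runs.mono (Prog.LoopFree.runs_of_wp (p := .branch (.ltInt (.const 0) (.get 6 (.reg 0)))
        (copyMask S.slots m) .skip) ⟨copyMask_loopFree _ _, trivial⟩ ?_) ?_ (fun _ _ h => h)
      · rw [wp_branch]
        simp only [BExpr.Holds, IExpr.eval, h0, h6, readAt_tab rfl hi]
        refine ⟨fun hh => ?_, fun hh => ?_⟩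
        · have hF : S.Feas cand m i := by by_contra hF; rw [pick_neg hF] at hh; norm_num at hh
          refine (copyMask_wp hR h0 h7).mono ?_
          rintro s'' ⟨hR', h6', h7'⟩
          refine ⟨hR'.setReg (by norm_num) _, by simpa using h6'.trans h6, ?_⟩
          rw [State.setReg_intArr, h7']
          congr 1
          ext1 κ
          rw [Function.update_apply]
          by_cases hκ : κ = i
          · rw [if_pos hκ, pick_pos ⟨by omega, hκ ▸ hF⟩]
          · have : κ < i + 1 ↔ κ < i := by omega
            rw [if_neg hκ, this]
        · have hF : ¬ S.Feas cand m i := by intro hF; rw [pick_pos hF] at hh; norm_num at hh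
          rw [wp_skip]
          refine ⟨hR.setReg (by norm_num) _, by simpa using h6, ?_⟩
          change s'.intArr 7 = _
          rw [h7]
          congr 1
          ext1 κ
          by_cases hκ : κ = i
          · subst hκ
            rw [pick_neg fun h => hF h.2, pick_neg fun h => hF h.2]
          · have : κ < i + 1 ↔ κ < i := by omega
            rw [this]
      · simp only [Prog.costBound, BExpr.cost, IExpr.cost]; omega
    · rintro s' - ⟨hR, h6, h7⟩
      refine ⟨hR, ⟨_, h6⟩, _, h7, fun κ hκ => ?_⟩
      simp only [hκ, true_and]
  rw [← hM]
  refine Runs.mono (Runs.seq (r1.mono le_rfl fun s₁ _ hs₁ => Runs.seq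
    ((r2 s₁ hs₁.1 hs₁.2.1 hs₁.2.2).mono le_rfl fun s₂ _ hs₂ => r3 s₂ hs₂.1 hs₂.2.1 hs₂.2.2))) ?_
    (fun _ _ h => h)
  have e1 : M + 1 ≤ (5 * S.N + 1) * (S.tot + 1) := by rw [hM]; ring_nf; omega
  have e2 : S.n' + 1 ≤ S.tot + 1 := by unfold Inst.tot; omega
  have e3 := Nat.mul_le_mul_right 12 e1
  have e4 := Nat.mul_le_mul_right ((checkBody S.N S.slots m).costBound + 11) e2
  have e5 := Nat.mul_le_mul_right ((copyMask S.slots m).costBound + 19) e1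
  have e6 : 0 ≤ (5 * S.N + 1) * (S.tot + 1) := Nat.zero_le _
  unfold maskCost
  rw [hK]
  calc _ = (M + 1) * 12 + ((S.n' + 1) * ((checkBody S.N S.slots m).costBound + 11) +
        (M + 1) * ((copyMask S.slots m).costBound + 19)) := by ring
    _ ≤ _ := add_le_add e3 (add_le_add e4 e5)
    _ ≤ _ := by ring_nf; omega

theorem maskProg_mod {N K : ℕ} {m : Finset ℕ} {l : Loc} (h : (maskProg N K m).Mod l) :
    l = .ireg 0 ∨ l = .ireg 1 ∨ l = .ireg 2 ∨ l = .iarr 6 ∨ l = .iarr 7 := by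
  simp only [maskProg, Prog.Mod, forLoop_mod, or_false] at h
  rcases h with (h | h) | (h | h) | h | h
  · exact Or.inl h
  · exact Or.inr (Or.inr (Or.inr (Or.inl h)))
  · exact Or.inl h
  · have := checkBody_mod h; tauto
  · exact Or.inl h
  · have := copyMask_mod h; tauto

theorem selectProg_mod {N K : ℕ} {l : Loc} (h : (selectProg N K).Mod l) :
    l = .ireg 0 ∨ l = .ireg 1 ∨ l = .ireg 2 ∨ l = .iarr 6 ∨ l = .iarr 7 := by
  simp only [selectProg, Prog.Mod, forLoop_mod, seqList_mod, List.mem_map] at h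
  rcases h with (h | h) | ⟨_, ⟨m, -, rfl⟩, h⟩
  · exact Or.inl h
  · exact Or.inr (Or.inr (Or.inr (Or.inl h)))
  · exact maskProg_mod h

theorem collectProg_mod {N R : ℕ} {l : Loc} (h : (collectProg N R).Mod l) :
    l = .ireg 0 ∨ l = .ireg 1 ∨ l = .iarr 5 ∨ l = .iarr 7 := by
  simp only [collectProg, Prog.Mod, forLoop_mod] at h
  rcases h with (h | h | h) | h | h
  · exact Or.inl h
  · exact Or.inr (Or.inr (Or.inl h))
  · exact Or.inr (Or.inr (Or.inr h))
  · exact Or.inl h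
  · have := insertBody_mod h; tauto

/-- Running time of the search for the best selections, per point. -/
noncomputable def selectCost (N R : ℕ) : ℕ :=
  (5 * N + 1) * 11 + ((masks (slotsOf N R)).length *
    ((masks (slotsOf N R)).map (maskCost N R)).sum + 1)

/-- The number of selections depends on `N` and `R` only, so trying them all is a linear-time
computation. The invariant compares the current selection of a cell with all feasible ones tried so
far. -/
theorem selectProg_runs {S : Inst} (hS : S.Valid) {cand : ℕ → ℤ} (hc : S.CandSpec cand) {s : State}
    (h : MaskMem S cand s) (h6 : s.intArr 6 = [])
    (h7 : s.intArr 7 = tab (S.tot * (5 * S.N) * S.slots) (fun _ => 0)) :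
    Runs (selectProg S.N S.slots) s (selectCost S.N S.R * (S.tot + 1)) (fun s' =>
      MaskMem S cand s' ∧ ∃ sel : ℕ → Finset ℕ, s'.intArr 7 = bitTab S sel ∧
        S.SelSpec cand sel) := by
  have hK : slotsOf S.N S.R = S.slots := rfl
  obtain ⟨M, hM⟩ : ∃ M, M = S.tot * (5 * S.N) := ⟨_, rfl⟩
  have r1 : Runs (forLoop 0 (.lenInt 4) (.pushInt 6 (.const 0))) s
      ((M + 1) * (2 + 1 + 8)) (fun s' => MaskMem S cand s' ∧
        s'.intArr 7 = tab (S.tot * (5 * S.N) * S.slots) (fun _ => 0) ∧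
        s'.intArr 6 = tab M fun _ => 0) := by
    refine Runs.forLoop M 2 (fun i s' => MaskMem S cand s' ∧
      s'.intArr 7 = tab (S.tot * (5 * S.N) * S.slots) (fun _ => 0) ∧
      s'.intArr 6 = tab i fun _ => 0) ?_ ?_ ?_ ?_
    · exact ⟨h.setReg (by norm_num) _, by simpa using h7, by simpa using h6⟩
    · simp [Prog.Mod]
    · rintro i - s' - ⟨hR, -⟩
      simp [IExpr.eval, hR.ready.id, hM]
    · rintro i hi s' - h0 ⟨hR, h7, h6⟩
      refine Prog.LoopFree.runs_of_wp (p := .pushInt 6 (.const 0)) trivial ?_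
      rw [wp_pushInt]
      exact ⟨(hR.setIArr (by norm_num) _).setReg (by norm_num) _, by simpa using h7,
        by simp [h6, IExpr.eval, tab_succ]⟩
  have r2 : ∀ s₁, MaskMem S cand s₁ →
      s₁.intArr 7 = tab (S.tot * (5 * S.N) * S.slots) (fun _ => 0) →
      s₁.intArr 6 = tab M (fun _ => 0) →
      Runs (seqList ((masks S.slots).map (maskProg S.N S.slots))) s₁ ((masks S.slots).length *
        (((masks S.slots).map (maskCost S.N S.R)).sum * (S.tot + 1)) + 1) (fun s' =>
        MaskMem S cand s' ∧ (∃ f : ℕ → ℤ, s'.intArr 6 = tab M f) ∧ ∃ sel : ℕ → Finset ℕ,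
          s'.intArr 7 = bitTab S sel ∧ ∀ κ < M, ∀ m ∈ masks S.slots, S.Feas cand m κ →
            S.Feas cand (sel κ) κ ∧ sel κ ⊆ Finset.range S.slots ∧ (sel κ).card ≤ m.card) := by
    intro s₁ h h7 h6
    refine Runs.seqList (maskProg S.N S.slots) (fun pre s' =>
        MaskMem S cand s' ∧ (∃ f : ℕ → ℤ, s'.intArr 6 = tab M f) ∧ ∃ sel : ℕ → Finset ℕ,
          s'.intArr 7 = bitTab S sel ∧ ∀ κ < M, ∀ m ∈ pre, S.Feas cand m κ →
            S.Feas cand (sel κ) κ ∧ sel κ ⊆ Finset.range S.slots ∧ (sel κ).card ≤ m.card) ?_ ?_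
    · exact ⟨h, ⟨_, h6⟩, fun _ => ∅, h7.trans (tab_congr fun z _ => by simp), by simp⟩
    · rintro pre a post hl s' - ⟨hR, ⟨f, h6⟩, sel, h7, hsel⟩
      have ha : a ∈ masks S.slots := by rw [hl]; simp
      have hp := masks_pairwise S.slots
      rw [hl, List.pairwise_append] at hp
      refine Runs.mono (maskProg_runs hS hc (mem_masks.1 ha) hR (hM ▸ h6) h7) ?_ ?_
      -- The rule for unrolled loops wants one cost for all rounds; the sum of the costs is a crude
      -- common bound.
      · exact Nat.mul_le_mul_right _
          (List.single_le_sum (fun _ _ => Nat.zero_le _) _ (List.mem_map_of_mem ha))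
      · rintro s'' - ⟨hR, h6, sel', h7, hsel'⟩
        rw [← hM] at h6 hsel'
        refine ⟨hR, h6, sel', h7, fun κ hκ m hm hF => ?_⟩
        rw [hsel' κ hκ]
        by_cases hFa : S.Feas cand a κ
        · rw [pick_pos hFa]
          refine ⟨hFa, mem_masks.1 ha, ?_⟩
          rcases List.mem_append.1 hm with hm | hm
          -- The selection just written is no larger than any tried before.
          · exact hp.2.2 m hm a (by simp)
          · rw [List.mem_singleton.1 hm]
        · rw [pick_neg hFa]
          rcases List.mem_append.1 hm with hm | hm
          · exact hsel κ hκ m hm hF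
          · exact absurd (List.mem_singleton.1 hm ▸ hF) hFa
  refine Runs.mono (Runs.seq (r1.mono le_rfl fun s₁ _ hs₁ => r2 s₁ hs₁.1 hs₁.2.1 hs₁.2.2)) ?_ ?_
  · have e1 : M + 1 ≤ (5 * S.N + 1) * (S.tot + 1) := by rw [hM]; ring_nf; omega
    have e2 := Nat.mul_le_mul_right 11 e1
    unfold selectCost
    rw [hK]
    calc _ ≤ (5 * S.N + 1) * (S.tot + 1) * 11 + ((masks S.slots).length *
        (((masks S.slots).map (maskCost S.N S.R)).sum * (S.tot + 1)) + (S.tot + 1)) := by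
          refine add_le_add e2 ?_; omega
      _ = _ := by ring
  · rintro s' - ⟨hR, -, sel, h7, hsel⟩
    refine ⟨hR, sel, h7, fun κ hκ m hm hF => hsel κ (hM ▸ hκ) m (mem_masks.2 hm) hF⟩

/-! #### The selected points -/

/-- Set `reg 2` to `1` if the point `reg 0` is the candidate in the slot `reg 1 + d` and that slot is
selected. -/
def flagSlot (d : ℕ) : Prog :=
  .branch (.and (.leInt (.get 5 (.add (.reg 1) (.const d))) (.reg 0))
      (.and (.leInt (.reg 0) (.get 5 (.add (.reg 1) (.const d))))
        (.ltInt (.const 0) (.get 7 (.add (.reg 1) (.const d))))))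
    (.setInt 2 (.const 1)) .skip

/-- Check all slots of the `c`-th copy for the shift `t`. -/
def flagCopy (N R t c : ℕ) : Prog :=
  .seq (.setInt 1 (slotExpr N R (5 * t + c))) (seqList ((List.range 1681).map flagSlot))

/-- Determine whether the point `reg 0` is selected for the shift `t`. -/
def flagShift (N R t : ℕ) : Prog :=
  .seq (.setInt 2 (.const 0)) <| .seq (seqList ((List.range 4).map (flagCopy N R t))) <|
  .pushInt 8 (.reg 2)

/-- All shifts. -/
def flagBody (N R : ℕ) : Prog := seqList ((List.range N).map (flagShift N R))

/-- Determine which points are selected for which shift. -/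
def flagProg (N R : ℕ) : Prog := forLoop 0 (.reg 10) (flagBody N R)

theorem flagCopy_loopFree (N R t c : ℕ) : (flagCopy N R t c).LoopFree := by
  rw [flagCopy, Prog.loopFree_seq, seqList_loopFree]
  refine ⟨trivial, fun p hp => ?_⟩
  obtain ⟨d, -, rfl⟩ := List.mem_map.1 hp
  simp [flagSlot, Prog.LoopFree]

theorem flagBody_loopFree (N R : ℕ) : (flagBody N R).LoopFree := by
  rw [flagBody, seqList_loopFree]
  intro p hp
  obtain ⟨t, -, rfl⟩ := List.mem_map.1 hp
  rw [flagShift, Prog.loopFree_seq, Prog.loopFree_seq, seqList_loopFree]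
  refine ⟨trivial, fun p hp => ?_, trivial⟩
  obtain ⟨c, -, rfl⟩ := List.mem_map.1 hp
  exact flagCopy_loopFree _ _ _ _

theorem flagCopy_mod {N R t c : ℕ} {l : Loc} (h : (flagCopy N R t c).Mod l) :
    l = .ireg 1 ∨ l = .ireg 2 := by
  simp only [flagCopy, Prog.Mod, seqList_mod, List.mem_map] at h
  rcases h with h | ⟨_, ⟨d, -, rfl⟩, h⟩
  · exact Or.inl h
  · simp only [flagSlot, Prog.Mod, or_false] at h
    exact Or.inr h

theorem flagBody_mod {N R : ℕ} {l : Loc} (h : (flagBody N R).Mod l) :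
    l = .ireg 1 ∨ l = .ireg 2 ∨ l = .iarr 8 := by
  simp only [flagBody, seqList_mod, List.mem_map] at h
  obtain ⟨_, ⟨t, -, rfl⟩, h⟩ := h
  simp only [flagShift, Prog.Mod, seqList_mod, List.mem_map] at h
  rcases h with h | ⟨_, ⟨c, -, rfl⟩, h⟩ | h
  · exact Or.inr (Or.inl h)
  · exact (flagCopy_mod h).imp_right Or.inl
  · exact Or.inr (Or.inr h)

/-- Memory with the candidates and the selections. -/
structure SelMem (S : Inst) (cand : ℕ → ℤ) (sel : ℕ → Finset ℕ) (s : State) : Prop where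
  mask : MaskMem S cand s
  sel : s.intArr 7 = bitTab S sel

theorem SelMem.setReg {S : Inst} {cand : ℕ → ℤ} {sel : ℕ → Finset ℕ} {s : State}
    (h : SelMem S cand sel s) {x : ℕ} (hx : x < 10) (v : ℤ) : SelMem S cand sel (s.setReg x v) :=
  ⟨h.mask.setReg hx v, h.sel⟩

theorem SelMem.setIArr {S : Inst} {cand : ℕ → ℤ} {sel : ℕ → Finset ℕ} {s : State}
    (h : SelMem S cand sel s) {a : ℕ} (ha : 8 ≤ a) (v : List ℤ) :
    SelMem S cand sel (s.setIArr a v) := by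
  have h7 : (7 : ℕ) ≠ a := by omega
  exact ⟨h.mask.setIArr (by omega) v, by simpa [h7] using h.sel⟩

theorem flagSlot_wp {S : Inst} (hS : S.Valid) {cand : ℕ → ℤ} {sel : ℕ → Finset ℕ} {s : State}
    (h : SelMem S cand sel s) {i e d : ℕ} (hi : i < S.tot) (he : e < 5 * S.N) (hd : d < 1681)
    (h0 : s.intReg 0 = i) (h1 : s.intReg 1 = S.slot i e 0) {P : Prop}
    (h2 : s.intReg 2 = pick P 1 0) :
    (flagSlot d).WP (fun s' => SelMem S cand sel s' ∧ s'.intArr 8 = s.intArr 8 ∧ s'.intReg 0 = i ∧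
      s'.intReg 1 = S.slot i e 0 ∧ s'.intReg 2 = pick (P ∨ (cand (S.slot i e d) = i ∧
        S.loc i e d ∈ sel (S.id i e))) 1 0) s := by
  have hslt := hS.slot_lt hi he hd
  have hz : s.intReg 1 + (d : ℤ) = (S.slot i e d : ℕ) := by rw [h1, slot_add S i e d]; push_cast; rfl
  have hloc := hS.loc_lt i e hd
  have hdiv : S.slot i e d / S.slots = S.id i e := by
    rw [Inst.slot, add_comm, Nat.add_mul_div_right _ _ (by omega), Nat.div_eq_of_lt hloc, zero_add]
  have hmod : S.slot i e d % S.slots = S.loc i e d := by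
    rw [Inst.slot, add_comm, Nat.add_mul_mod_self_right, Nat.mod_eq_of_lt hloc]
  have hH : (BExpr.and (.leInt (.get 5 (.add (.reg 1) (.const d))) (.reg 0))
      (.and (.leInt (.reg 0) (.get 5 (.add (.reg 1) (.const d))))
        (.ltInt (.const 0) (.get 7 (.add (.reg 1) (.const d)))))).Holds s ↔
      (cand (S.slot i e d) = i ∧ S.loc i e d ∈ sel (S.id i e)) := by
    simp only [BExpr.Holds, IExpr.eval, hz, h.mask.cand, h.sel, bitTab, readAt_tab rfl hslt, h0,
      hdiv, hmod]
    -- The machine has no test for equality, so the program uses two inequalities.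
    rw [← and_assoc, ← le_antisymm_iff]
    refine and_congr_right fun _ => ?_
    split_ifs with hm <;> simp [hm]
  rw [flagSlot, wp_branch, hH]
  refine ⟨fun hh => ?_, fun hh => ?_⟩
  · rw [wp_setInt]
    exact ⟨h.setReg (by norm_num) _, by simp, by simpa using h0, by simpa using h1,
      by rw [pick_pos (Or.inr hh)]; simp [IExpr.eval]⟩
  · rw [wp_skip]
    exact ⟨h, rfl, h0, h1, by simp only [hh, or_false, h2]⟩

theorem flagCopy_wp {S : Inst} (hS : S.Valid) {cand : ℕ → ℤ} {sel : ℕ → Finset ℕ} {s : State}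
    (h : SelMem S cand sel s) {i t c : ℕ} (hi : i < S.tot) (he : 5 * t + c < 5 * S.N)
    (h0 : s.intReg 0 = i) {P : Prop} (h2 : s.intReg 2 = pick P 1 0) :
    (flagCopy S.N S.R t c).WP (fun s' => SelMem S cand sel s' ∧ s'.intArr 8 = s.intArr 8 ∧
      s'.intReg 0 = i ∧ s'.intReg 2 = pick (P ∨ ∃ d < 1681, cand (S.slot i (5 * t + c) d) = i ∧
        S.loc i (5 * t + c) d ∈ sel (S.id i (5 * t + c))) 1 0) s := by
  rw [flagCopy, wp_seq, wp_setInt, h.mask.ready.slotExpr_eval hS h0 hi he]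
  have hd := wp_seqList_range flagSlot (fun D s' => SelMem S cand sel s' ∧
    s'.intArr 8 = s.intArr 8 ∧ s'.intReg 0 = i ∧ s'.intReg 1 = S.slot i (5 * t + c) 0 ∧
    s'.intReg 2 = pick (P ∨ ∃ d < D, cand (S.slot i (5 * t + c) d) = i ∧
        S.loc i (5 * t + c) d ∈ sel (S.id i (5 * t + c))) 1 0) (n := 1681)
    (s := s.setReg 1 (S.slot i (5 * t + c) 0)) ?_ ?_
  · exact Prog.WP.mono hd fun s' hs' => ⟨hs'.1, hs'.2.1, hs'.2.2.1, hs'.2.2.2.2⟩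
  · refine ⟨h.setReg (by norm_num) _, by simp, by simpa using h0, by simp, ?_⟩
    simpa using h2
  · rintro d hd s' ⟨hM, h8, h0, h1, h2⟩
    refine (flagSlot_wp hS hM hi he hd h0 h1 h2).mono ?_
    rintro s'' ⟨hM, h8', h0, h1, h2⟩
    refine ⟨hM, h8'.trans h8, h0, h1, h2.trans ?_⟩
    congr 1
    rw [or_assoc]
    simp only [Nat.lt_succ_iff_lt_or_eq, or_and_right, exists_or, exists_eq_left]

theorem flagShift_wp {S : Inst} (hS : S.Valid) {cand : ℕ → ℤ} {sel : ℕ → Finset ℕ} {s : State}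
    (h : SelMem S cand sel s) {i t : ℕ} (hi : i < S.tot) (ht : t < S.N) (h0 : s.intReg 0 = i) :
    (flagShift S.N S.R t).WP (fun s' => SelMem S cand sel s' ∧ s'.intReg 0 = i ∧
      s'.intArr 8 = s.intArr 8 ++ [pick (S.Flag cand sel i t) 1 0]) s := by
  rw [flagShift, wp_seq, wp_setInt, wp_seq]
  have hd := wp_seqList_range (flagCopy S.N S.R t) (fun C s' => SelMem S cand sel s' ∧
    s'.intArr 8 = s.intArr 8 ∧ s'.intReg 0 = i ∧
    s'.intReg 2 = pick (∃ c < C, ∃ d < 1681, cand (S.slot i (5 * t + c) d) = i ∧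
        S.loc i (5 * t + c) d ∈ sel (S.id i (5 * t + c))) 1 0) (n := 4)
    (s := s.setReg 2 (IExpr.eval s (.const 0))) ?_ ?_
  · refine Prog.WP.mono hd ?_
    rintro s' ⟨hM, h8, h0, h2⟩
    rw [wp_pushInt]
    refine ⟨hM.setIArr (by norm_num) _, by simpa using h0, ?_⟩
    simp only [State.setIArr_intArr, Function.update_self, IExpr.eval, h8, h2]
    rfl
  · refine ⟨h.setReg (by norm_num) _, by simp, by simpa using h0, ?_⟩
    rw [pick_neg (by simp)]; simp [IExpr.eval]
  · rintro c hc s' ⟨hM, h8, h0, h2⟩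
    refine (flagCopy_wp hS hM hi (by omega) h0 h2).mono ?_
    rintro s'' ⟨hM, h8', h0, h2⟩
    refine ⟨hM, h8'.trans h8, h0, h2.trans ?_⟩
    congr 1
    exact propext Nat.exists_lt_succ_right.symm

/-- The table of the selected points. -/
noncomputable def flagTab (S : Inst) (cand : ℕ → ℤ) (sel : ℕ → Finset ℕ) (k : ℕ) : List ℤ :=
  tab k fun z => pick (S.Flag cand sel (z / S.N) (z % S.N)) 1 0

theorem flagBody_wp {S : Inst} (hS : S.Valid) {cand : ℕ → ℤ} {sel : ℕ → Finset ℕ} {s : State}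
    (h : SelMem S cand sel s) {i : ℕ} (hi : i < S.tot) (h0 : s.intReg 0 = i)
    (h8 : s.intArr 8 = flagTab S cand sel (i * S.N)) :
    (flagBody S.N S.R).WP (fun s' => SelMem S cand sel s' ∧
      s'.intArr 8 = flagTab S cand sel ((i + 1) * S.N)) s := by
  refine Prog.WP.mono (wp_seqList_range (flagShift S.N S.R) (fun t s' => SelMem S cand sel s' ∧
    s'.intReg 0 = i ∧ s'.intArr 8 = flagTab S cand sel (i * S.N + t)) ⟨h, h0, h8⟩ ?_) ?_
  · rintro t ht s' ⟨hM, h0, h8⟩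
    refine (flagShift_wp hS hM hi ht h0).mono ?_
    rintro s'' ⟨hM, h0, h8'⟩
    refine ⟨hM, h0, ?_⟩
    rw [h8', h8, flagTab, flagTab, ← add_assoc, tab_succ]
    have e1 : (i * S.N + t) / S.N = i := by
      rw [add_comm, Nat.add_mul_div_right _ _ (by omega), Nat.div_eq_of_lt ht, zero_add]
    have e2 : (i * S.N + t) % S.N = t := by
      rw [add_comm, Nat.add_mul_mod_self_right, Nat.mod_eq_of_lt ht]
    rw [e1, e2]
  · rintro s' ⟨hM, -, h8⟩
    exact ⟨hM, by rw [h8, add_mul, one_mul]⟩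

theorem flagProg_runs {S : Inst} (hS : S.Valid) {cand : ℕ → ℤ} {sel : ℕ → Finset ℕ} {s : State}
    (h : SelMem S cand sel s) (h8 : s.intArr 8 = []) :
    Runs (flagProg S.N S.R) s (((flagBody S.N S.R).costBound + 9) * (S.tot + 1)) (fun s' =>
      Ready S s' ∧ s'.intArr 8 = flagTab S cand sel (S.n * S.N)) := by
  refine Runs.mono (Runs.forLoop S.n (flagBody S.N S.R).costBound
    (fun i s' => SelMem S cand sel s' ∧ s'.intArr 8 = flagTab S cand sel (i * S.N)) ?_ ?_ ?_ ?_) ?_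
    (fun s' _ h => ⟨h.1.mask.ready, h.2⟩)
  · exact ⟨h.setReg (by norm_num) _, by simpa [flagTab] using h8⟩
  · intro h; have := flagBody_mod h; simp at this
  · rintro i - s' - ⟨hR, -⟩
    exact hR.mask.ready.n
  · rintro i hi s' - h0 ⟨hM, h8⟩
    refine Prog.LoopFree.runs_of_wp (flagBody_loopFree _ _) ?_
    refine (flagBody_wp hS hM (by unfold Inst.tot; omega) h0 h8).mono ?_
    rintro s'' ⟨hM, h8⟩
    exact ⟨hM.setReg (by norm_num) _, h8⟩
  · have e2 : S.n + 1 ≤ S.tot + 1 := by unfold Inst.tot; omega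
    rw [mul_comm]
    exact Nat.mul_le_mul_left _ e2

/-! #### The best shift -/

/-- Entry of the table of the selected points, for the point `reg 0`. -/
def flagExpr (N : ℕ) (t : IExpr) : IExpr := .get 8 (.add (.mul (.reg 0) (.const N)) t)

/-- Count the points selected for the shift `t` and compare with the best shift so far, which is in
`reg 3`, with the number of points in `reg 4`. -/
def bestShift (N t : ℕ) : Prog :=
  .seq (.setInt 5 (.const 0)) <|
  .seq (forLoop 0 (.reg 10) (.setInt 5 (.add (.reg 5) (flagExpr N (.const t))))) <|
  .branch (.ltInt (.reg 5) (.reg 4)) (.seq (.setInt 4 (.reg 5)) (.setInt 3 (.const t))) .skip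

/-- Determine the best shift. -/
def bestProg (N : ℕ) : Prog :=
  .seq (.setInt 4 (.add (.reg 10) (.const 1))) (seqList ((List.range N).map (bestShift N)))

/-- Output the points that are selected for the shift `reg 3`. -/
def outputProg (N : ℕ) : Prog :=
  forLoop 0 (.reg 10) <| .branch (.ltInt (.const 0) (flagExpr N (.reg 3)))
    (.seq (.pushReal 4 (.get 0 (.reg 0))) (.pushReal 5 (.get 1 (.reg 0)))) .skip

/-- Memory with the selected points. -/
structure FlagMem (S : Inst) (cand : ℕ → ℤ) (sel : ℕ → Finset ℕ) (s : State) : Prop where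
  ready : Ready S s
  flag : s.intArr 8 = flagTab S cand sel (S.n * S.N)

theorem FlagMem.setReg {S : Inst} {cand : ℕ → ℤ} {sel : ℕ → Finset ℕ} {s : State}
    (h : FlagMem S cand sel s) {x : ℕ} (hx : x < 10) (v : ℤ) : FlagMem S cand sel (s.setReg x v) :=
  ⟨h.ready.setReg hx v, h.flag⟩

theorem FlagMem.setRArr {S : Inst} {cand : ℕ → ℤ} {sel : ℕ → Finset ℕ} {s : State}
    (h : FlagMem S cand sel s) {a : ℕ} (ha : 2 ≤ a) (v : List ℝ) :
    FlagMem S cand sel (s.setRArr a v) :=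
  ⟨h.ready.setRArr ha v, h.flag⟩

theorem FlagMem.flagExpr_eval {S : Inst} {cand : ℕ → ℤ} {sel : ℕ → Finset ℕ} {s : State}
    (h : FlagMem S cand sel s) {te : IExpr} {i t : ℕ} (h0 : s.intReg 0 = i) (hi : i < S.n)
    (hte : te.eval s = t) (ht : t < S.N) :
    (flagExpr S.N te).eval s = pick (S.Flag cand sel i t) 1 0 := by
  simp only [flagExpr, IExpr.eval, h0, hte, h.flag, flagTab]
  exact readAt_tab_pair (f := fun i t => pick (S.Flag cand sel i t) 1 0) rfl hi ht

open Classical in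
/-- The indices below `i` of the points selected for the shift `t`. -/
noncomputable def flagList (S : Inst) (cand : ℕ → ℤ) (sel : ℕ → Finset ℕ) (t i : ℕ) : List ℕ :=
  (List.range i).filter fun i => S.Flag cand sel i t

theorem flagList_succ (S : Inst) (cand : ℕ → ℤ) (sel : ℕ → Finset ℕ) (t i : ℕ) :
    flagList S cand sel t (i + 1) =
      flagList S cand sel t i ++ pick (S.Flag cand sel i t) [i] [] := by
  by_cases h : S.Flag cand sel i t
  · rw [pick_pos h]
    simp [flagList, List.range_succ, List.filter_append, h]
  · rw [pick_neg h]
    simp [flagList, List.range_succ, List.filter_append, h]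

theorem length_flagList (S : Inst) (cand : ℕ → ℤ) (sel : ℕ → Finset ℕ) (t : ℕ) :
    (flagList S cand sel t S.n).length = (S.flagged cand sel t).card := by
  classical
  have h : (flagList S cand sel t S.n).toFinset = S.flagged cand sel t := by
    ext i; simp [flagList, Inst.flagged]
  have hn : (flagList S cand sel t S.n).Nodup := List.nodup_range.filter _
  rw [← h, List.toFinset_card_of_nodup hn]

theorem bestShift_mod {N t : ℕ} {l : Loc} (h : (bestShift N t).Mod l) :
    l = .ireg 0 ∨ l = .ireg 3 ∨ l = .ireg 4 ∨ l = .ireg 5 := by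
  simp only [bestShift, Prog.Mod, forLoop_mod] at h
  tauto

theorem bestProg_mod {N : ℕ} {l : Loc} (h : (bestProg N).Mod l) :
    l = .ireg 0 ∨ l = .ireg 3 ∨ l = .ireg 4 ∨ l = .ireg 5 := by
  simp only [bestProg, Prog.Mod, seqList_mod, List.mem_map] at h
  rcases h with h | ⟨_, ⟨t, -, rfl⟩, h⟩
  · tauto
  · exact bestShift_mod h

theorem bestShift_runs {S : Inst} {cand : ℕ → ℤ} {sel : ℕ → Finset ℕ} {s : State}
    (h : FlagMem S cand sel s) {t : ℕ} (ht : t < S.N) {z b : ℤ} (h3 : s.intReg 3 = z)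
    (h4 : s.intReg 4 = b) :
    Runs (bestShift S.N t) s ((S.n + 1) * 18 + 20) (fun s' => FlagMem S cand sel s' ∧
      (((S.flagged cand sel t).card < b ∧ s'.intReg 3 = t ∧
        s'.intReg 4 = (S.flagged cand sel t).card) ∨
      (b ≤ (S.flagged cand sel t).card ∧ s'.intReg 3 = z ∧ s'.intReg 4 = b))) := by
  have r1 : Runs (.setInt 5 (.const 0)) s 2 (fun s' => FlagMem S cand sel s' ∧ s'.intReg 3 = z ∧
      s'.intReg 4 = b ∧ s'.intReg 5 = 0) := by
    refine Prog.LoopFree.runs_of_wp (p := .setInt 5 (.const 0)) trivial ?_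
    rw [wp_setInt]
    exact ⟨h.setReg (by norm_num) _, by simpa using h3, by simpa using h4, by simp [IExpr.eval]⟩
  have r2 : ∀ s₁, FlagMem S cand sel s₁ → s₁.intReg 3 = z → s₁.intReg 4 = b → s₁.intReg 5 = 0 →
      Runs (forLoop 0 (.reg 10) (.setInt 5 (.add (.reg 5) (flagExpr S.N (.const t))))) s₁
        ((S.n + 1) * (9 + 1 + 8)) (fun s' => FlagMem S cand sel s' ∧ s'.intReg 3 = z ∧
          s'.intReg 4 = b ∧ s'.intReg 5 = (flagList S cand sel t S.n).length) := by
    intro s₁ h h3 h4 h5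
    refine Runs.forLoop S.n 9 (fun i s' => FlagMem S cand sel s' ∧ s'.intReg 3 = z ∧
          s'.intReg 4 = b ∧ s'.intReg 5 = (flagList S cand sel t i).length) ?_ ?_ ?_ ?_
    · exact ⟨h.setReg (by norm_num) _, by simpa using h3, by simpa using h4,
        by simpa [flagList] using h5⟩
    · simp [Prog.Mod]
    · rintro i - s' - ⟨hR, -⟩
      exact hR.ready.n
    · rintro i hi s' - h0 ⟨hR, h3, h4, h5⟩
      refine Prog.LoopFree.runs_of_wp
        (p := .setInt 5 (.add (.reg 5) (flagExpr S.N (.const t)))) trivial ?_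
      rw [wp_setInt]
      refine ⟨(hR.setReg (by norm_num) _).setReg (by norm_num) _, by simpa using h3,
        by simpa using h4, ?_⟩
      have he := hR.flagExpr_eval (te := .const t) h0 hi rfl ht
      rw [flagList_succ]
      by_cases hf : S.Flag cand sel i t
      · rw [pick_pos hf] at he ⊢
        simp [IExpr.eval, he, h5]
      · rw [pick_neg hf] at he ⊢
        simp [IExpr.eval, he, h5]
  have r3 : ∀ s₁, FlagMem S cand sel s₁ → s₁.intReg 3 = z → s₁.intReg 4 = b →
      s₁.intReg 5 = (flagList S cand sel t S.n).length →
      Runs (.branch (.ltInt (.reg 5) (.reg 4))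
        (.seq (.setInt 4 (.reg 5)) (.setInt 3 (.const t))) .skip) s₁ 18
        (fun s' => FlagMem S cand sel s' ∧
      (((S.flagged cand sel t).card < b ∧ s'.intReg 3 = t ∧
        s'.intReg 4 = (S.flagged cand sel t).card) ∨
      (b ≤ (S.flagged cand sel t).card ∧ s'.intReg 3 = z ∧ s'.intReg 4 = b))) := by
    intro s₁ h h3 h4 h5
    rw [length_flagList] at h5
    refine Runs.mono (Prog.LoopFree.runs_of_wp (p := .branch (.ltInt (.reg 5) (.reg 4))
        (.seq (.setInt 4 (.reg 5)) (.setInt 3 (.const t))) .skip) ⟨⟨trivial, trivial⟩, trivial⟩ ?_)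
        ?_ (fun _ _ h => h)
    · rw [wp_branch]
      simp only [BExpr.Holds, IExpr.eval, h4, h5]
      refine ⟨fun hh => ?_, fun hh => ?_⟩
      · rw [wp_seq, wp_setInt, wp_setInt]
        refine ⟨(h.setReg (by norm_num) _).setReg (by norm_num) _, Or.inl ⟨hh, ?_, ?_⟩⟩
        · simp [IExpr.eval]
        · simp [IExpr.eval, h5]
      · rw [wp_skip]
        exact ⟨h, Or.inr ⟨not_lt.1 hh, h3, h4⟩⟩
    · simp [Prog.costBound, BExpr.cost, IExpr.cost]
  refine Runs.mono (Runs.seq (r1.mono le_rfl fun s₁ _ hs₁ => Runs.seq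
    ((r2 s₁ hs₁.1 hs₁.2.1 hs₁.2.2.1 hs₁.2.2.2).mono le_rfl fun s₂ _ hs₂ =>
      r3 s₂ hs₂.1 hs₂.2.1 hs₂.2.2.1 hs₂.2.2.2))) ?_ (fun _ _ h => h)
  omega

/-- The initial record `S.n + 1` exceeds every possible count, so the first shift is always accepted
and `reg 3` holds a genuine shift afterwards. -/
theorem bestProg_runs {S : Inst} (hN : 0 < S.N) {cand : ℕ → ℤ} {sel : ℕ → Finset ℕ} {s : State}
    (h : FlagMem S cand sel s) :
    Runs (bestProg S.N) s ((S.N * 38 + 5) * (S.tot + 1)) (fun s' => FlagMem S cand sel s' ∧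
      ∃ t < S.N, s'.intReg 3 = t ∧
        ∀ t' < S.N, (S.flagged cand sel t).card ≤ (S.flagged cand sel t').card) := by
  have hcard : ∀ t, (S.flagged cand sel t).card ≤ S.n := fun t => by
    classical
    exact (Finset.card_filter_le _ _).trans (Finset.card_range _).le
  have r1 : Runs (.setInt 4 (.add (.reg 10) (.const 1))) s 4 (fun s' => FlagMem S cand sel s' ∧
      s'.intReg 4 = S.n + 1) := by
    refine Prog.LoopFree.runs_of_wp (p := .setInt 4 (.add (.reg 10) (.const 1))) trivial ?_
    rw [wp_setInt]
    exact ⟨h.setReg (by norm_num) _, by simp [IExpr.eval, h.ready.n]⟩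
  have r2 : ∀ s₁, FlagMem S cand sel s₁ → s₁.intReg 4 = S.n + 1 →
      Runs (seqList ((List.range S.N).map (bestShift S.N))) s₁ (S.N * ((S.n + 1) * 18 + 20) + 1)
        (fun s' => FlagMem S cand sel s' ∧ ∃ b : ℕ, s'.intReg 4 = b ∧ (S.N = 0 → b = S.n + 1) ∧
          (∀ t' < S.N, b ≤ (S.flagged cand sel t').card) ∧
          (0 < S.N → ∃ t < S.N, s'.intReg 3 = t ∧ b = (S.flagged cand sel t).card)) := by
    intro s₁ h h4
    refine Runs.seqList_range (bestShift S.N) (fun T s' => FlagMem S cand sel s' ∧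
      ∃ b : ℕ, s'.intReg 4 = b ∧ (T = 0 → b = S.n + 1) ∧
          (∀ t' < T, b ≤ (S.flagged cand sel t').card) ∧
          (0 < T → ∃ t < T, s'.intReg 3 = t ∧ b = (S.flagged cand sel t).card)) ?_ ?_
    · exact ⟨h, S.n + 1, by simpa using h4, by simp, by simp, by simp⟩
    · rintro t ht s' - ⟨hR, b, h4, hb0, hb1, hb2⟩
      refine (bestShift_runs hR ht rfl h4).mono le_rfl ?_
      rintro s'' - ⟨hR, ⟨hlt, h3, h4⟩ | ⟨hle, h3, h4⟩⟩
      · refine ⟨hR, _, h4, by simp, fun t' ht' => ?_, fun _ => ⟨t, by omega, h3, rfl⟩⟩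
        rcases Nat.lt_succ_iff_lt_or_eq.1 ht' with h | rfl
        · have := hb1 t' h
          have : (S.flagged cand sel t).card < b := by exact_mod_cast hlt
          omega
        · exact le_rfl
      · have hle' : b ≤ (S.flagged cand sel t).card := by exact_mod_cast hle
        have ht0 : 0 < t := by
          rcases Nat.eq_zero_or_pos t with h | h
          · have := hb0 h
            have := hcard t
            omega
          · exact h
        refine ⟨hR, _, h4, by simp, fun t' ht' => ?_, fun _ => ?_⟩
        · rcases Nat.lt_succ_iff_lt_or_eq.1 ht' with h | rfl
          · exact hb1 t' h
          · exact hle'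
        · obtain ⟨t₀, h1, h2, h5⟩ := hb2 ht0
          exact ⟨t₀, by omega, h3.trans h2, h5⟩
  refine Runs.mono (Runs.seq (r1.mono le_rfl fun s₁ _ hs₁ => r2 s₁ hs₁.1 hs₁.2)) ?_ ?_
  · have e : (S.n + 1) * 18 + 20 ≤ 38 * (S.tot + 1) := by unfold Inst.tot; omega
    have := Nat.mul_le_mul_left S.N e
    calc _ ≤ 4 + (S.N * (38 * (S.tot + 1)) + 1) := by omega
      _ ≤ _ := by ring_nf; omega
  · rintro s' - ⟨hR, b, -, -, h1, h2⟩
    obtain ⟨t, ht, h3, rfl⟩ := h2 hN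
    exact ⟨hR, t, ht, h3, h1⟩

theorem outputProg_runs {S : Inst} {cand : ℕ → ℤ} {sel : ℕ → Finset ℕ} {s : State}
    (h : FlagMem S cand sel s) {t : ℕ} (ht : t < S.N) (h3 : s.intReg 3 = t)
    (h4 : s.realArr 4 = []) (h5 : s.realArr 5 = []) :
    Runs (outputProg S.N) s (30 * (S.tot + 1)) (fun s' =>
      s'.realArr 4 = (flagList S cand sel t S.n).map S.px ∧
      s'.realArr 5 = (flagList S cand sel t S.n).map S.py) := by
  refine Runs.mono (Runs.forLoop S.n 21 (fun i s' => FlagMem S cand sel s' ∧ s'.intReg 3 = t ∧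
    s'.realArr 4 = (flagList S cand sel t i).map S.px ∧
    s'.realArr 5 = (flagList S cand sel t i).map S.py) ?_ ?_ ?_ ?_) ?_ (fun _ _ h => h.2.2)
  · exact ⟨h.setReg (by norm_num) _, by simpa using h3, by simpa [flagList] using h4,
      by simpa [flagList] using h5⟩
  · simp [Prog.Mod]
  · rintro i - s' - ⟨hR, -⟩
    exact hR.ready.n
  · rintro i hi s' - h0 ⟨hR, h3, h4, h5⟩
    refine Runs.mono (Prog.LoopFree.runs_of_wp (p := .branch (.ltInt (.const 0) (flagExpr S.N (.reg 3)))
      (.seq (.pushReal 4 (.get 0 (.reg 0))) (.pushReal 5 (.get 1 (.reg 0)))) .skip)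
      ⟨⟨trivial, trivial⟩, trivial⟩ ?_) ?_ (fun _ _ h => h)
    · have hit : i < S.tot := by unfold Inst.tot; omega
      rw [wp_branch]
      simp only [BExpr.Holds, hR.flagExpr_eval (te := .reg 3) h0 hi h3 ht, IExpr.eval]
      refine ⟨fun hh => ?_, fun hh => ?_⟩
      · have hf : S.Flag cand sel i t := by
          by_contra hf; rw [pick_neg hf] at hh; norm_num at hh
        rw [wp_seq, wp_pushReal, wp_pushReal]
        refine ⟨((hR.setRArr (by norm_num) _).setRArr (by norm_num) _).setReg (by norm_num) _,
          by simpa using h3, ?_, ?_⟩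
        · rw [flagList_succ, pick_pos hf]
          simp [h4, RExpr.eval, IExpr.eval, h0, hR.ready.xs, readAt_tab rfl hit]
        · rw [flagList_succ, pick_pos hf]
          simp [h5, RExpr.eval, IExpr.eval, h0, hR.ready.ys, readAt_tab rfl hit]
      · have hf : ¬ S.Flag cand sel i t := by
          intro hf; rw [pick_pos hf] at hh; norm_num at hh
        rw [wp_skip]
        refine ⟨hR.setReg (by norm_num) _, by simpa using h3, ?_, ?_⟩
        · rw [flagList_succ, pick_neg hf]; simpa using h4
        · rw [flagList_succ, pick_neg hf]; simpa using h5
    · simp [Prog.costBound, BExpr.cost, RExpr.cost, IExpr.cost, flagExpr]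
  · simp only [IExpr.cost]; unfold Inst.tot; omega

/-! #### The main program -/

/-- Everything after the computation of the grid cells. -/
noncomputable def mainProg (N R : ℕ) : Prog :=
  .seq (collectProg N R) <| .seq (selectProg N (slotsOf N R)) <| .seq (flagProg N R) <|
  .seq (bestProg N) (outputProg N)

/-- Running time of the main program, per point. -/
noncomputable def mainCost (N R : ℕ) : ℕ :=
  collectCost N R + (selectCost N R + (((flagBody N R).costBound + 9) + ((N * 38 + 5) + 30)))

theorem mainProg_basic (N R : ℕ) : (mainProg N R).Basic := by
  refine ⟨⟨?_, ?_⟩, ⟨?_, ?_⟩, ?_, ⟨trivial, ?_⟩, ?_⟩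
  · rw [forLoop_basic]; exact ⟨trivial, trivial⟩
  · rw [forLoop_basic, insertBody, seqList_basic]
    intro p hp
    obtain ⟨e, -, rfl⟩ := List.mem_map.1 hp
    unfold insertCopy
    split_ifs
    · refine ⟨trivial, ?_⟩
      rw [seqList_basic]
      intro p hp
      obtain ⟨d, -, rfl⟩ := List.mem_map.1 hp
      exact ⟨trivial, trivial⟩
    · trivial
  · rw [forLoop_basic]; trivial
  · rw [seqList_basic]
    intro p hp
    obtain ⟨m, -, rfl⟩ := List.mem_map.1 hp
    refine ⟨?_, ?_, ?_⟩
    · rw [forLoop_basic]; trivial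
    · rw [forLoop_basic, checkBody, seqList_basic]
      intro p hp
      obtain ⟨t, -, rfl⟩ := List.mem_map.1 hp
      refine ⟨trivial, trivial, ?_, trivial, trivial⟩
      rw [seqList_basic]
      intro p hp
      obtain ⟨j, -, rfl⟩ := List.mem_map.1 hp
      exact ⟨trivial, trivial⟩
    · rw [forLoop_basic]
      refine ⟨?_, trivial⟩
      rw [copyMask, seqList_basic]
      intro p hp
      obtain ⟨j, -, rfl⟩ := List.mem_map.1 hp
      trivial
  · rw [flagProg, forLoop_basic, flagBody, seqList_basic]
    intro p hp
    obtain ⟨t, -, rfl⟩ := List.mem_map.1 hp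
    refine ⟨trivial, ?_, trivial⟩
    rw [seqList_basic]
    intro p hp
    obtain ⟨c, -, rfl⟩ := List.mem_map.1 hp
    refine ⟨trivial, ?_⟩
    rw [seqList_basic]
    intro p hp
    obtain ⟨d, -, rfl⟩ := List.mem_map.1 hp
    exact ⟨trivial, trivial⟩
  · rw [seqList_basic]
    intro p hp
    obtain ⟨t, -, rfl⟩ := List.mem_map.1 hp
    refine ⟨trivial, ?_, ⟨trivial, trivial⟩, trivial⟩
    rw [forLoop_basic]; trivial
  · rw [outputProg, forLoop_basic]; exact ⟨⟨trivial, trivial⟩, trivial⟩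

theorem mainProg_runs {S : Inst} (hS : S.Valid) {s : State} (h : Ready S s)
    (hi : ∀ a, 5 ≤ a → a ≤ 8 → s.intArr a = []) (h4 : s.realArr 4 = []) (h5 : s.realArr 5 = []) :
    Runs (mainProg S.N S.R) s (mainCost S.N S.R * (S.tot + 1)) (fun s' => ∃ l : List ℕ, l.Nodup ∧
      s'.realArr 4 = l.map S.px ∧ s'.realArr 5 = l.map S.py ∧ S.Dominates l.toFinset ∧
      ∀ D, S.Dominates D → S.N * l.length ≤ 4 * (D.card * (S.N + 12 * S.R))) := by
  have e : mainCost S.N S.R * (S.tot + 1) = collectCost S.N S.R * (S.tot + 1) +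
      (selectCost S.N S.R * (S.tot + 1) + (((flagBody S.N S.R).costBound + 9) * (S.tot + 1) +
        ((S.N * 38 + 5) * (S.tot + 1) + 30 * (S.tot + 1)))) := by
    unfold mainCost; ring
  rw [e]
  refine Runs.seq ((collectProg_runs hS h (hi 5 (by norm_num) (by norm_num))
    (hi 7 (by norm_num) (by norm_num))).mono le_rfl ?_)
  rintro s₁ a₁ ⟨hR, h7, cand, hcand, hc⟩
  refine Runs.seq ((selectProg_runs hS hc ⟨hR, hcand⟩ ?_ h7).mono le_rfl ?_)
  · rw [a₁.iarr 6, hi 6 (by norm_num) (by norm_num)]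
    intro h; have := collectProg_mod h; simp at this
  rintro s₂ a₂ ⟨hR, sel, h7, hsel⟩
  refine Runs.seq ((flagProg_runs hS ⟨hR, h7⟩ ?_).mono le_rfl ?_)
  · rw [a₂.iarr 8, a₁.iarr 8, hi 8 (by norm_num) (by norm_num)]
    · intro h; have := collectProg_mod h; simp at this
    · intro h; have := selectProg_mod h; simp at this
  rintro s₃ a₃ ⟨hR, h8⟩
  refine Runs.seq ((bestProg_runs hS.N_pos ⟨hR, h8⟩).mono le_rfl ?_)
  rintro s₄ a₄ ⟨hR, t, ht, h3, hmin⟩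
  -- No stage before the output writes a real array.
  have hout : ∀ a, s₄.realArr a = s.realArr a := by
    intro a
    rw [a₄.rarr a, a₃.rarr a, a₂.rarr a, a₁.rarr a]
    · intro h; have := collectProg_mod h; simp at this
    · intro h; have := selectProg_mod h; simp at this
    · intro h
      rcases forLoop_mod.1 h with h | h
      · simp at h
      · have := flagBody_mod h; simp at this
    · intro h; have := bestProg_mod h; simp at this
  refine (outputProg_runs hR ht h3 ((hout 4).trans h4) ((hout 5).trans h5)).mono le_rfl ?_
  rintro s₅ - ⟨h4, h5⟩
  refine ⟨flagList S cand sel t S.n, List.nodup_range.filter _, h4, h5, ⟨?_, ?_⟩, ?_⟩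
  · intro i hi
    simp only [flagList, List.mem_toFinset, List.mem_filter, List.mem_range] at hi
    exact Finset.mem_range.2 hi.1
  · intro q hq
    obtain ⟨i, hi, hf, hd⟩ := Inst.flag_dominates hS hc hsel ht hq
    exact ⟨i, by simp [flagList, hi, hf], hd⟩
  · intro D hD
    rw [length_flagList]
    exact Inst.card_best_le hS hc hsel hD hmin

/-! ### Preprocessing -/

/-- Append the points of `P'` to those of `P`. -/
def joinProg : Prog :=
  .seq (.setInt 10 (.lenReal 0)) <|
  .seq (forLoop 0 (.lenReal 2) (.seq (.pushReal 0 (.get 2 (.reg 0))) (.pushReal 1 (.get 3 (.reg 0)))))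
    (.setInt 11 (.lenReal 0))

/-- The memory holds the points. -/
structure PointMem (S : Inst) (s : State) : Prop where
  xs : s.realArr 0 = tab S.tot S.px
  ys : s.realArr 1 = tab S.tot S.py
  n : s.intReg 10 = S.n
  tot : s.intReg 11 = S.tot

theorem PointMem.of_agree {S : Inst} {s s' : State} {M : Loc → Prop} (h : PointMem S s)
    (hA : Agree M s s') (h0 : ¬ M (.rarr 0)) (h1 : ¬ M (.rarr 1)) (h2 : ¬ M (.ireg 10))
    (h3 : ¬ M (.ireg 11)) : PointMem S s' :=
  ⟨(hA.rarr _ h0).trans h.xs, (hA.rarr _ h1).trans h.ys, (hA.ireg _ h2).trans h.n,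
    (hA.ireg _ h3).trans h.tot⟩

theorem joinProg_mod {l : Loc} (h : joinProg.Mod l) :
    l = .ireg 0 ∨ l = .ireg 10 ∨ l = .ireg 11 ∨ l = .rarr 0 ∨ l = .rarr 1 := by
  simp only [joinProg, Prog.Mod, forLoop_mod] at h
  tauto

theorem joinProg_runs (S : Inst) {s : State} (h0 : s.realArr 0 = tab S.n S.px)
    (h1 : s.realArr 1 = tab S.n S.py) (h2 : s.realArr 2 = tab S.n' fun q => S.px (S.n + q))
    (h3 : s.realArr 3 = tab S.n' fun q => S.py (S.n + q)) :
    Runs joinProg s (30 * (S.tot + 1)) (PointMem S) := by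
  have r1 : Runs (.setInt 10 (.lenReal 0)) s 2 (fun s' => s'.intReg 10 = S.n ∧
      s'.realArr = s.realArr) := by
    refine Prog.LoopFree.runs_of_wp (p := .setInt 10 (.lenReal 0)) trivial ?_
    rw [wp_setInt]
    exact ⟨by simp [IExpr.eval, h0], rfl⟩
  have r2 : ∀ s₁ : State, s₁.intReg 10 = S.n → s₁.realArr = s.realArr →
      Runs (forLoop 0 (.lenReal 2) (.seq (.pushReal 0 (.get 2 (.reg 0)))
        (.pushReal 1 (.get 3 (.reg 0))))) s₁ ((S.n' + 1) * (6 + 1 + 8)) (fun s' =>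
        s'.intReg 10 = S.n ∧ s'.realArr 0 = tab S.tot S.px ∧ s'.realArr 1 = tab S.tot S.py) := by
    intro s₁ h10 hr
    refine Runs.mono (Runs.forLoop S.n' 6 (fun i s' => s'.intReg 10 = S.n ∧
      s'.realArr 0 = tab (S.n + i) S.px ∧ s'.realArr 1 = tab (S.n + i) S.py ∧
      s'.realArr 2 = s.realArr 2 ∧ s'.realArr 3 = s.realArr 3) ?_ ?_ ?_ ?_) le_rfl ?_
    · exact ⟨by simpa using h10, by simp [hr, h0], by simp [hr, h1], by simp [hr], by simp [hr]⟩
    · simp [Prog.Mod]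
    · rintro i - s' - ⟨-, -, -, h, -⟩
      simp [IExpr.eval, h, h2]
    · rintro i hi s' - hi0 ⟨h10, h0', h1', h2', h3'⟩
      refine Prog.LoopFree.runs_of_wp (p := .seq (.pushReal 0 (.get 2 (.reg 0)))
        (.pushReal 1 (.get 3 (.reg 0)))) ⟨trivial, trivial⟩ ?_
      rw [wp_seq, wp_pushReal, wp_pushReal]
      refine ⟨by simpa using h10, ?_, ?_, by simpa using h2', by simpa using h3'⟩
      · simp [RExpr.eval, IExpr.eval, h0', h2', hi0, h2, readAt_tab rfl hi, ← add_assoc, tab_succ]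
      · simp [RExpr.eval, IExpr.eval, h1', h3', hi0, h3, readAt_tab rfl hi, ← add_assoc, tab_succ]
    · rintro s' - ⟨h10, h0', h1', -⟩
      exact ⟨h10, h0', h1'⟩
  refine Runs.mono (Runs.seq (r1.mono le_rfl fun s₁ _ hs₁ => Runs.seq
    ((r2 s₁ hs₁.1 hs₁.2).mono le_rfl fun s₂ _ hs₂ =>
      Prog.LoopFree.runs_of_wp (p := .setInt 11 (.lenReal 0)) (Q := PointMem S) trivial ?_))) ?_
      (fun _ _ h => h)
  · rw [wp_setInt]
    exact ⟨by simpa using hs₂.2.1, by simpa using hs₂.2.2, by simpa using hs₂.1,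
      by simp [IExpr.eval, hs₂.2.1]⟩
  · simp only [Prog.costBound, IExpr.cost]
    unfold Inst.tot; omega

/-! #### Columns and rows of the fine grid -/

/-- `c` assigns numbers of cells of width `1 / 200` to the reals `x i`. -/
structure IsGrid (n : ℕ) (x : ℕ → ℝ) (c : ℕ → ℤ) : Prop where
  near : ∀ i < n, ∀ j < n, |x i - x j| ≤ 2 → |c i - c j| ≤ 401
  same : ∀ i < n, ∀ j < n, c i = c j → |x i - x j| ≤ 1 / 200

/-- A distance of `2` is `400` cell widths, and taking floors adds less than one. -/
theorem isGrid_floor (n : ℕ) (x : ℕ → ℝ) : IsGrid n x fun i => ⌊x i * 200⌋ := by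
  refine ⟨fun i _ j _ h => ?_, fun i _ j _ h => ?_⟩
  · rw [abs_le] at h ⊢
    have h1 := Int.floor_le (x i * 200)
    have h2 := Int.lt_floor_add_one (x i * 200)
    have h3 := Int.floor_le (x j * 200)
    have h4 := Int.lt_floor_add_one (x j * 200)
    have h5 : ((⌊x i * 200⌋ - ⌊x j * 200⌋ : ℤ) : ℝ) < ((401 : ℤ) : ℝ) := by push_cast; linarith
    have h6 : ((-401 : ℤ) : ℝ) < ((⌊x i * 200⌋ - ⌊x j * 200⌋ : ℤ) : ℝ) := by push_cast; linarith
    exact ⟨(Int.cast_lt.1 h6).le, (Int.cast_lt.1 h5).le⟩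
  · have h1 := Int.floor_le (x i * 200)
    have h2 := Int.lt_floor_add_one (x i * 200)
    have h3 := Int.floor_le (x j * 200)
    have h4 := Int.lt_floor_add_one (x j * 200)
    rw [h] at h1 h2
    rw [abs_le]
    constructor <;> linarith

/-- Greedy cells are not equally spaced, but their numbers grow at most as fast as in a true grid:
`gap` bounds the difference of the numbers by `400 + 1` at distance `2`. Distant points may receive
close numbers, which is harmless because `near` and `same` are all that is used. -/
theorem IsCells.isGrid {n : ℕ} {x : ℕ → ℝ} {c : ℕ → ℤ} (h : IsCells n (((1 / 200 : ℚ) : ℚ) : ℝ) x c) :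
    IsGrid n x c := by
  have hgap : ∀ i < n, ∀ j < n, x i ≤ x j → x j - x i ≤ 2 → |c i - c j| ≤ 401 := by
    intro i hi j hj hij h2
    have h1 := h.gap i hi j hj hij
    have h3 := h.mono i hi j hj hij
    have h4 : ((c j - c i - 1 : ℤ) : ℝ) ≤ ((400 : ℤ) : ℝ) := by
      push_cast at h1 ⊢; linarith
    have h5 := Int.cast_le.1 h4
    rw [abs_le]; omega
  refine ⟨fun i hi j hj h2 => ?_, fun i hi j hj hc => ?_⟩
  · rw [abs_le] at h2
    rcases le_total (x i) (x j) with hij | hij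
    · exact hgap i hi j hj hij (by linarith)
    · rw [abs_sub_comm]
      exact hgap j hj i hi hij (by linarith)
  · have h1 := h.same i hi j hj hc
    have h2 := h.same j hj i hi hc.symm
    push_cast at h1 h2
    rw [abs_le]
    constructor <;> linarith

/-- Compute columns and rows with the floor function. -/
def floorGridProg : Prog :=
  forLoop 0 (.reg 11) <|
    .seq (.floor 1 (.mul (.get 0 (.reg 0)) (.const 200))) <| .seq (.pushInt 0 (.reg 1)) <|
    .seq (.floor 1 (.mul (.get 1 (.reg 0)) (.const 200))) (.pushInt 1 (.reg 1))

theorem floorGridProg_mod {l : Loc} (h : floorGridProg.Mod l) :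
    l = .ireg 0 ∨ l = .ireg 1 ∨ l = .iarr 0 ∨ l = .iarr 1 := by
  simp only [floorGridProg, Prog.Mod, forLoop_mod] at h
  tauto

theorem floorGridProg_runs {S : Inst} {s : State} (h : PointMem S s) (h0 : s.intArr 0 = [])
    (h1 : s.intArr 1 = []) :
    Runs floorGridProg s (30 * (S.tot + 1)) (fun s' =>
      s'.intArr 0 = tab S.tot (fun i => ⌊S.px i * 200⌋) ∧
      s'.intArr 1 = tab S.tot (fun i => ⌊S.py i * 200⌋)) := by
  refine Runs.mono (Runs.forLoop S.tot 14 (fun i s' =>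
    s'.intArr 0 = tab i (fun i => ⌊S.px i * 200⌋) ∧
    s'.intArr 1 = tab i (fun i => ⌊S.py i * 200⌋)) ?_ ?_ ?_ ?_) ?_ (fun _ _ h => h)
  · exact ⟨by simpa using h0, by simpa using h1⟩
  · simp [Prog.Mod]
  · rintro i - s' hA -
    rw [IExpr.eval, hA.ireg 11, h.tot]
    intro h; simpa using floorGridProg_mod h
  · rintro i hi s' hA hi0 ⟨h0, h1⟩
    have hP : PointMem S s' := by
      refine h.of_agree hA ?_ ?_ ?_ ?_ <;> (intro h; simpa using floorGridProg_mod h)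
    refine Runs.mono (Prog.LoopFree.runs_of_wp
      (p := .seq (.floor 1 (.mul (.get 0 (.reg 0)) (.const 200))) <| .seq (.pushInt 0 (.reg 1)) <|
        .seq (.floor 1 (.mul (.get 1 (.reg 0)) (.const 200))) (.pushInt 1 (.reg 1)))
      ⟨trivial, trivial, trivial, trivial⟩ ?_) ?_ (fun _ _ h => h)
    · simp only [wp_seq, wp_floor, wp_pushInt]
      refine ⟨?_, ?_⟩
      · simp [RExpr.eval, IExpr.eval, h0, hi0, hP.xs, readAt_tab rfl hi, tab_succ]
      · simp [RExpr.eval, IExpr.eval, h1, hi0, hP.ys, readAt_tab rfl hi, tab_succ]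
    · simp [Prog.costBound, RExpr.cost, IExpr.cost]
  · simp only [IExpr.cost]; omega

/-! #### Division by a constant -/

/-- Tabulate the quotients by `N` of the numbers below `reg 11 + L`. -/
def divTableProg (N L : ℕ) : Prog :=
  .seq (.setInt 1 (.const 0)) <| .seq (.setInt 2 (.const 0)) <|
  forLoop 0 (.add (.reg 11) (.const L)) <|
    .seq (.pushInt 9 (.reg 1)) <| .seq (.setInt 2 (.add (.reg 2) (.const 1))) <|
    .branch (.leInt (.const N) (.reg 2))
      (.seq (.setInt 2 (.const 0)) (.setInt 1 (.add (.reg 1) (.const 1)))) .skip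

theorem divTableProg_mod {N L : ℕ} {l : Loc} (h : (divTableProg N L).Mod l) :
    l = .ireg 0 ∨ l = .ireg 1 ∨ l = .ireg 2 ∨ l = .iarr 9 := by
  simp only [divTableProg, Prog.Mod, forLoop_mod] at h
  tauto

/-- The machine without floor has no integer division. Counting with a quotient and a remainder
register tabulates all quotients that can occur, because greedy cell numbers are smaller than the
number of points. -/
theorem divTableProg_runs {N : ℕ} (hN : 0 < N) (L : ℕ) {n : ℕ} {s : State} (h11 : s.intReg 11 = n)
    (h9 : s.intArr 9 = []) :
    Runs (divTableProg N L) s ((n + L + 1) * 40) (fun s' =>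
      s'.intArr 9 = tab (n + L) fun v => ((v / N : ℕ) : ℤ)) := by
  have r1 : Runs (.setInt 1 (.const 0)) s 2 (fun s' => s'.intReg 11 = n ∧ s'.intArr 9 = [] ∧
      s'.intReg 1 = 0) := by
    refine Prog.LoopFree.runs_of_wp (p := .setInt 1 (.const 0)) trivial ?_
    rw [wp_setInt]
    exact ⟨by simpa using h11, by simpa using h9, by simp [IExpr.eval]⟩
  have r2 : ∀ s₁ : State, s₁.intReg 11 = n → s₁.intArr 9 = [] → s₁.intReg 1 = 0 →
      Runs (.setInt 2 (.const 0)) s₁ 2 (fun s' => s'.intReg 11 = n ∧ s'.intArr 9 = [] ∧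
      s'.intReg 1 = 0 ∧ s'.intReg 2 = 0) := by
    intro s₁ h11 h9 h1
    refine Prog.LoopFree.runs_of_wp (p := .setInt 2 (.const 0)) trivial ?_
    rw [wp_setInt]
    exact ⟨by simpa using h11, by simpa using h9, by simpa using h1, by simp [IExpr.eval]⟩
  have r3 : ∀ s₁ : State, s₁.intReg 11 = n → s₁.intArr 9 = [] → s₁.intReg 1 = 0 → s₁.intReg 2 = 0 →
      Runs (forLoop 0 (.add (.reg 11) (.const L)) <|
        .seq (.pushInt 9 (.reg 1)) <| .seq (.setInt 2 (.add (.reg 2) (.const 1))) <|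
        .branch (.leInt (.const N) (.reg 2))
          (.seq (.setInt 2 (.const 0)) (.setInt 1 (.add (.reg 1) (.const 1)))) .skip) s₁
        ((n + L + 1) * (17 + 3 + 8)) (fun s' =>
          s'.intReg 11 = n ∧ s'.intArr 9 = (tab (n + L) fun v => ((v / N : ℕ) : ℤ)) ∧
          s'.intReg 1 = ((n + L) / N : ℕ) ∧ s'.intReg 2 = ((n + L) % N : ℕ)) := by
    intro s₁ h11 h9 h1 h2
    refine Runs.forLoop (n + L) 17 (fun i s' => s'.intReg 11 = n ∧
      s'.intArr 9 = (tab i fun v => ((v / N : ℕ) : ℤ)) ∧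
      s'.intReg 1 = (i / N : ℕ) ∧ s'.intReg 2 = (i % N : ℕ)) ?_ ?_ ?_ ?_
    · exact ⟨by simpa using h11, by simpa using h9, by simpa using h1, by simpa using h2⟩
    · simp [Prog.Mod]
    · rintro i - s' - ⟨h11, -⟩
      simp [IExpr.eval, h11]
    · rintro i hi s' - - ⟨h11, h9, h1, h2⟩
      refine Runs.mono (Prog.LoopFree.runs_of_wp
        (p := .seq (.pushInt 9 (.reg 1)) <| .seq (.setInt 2 (.add (.reg 2) (.const 1))) <|
          .branch (.leInt (.const N) (.reg 2))
            (.seq (.setInt 2 (.const 0)) (.setInt 1 (.add (.reg 1) (.const 1)))) .skip)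
        ⟨trivial, trivial, ⟨trivial, trivial⟩, trivial⟩ ?_) ?_ (fun _ _ h => h)
      · have hm := Nat.mod_lt i hN
        have hd := Nat.mod_add_div i N
        rw [wp_seq, wp_pushInt, wp_seq, wp_setInt, wp_branch]
        have hH : (BExpr.leInt (.const N) (.reg 2)).Holds
            ((s'.setIArr 9 (s'.intArr 9 ++ [IExpr.eval s' (.reg 1)])).setReg 2
              (IExpr.eval (s'.setIArr 9 (s'.intArr 9 ++ [IExpr.eval s' (.reg 1)]))
                (.add (.reg 2) (.const 1)))) ↔ N ≤ i % N + 1 := by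
          simp only [BExpr.Holds, IExpr.eval, State.setReg_intReg, Function.update_self,
            State.setIArr_intReg, h2]
          exact_mod_cast Iff.rfl
        rw [hH]
        refine ⟨fun hh => ?_, fun hh => ?_⟩
        · obtain ⟨e1, e2⟩ := (Nat.div_mod_unique (a := i + 1) (d := i / N + 1) (c := 0) hN).2
            ⟨by rw [mul_add]; omega, hN⟩
          rw [wp_seq, wp_setInt, wp_setInt, e1, e2]
          refine ⟨by simpa using h11, ?_, ?_, ?_⟩
          · simp [IExpr.eval, h9, h1, tab_succ]
          · simp [IExpr.eval, h1]
          · simp [IExpr.eval]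
        · obtain ⟨e1, e2⟩ := (Nat.div_mod_unique (a := i + 1) (d := i / N) (c := i % N + 1) hN).2
            ⟨by omega, by omega⟩
          rw [wp_skip, e1, e2]
          refine ⟨by simpa using h11, ?_, ?_, ?_⟩
          · simp [IExpr.eval, h9, h1, tab_succ]
          · simp [IExpr.eval, h1]
          · simp [IExpr.eval, h2]
      · simp [Prog.costBound, BExpr.cost, IExpr.cost]
  refine Runs.mono (Runs.seq (r1.mono le_rfl fun s₁ _ hs₁ => Runs.seq
    ((r2 s₁ hs₁.1 hs₁.2.1 hs₁.2.2).mono le_rfl fun s₂ _ hs₂ =>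
      r3 s₂ hs₂.1 hs₂.2.1 hs₂.2.2.1 hs₂.2.2.2))) ?_ (fun _ _ h => h.2.1)
  omega

/-! #### Keys of the coarse cells -/

/-- Compute the keys of copy `e` of the point `reg 0`; `dv` divides by `N`. -/
def keyCopy (N R : ℕ) (dv : IExpr → Prog) (e : ℕ) : Prog :=
  .seq (dv (.add (.get 0 (.reg 0)) (.const (e / 5 + offX R (e % 5) : ℕ)))) <|
  .seq (.pushInt 2 (.add (.mul (.reg 1) (.const N)) (.const (e / 5 : ℕ)))) <|
  .seq (dv (.add (.get 1 (.reg 0)) (.const (e / 5 + offY R (e % 5) : ℕ)))) (.pushInt 3 (.reg 1))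

/-- All copies of a point. -/
def keyBody (N R : ℕ) (dv : IExpr → Prog) : Prog :=
  seqList ((List.range (5 * N)).map (keyCopy N R dv))

/-- Compute the keys of all copies of all points. -/
def keyProg (N R : ℕ) (dv : IExpr → Prog) : Prog := forLoop 0 (.reg 11) (keyBody N R dv)

/-- The memory holds the points, the fine grid, and the keys of the coarse cells. -/
structure KeyMem (S : Inst) (s : State) : Prop where
  points : PointMem S s
  cx : s.intArr 0 = tab S.tot S.cx
  cy : s.intArr 1 = tab S.tot S.cy
  keyA : s.intArr 2 = tab (S.tot * (5 * S.N)) fun j => S.keyA (j / (5 * S.N)) (j % (5 * S.N))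
  keyB : s.intArr 3 = tab (S.tot * (5 * S.N)) fun j => S.keyB (j / (5 * S.N)) (j % (5 * S.N))

/-- `dv` divides by `N` the numbers that satisfy `ok`, if the integer array `9` is `A`. -/
structure Divides (N : ℕ) (dv : IExpr → Prog) (A : List ℤ) (ok : ℤ → Prop) : Prop where
  loopFree : ∀ e, (dv e).LoopFree
  mod : ∀ e l, (dv e).Mod l → l = .ireg 1
  spec : ∀ s e, s.intArr 9 = A → ok (e.eval s) →
    (dv e).WP (fun s' => s' = s.setReg 1 (e.eval s / N)) s

/-- Flooring the real quotient is integer division, for negative columns as well. -/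
theorem divides_floor {N : ℕ} (A : List ℤ) :
    Divides N (fun e => .floor 1 (.div (.ofInt e) (.const N))) A fun _ => True := by
  refine ⟨fun _ => trivial, fun _ _ h => h, fun s e _ _ => ?_⟩
  rw [wp_floor]
  simp only [RExpr.eval, Rat.cast_natCast, Int.floor_div_natCast, Int.floor_intCast]

theorem divides_table (N L : ℕ) :
    Divides N (fun e => .setInt 1 (.get 9 e)) (tab L fun v => ((v / N : ℕ) : ℤ))
      fun z => 0 ≤ z ∧ z < L := by
  refine ⟨fun _ => trivial, fun _ _ h => h, fun s e hA hok => ?_⟩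
  rw [wp_setInt]
  obtain ⟨k, hk⟩ := Int.eq_ofNat_of_zero_le hok.1
  rw [hk] at hok ⊢
  simp only [IExpr.eval, hk, hA]
  rw [readAt_tab rfl (by omega)]
  push_cast
  rfl

theorem keyBody_mod {N R : ℕ} {dv : IExpr → Prog} {A : List ℤ} {ok : ℤ → Prop}
    (hdv : Divides N dv A ok) {l : Loc} (h : (keyBody N R dv).Mod l) :
    l = .ireg 1 ∨ l = .iarr 2 ∨ l = .iarr 3 := by
  simp only [keyBody, seqList_mod, List.mem_map] at h
  obtain ⟨_, ⟨t, -, rfl⟩, h⟩ := h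
  simp only [keyCopy, Prog.Mod] at h
  rcases h with h | h | h | h
  · exact Or.inl (hdv.mod _ _ h)
  · exact Or.inr (Or.inl h)
  · exact Or.inl (hdv.mod _ _ h)
  · exact Or.inr (Or.inr h)

theorem keyProg_mod {N R : ℕ} {dv : IExpr → Prog} {A : List ℤ} {ok : ℤ → Prop}
    (hdv : Divides N dv A ok) {l : Loc} (h : (keyProg N R dv).Mod l) :
    l = .ireg 0 ∨ l = .ireg 1 ∨ l = .iarr 2 ∨ l = .iarr 3 :=
  (forLoop_mod.1 h).imp_right (keyBody_mod hdv)

theorem keyBody_loopFree {N R : ℕ} {dv : IExpr → Prog} {A : List ℤ} {ok : ℤ → Prop}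
    (hdv : Divides N dv A ok) : (keyBody N R dv).LoopFree := by
  rw [keyBody, seqList_loopFree]
  intro p hp
  obtain ⟨e, -, rfl⟩ := List.mem_map.1 hp
  exact ⟨hdv.loopFree _, trivial, hdv.loopFree _, trivial⟩

theorem keyBody_wp {S : Inst} {dv : IExpr → Prog} {A : List ℤ} {ok : ℤ → Prop}
    (hdv : Divides S.N dv A ok) {s : State} {i : ℕ}
    (hx : ∀ k < S.N + 2 * S.R, ok (S.cx i + k))
    (hy : ∀ k < S.N + 2 * S.R, ok (S.cy i + k)) (hi : i < S.tot)
    (h0 : s.intReg 0 = i) (h9 : s.intArr 9 = A) (hcx : s.intArr 0 = tab S.tot S.cx)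
    (hcy : s.intArr 1 = tab S.tot S.cy)
    (h2 : s.intArr 2 = tab (i * (5 * S.N)) fun j => S.keyA (j / (5 * S.N)) (j % (5 * S.N)))
    (h3 : s.intArr 3 = tab (i * (5 * S.N)) fun j => S.keyB (j / (5 * S.N)) (j % (5 * S.N))) :
    (keyBody S.N S.R dv).WP (fun s' =>
      s'.intArr 2 = (tab ((i + 1) * (5 * S.N)) fun j => S.keyA (j / (5 * S.N)) (j % (5 * S.N))) ∧
      s'.intArr 3 = tab ((i + 1) * (5 * S.N)) fun j => S.keyB (j / (5 * S.N)) (j % (5 * S.N))) s := by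
  refine Prog.WP.mono (wp_seqList_range (keyCopy S.N S.R dv) (fun e s' =>
    s'.intReg 0 = i ∧ s'.intArr 9 = A ∧ s'.intArr 0 = tab S.tot S.cx ∧
    s'.intArr 1 = tab S.tot S.cy ∧
    s'.intArr 2 = (tab (i * (5 * S.N) + e) fun j => S.keyA (j / (5 * S.N)) (j % (5 * S.N))) ∧
    s'.intArr 3 = tab (i * (5 * S.N) + e) fun j => S.keyB (j / (5 * S.N)) (j % (5 * S.N)))
    ⟨h0, h9, hcx, hcy, h2, h3⟩ ?_) ?_
  · rintro e he s' ⟨h0, h9, hcx, hcy, h2, h3⟩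
    have e1 : (i * (5 * S.N) + e) / (5 * S.N) = i := by
      rw [add_comm, Nat.add_mul_div_right _ _ (by omega), Nat.div_eq_of_lt he, zero_add]
    have e2 : (i * (5 * S.N) + e) % (5 * S.N) = e := by
      rw [add_comm, Nat.add_mul_mod_self_right, Nat.mod_eq_of_lt he]
    have hX : (IExpr.add (.get 0 (.reg 0)) (.const (e / 5 + offX S.R (e % 5) : ℕ))).eval s' =
        S.cx i + (e / 5 + offX S.R (e % 5) : ℕ) := by
      simp only [IExpr.eval, h0, hcx, readAt_tab rfl hi]
    have hox := offX_le S.R (e % 5)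
    have hoy := offY_le S.R (e % 5)
    rw [keyCopy, wp_seq]
    -- The shift is at most `N - 1` and the offset at most `2R`, so the dividend stays in the
    -- admissible range.
    refine (hdv.spec s' _ h9 (by rw [hX]; exact hx _ (by omega))).mono ?_
    rintro _ rfl
    rw [wp_seq, wp_pushInt, wp_seq, hX]
    obtain ⟨s₁, hs₁⟩ : ∃ s₁, s₁ = (s'.setReg 1 ((S.cx i + (e / 5 + offX S.R (e % 5) : ℕ)) / S.N)).setIArr 2
      ((s'.setReg 1 ((S.cx i + (e / 5 + offX S.R (e % 5) : ℕ)) / S.N)).intArr 2 ++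
        [IExpr.eval (s'.setReg 1 ((S.cx i + (e / 5 + offX S.R (e % 5) : ℕ)) / S.N))
          (.add (.mul (.reg 1) (.const S.N)) (.const (e / 5 : ℕ)))]) := ⟨_, rfl⟩
    rw [← hs₁]
    have h0' : s₁.intReg 0 = i := by simp [hs₁, h0]
    have hcy' : s₁.intArr 1 = tab S.tot S.cy := by simp [hs₁, hcy]
    have hcx' : s₁.intArr 0 = tab S.tot S.cx := by simp [hs₁, hcx]
    have h9' : s₁.intArr 9 = A := by simp [hs₁, h9]
    have h2' : s₁.intArr 2 = tab (i * (5 * S.N) + e + 1)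
        fun j => S.keyA (j / (5 * S.N)) (j % (5 * S.N)) := by
      rw [tab_succ, e1, e2]
      simp [hs₁, h2, IExpr.eval, Inst.keyA, add_assoc]
    have hY : (IExpr.add (.get 1 (.reg 0)) (.const (e / 5 + offY S.R (e % 5) : ℕ))).eval s₁ =
        S.cy i + (e / 5 + offY S.R (e % 5) : ℕ) := by
      simp only [IExpr.eval, h0', hcy', readAt_tab rfl hi]
    refine (hdv.spec s₁ _ h9' (by rw [hY]; exact hy _ (by omega))).mono ?_
    rintro _ rfl
    rw [wp_pushInt, hY]
    refine ⟨by simpa using h0', by simpa using h9', by simpa using hcx', by simpa using hcy',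
      by simpa [add_assoc] using h2', ?_⟩
    rw [← add_assoc, tab_succ, e1, e2]
    simp [hs₁, h3, IExpr.eval, Inst.keyB, add_assoc]
  · rintro s' ⟨-, -, -, -, h2, h3⟩
    rw [add_mul, one_mul]
    exact ⟨h2, h3⟩

theorem keyProg_runs {S : Inst} {dv : IExpr → Prog} {A : List ℤ} {ok : ℤ → Prop}
    (hdv : Divides S.N dv A ok) {s : State}
    (hx : ∀ i < S.tot, ∀ k < S.N + 2 * S.R, ok (S.cx i + k))
    (hy : ∀ i < S.tot, ∀ k < S.N + 2 * S.R, ok (S.cy i + k)) (h : PointMem S s)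
    (h9 : s.intArr 9 = A) (hcx : s.intArr 0 = tab S.tot S.cx) (hcy : s.intArr 1 = tab S.tot S.cy)
    (h2 : s.intArr 2 = []) (h3 : s.intArr 3 = []) :
    Runs (keyProg S.N S.R dv) s (((keyBody S.N S.R dv).costBound + 9) * (S.tot + 1)) (KeyMem S) := by
  have hfr : ∀ s', Agree (keyProg S.N S.R dv).Mod s s' → PointMem S s' ∧ s'.intArr 9 = A ∧
      s'.intArr 0 = tab S.tot S.cx ∧ s'.intArr 1 = tab S.tot S.cy := by
    intro s' hA
    refine ⟨h.of_agree hA ?_ ?_ ?_ ?_, (hA.iarr _ ?_).trans h9, (hA.iarr _ ?_).trans hcx,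
      (hA.iarr _ ?_).trans hcy⟩ <;> (intro h; simpa using keyProg_mod hdv h)
  refine Runs.mono (Runs.forLoop S.tot (keyBody S.N S.R dv).costBound (fun i s' =>
    s'.intArr 2 = (tab (i * (5 * S.N)) fun j => S.keyA (j / (5 * S.N)) (j % (5 * S.N))) ∧
    s'.intArr 3 = tab (i * (5 * S.N)) fun j => S.keyB (j / (5 * S.N)) (j % (5 * S.N)))
    ?_ ?_ ?_ ?_) ?_ ?_
  · exact ⟨by simpa using h2, by simpa using h3⟩
  · intro h; simpa using keyBody_mod hdv h
  · rintro i - s' hA -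
    exact (hfr s' hA).1.tot
  · rintro i hi s' hA h0 ⟨h2, h3⟩
    obtain ⟨-, h9, hcx, hcy⟩ := hfr s' hA
    exact Prog.LoopFree.runs_of_wp (keyBody_loopFree hdv)
      (keyBody_wp hdv (hx i hi) (hy i hi) hi h0 h9 hcx hcy h2 h3)
  · simp only [IExpr.cost]; rw [mul_comm]
  · rintro s' hA ⟨h2, h3⟩
    obtain ⟨hP, -, hcx, hcy⟩ := hfr s' hA
    exact ⟨hP, hcx, hcy, h2, h3⟩

/-! #### Numbers of the coarse cells -/

/-- `c` numbers the coarse cells: copies get the same number if and only if their keys agree. -/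
structure IsNumbering (S : Inst) (c : ℕ → ℤ) : Prop where
  nonneg : ∀ j < S.tot * (5 * S.N), 0 ≤ c j
  lt : ∀ j < S.tot * (5 * S.N), c j < (S.tot * (5 * S.N) : ℕ)
  eq_iff : ∀ i < S.tot * (5 * S.N), ∀ j < S.tot * (5 * S.N), c i = c j ↔
    S.keyA (i / (5 * S.N)) (i % (5 * S.N)) = S.keyA (j / (5 * S.N)) (j % (5 * S.N)) ∧
    S.keyB (i / (5 * S.N)) (i % (5 * S.N)) = S.keyB (j / (5 * S.N)) (j % (5 * S.N))

/-- Number the cells with a hash table; `reg 3` counts the cells. -/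
def hashIdProg : Prog :=
  .seq (.setInt 3 (.const 0)) <| forLoop 0 (.lenInt 2) <|
    .seq (.hashGet 1 0 (.get 2 (.reg 0)) (.get 3 (.reg 0))) <|
    .seq (.branch (.leInt (.reg 1) (.const 0))
      (.seq (.setInt 3 (.add (.reg 3) (.const 1))) <|
        .seq (.hashSet 0 (.get 2 (.reg 0)) (.get 3 (.reg 0)) (.reg 3)) (.setInt 1 (.reg 3))) .skip) <|
    .pushInt 4 (.sub (.reg 1) (.const 1))

theorem hashIdProg_mod {l : Loc} (h : hashIdProg.Mod l) :
    l = .ireg 0 ∨ l = .ireg 1 ∨ l = .ireg 3 ∨ l = .iarr 4 ∨ l = .table 0 := by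
  simp only [hashIdProg, Prog.Mod, forLoop_mod] at h
  tauto

/-- The hash table `H` numbers the keys with indices below `j` from `1` to `c`. -/
structure HashInv (key : ℕ → ℤ × ℤ) (j : ℕ) (c : ℤ) (H : ℤ × ℤ → ℤ) : Prop where
  le : c ≤ j
  nonneg : 0 ≤ c
  range : ∀ k, 0 ≤ H k ∧ H k ≤ c
  inj : ∀ k k', H k = H k' → 0 < H k → k = k'
  pos : ∀ i < j, 0 < H (key i)

theorem HashInv.old {key : ℕ → ℤ × ℤ} {j : ℕ} {c : ℤ} {H : ℤ × ℤ → ℤ} (h : HashInv key j c H)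
    (hk : 0 < H (key j)) : HashInv key (j + 1) c H := by
  refine ⟨by have := h.le; push_cast; omega, h.nonneg, h.range, h.inj, fun i hi => ?_⟩
  rcases Nat.lt_succ_iff_lt_or_eq.1 hi with hi | rfl
  · exact h.pos i hi
  · exact hk

theorem HashInv.ne {key : ℕ → ℤ × ℤ} {j : ℕ} {c : ℤ} {H : ℤ × ℤ → ℤ} (h : HashInv key j c H)
    (hk : H (key j) ≤ 0) {i : ℕ} (hi : i < j) : key i ≠ key j := by
  intro he
  have := h.pos i hi
  rw [he] at this
  omega

/-- The fresh number `c + 1` exceeds every value in the table, so the positive values remain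
injective. Numbers start at `1` because `0` stands for an absent key. -/
theorem HashInv.new {key : ℕ → ℤ × ℤ} {j : ℕ} {c : ℤ} {H : ℤ × ℤ → ℤ} (h : HashInv key j c H)
    (hk : H (key j) ≤ 0) :
    HashInv key (j + 1) (c + 1) (Function.update H (key j) (c + 1)) := by
  have hc := h.nonneg
  have hr := h.range
  refine ⟨by have := h.le; push_cast; omega, by omega, fun k => ?_, fun k k' he hp => ?_,
    fun i hi => ?_⟩
  · rw [Function.update_apply]
    have := hr k
    split_ifs <;> omega
  · rw [Function.update_apply, Function.update_apply] at he
    rw [Function.update_apply] at hp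
    have h1 := hr k
    have h2 := hr k'
    split_ifs at he hp with ha hb hb
    · rw [ha, hb]
    · omega
    · omega
    · exact h.inj k k' he hp
  · rw [Function.update_apply]
    split_ifs with ha
    · omega
    · rcases Nat.lt_succ_iff_lt_or_eq.1 hi with hi | rfl
      · exact h.pos i hi
      · exact absurd rfl ha

theorem hashIdProg_runs {S : Inst} {s : State} (h : KeyMem S s) (h4 : s.intArr 4 = [])
    (hH : s.hash 0 = fun _ => 0) :
    Runs hashIdProg s ((5 * S.N + 1) * 50 * (S.tot + 1)) (fun s' => ∃ c : ℕ → ℤ,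
      s'.intArr 4 = tab (S.tot * (5 * S.N)) c ∧ IsNumbering S c) := by
  obtain ⟨M, hM⟩ : ∃ M, M = S.tot * (5 * S.N) := ⟨_, rfl⟩
  obtain ⟨key, hkey⟩ : ∃ key : ℕ → ℤ × ℤ, key = fun j =>
    (S.keyA (j / (5 * S.N)) (j % (5 * S.N)), S.keyB (j / (5 * S.N)) (j % (5 * S.N))) := ⟨_, rfl⟩
  have hA : s.intArr 2 = tab M fun j => (key j).1 := by rw [h.keyA, hkey, hM]
  have hB : s.intArr 3 = tab M fun j => (key j).2 := by rw [h.keyB, hkey, hM]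
  have r1 : Runs (.setInt 3 (.const 0)) s 2 (fun s' => s' = s.setReg 3 0) := by
    refine Prog.LoopFree.runs_of_wp (p := .setInt 3 (.const 0)) trivial ?_
    rw [wp_setInt]
    rfl
  have r2 : Runs (forLoop 0 (.lenInt 2) <|
    .seq (.hashGet 1 0 (.get 2 (.reg 0)) (.get 3 (.reg 0))) <|
    .seq (.branch (.leInt (.reg 1) (.const 0))
      (.seq (.setInt 3 (.add (.reg 3) (.const 1))) <|
        .seq (.hashSet 0 (.get 2 (.reg 0)) (.get 3 (.reg 0)) (.reg 3)) (.setInt 1 (.reg 3))) .skip) <|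
    .pushInt 4 (.sub (.reg 1) (.const 1))) (s.setReg 3 0) ((M + 1) * (30 + 1 + 8)) (fun s' =>
      s'.intArr 2 = s.intArr 2 ∧ s'.intArr 3 = s.intArr 3 ∧ HashInv key M (s'.intReg 3) (s'.hash 0) ∧
      s'.intArr 4 = tab M fun i => s'.hash 0 (key i) - 1) := by
    refine Runs.forLoop M 30 (fun j s' =>
      s'.intArr 2 = s.intArr 2 ∧ s'.intArr 3 = s.intArr 3 ∧ HashInv key j (s'.intReg 3) (s'.hash 0) ∧
      s'.intArr 4 = tab j fun i => s'.hash 0 (key i) - 1) ?_ ?_ ?_ ?_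
    · refine ⟨rfl, rfl, ?_, by simpa using h4⟩
      simp only [State.setReg_hash, hH]
      exact ⟨by simp, by simp, by simp, by simp, by simp⟩
    · simp [Prog.Mod]
    · rintro i - s' - ⟨h2, -⟩
      simp [IExpr.eval, h2, hA]
    · rintro j hj s' - h0 ⟨h2, h3, hI, h4⟩
      refine Runs.mono (Prog.LoopFree.runs_of_wp
        (p := .seq (.hashGet 1 0 (.get 2 (.reg 0)) (.get 3 (.reg 0))) <|
          .seq (.branch (.leInt (.reg 1) (.const 0))
            (.seq (.setInt 3 (.add (.reg 3) (.const 1))) <|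
              .seq (.hashSet 0 (.get 2 (.reg 0)) (.get 3 (.reg 0)) (.reg 3)) (.setInt 1 (.reg 3)))
            .skip) <|
          .pushInt 4 (.sub (.reg 1) (.const 1)))
        ⟨trivial, ⟨⟨trivial, trivial, trivial⟩, trivial⟩, trivial⟩ ?_) ?_ (fun _ _ h => h)
      · have hk : ((IExpr.get 2 (.reg 0)).eval s', (IExpr.get 3 (.reg 0)).eval s') = key j := by
          simp [IExpr.eval, h2, h3, hA, hB, h0, readAt_tab rfl hj]
        rw [wp_seq, wp_hashGet, hk, wp_seq, wp_branch]
        have hk' : ∀ v w, ((IExpr.get 2 (.reg 0)).eval ((s'.setReg 1 v).setReg 3 w),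
            (IExpr.get 3 (.reg 0)).eval ((s'.setReg 1 v).setReg 3 w)) = key j := by
          intro v w
          rw [← hk]
          simp [IExpr.eval]
        simp only [BExpr.Holds, IExpr.eval, State.setReg_intReg, Function.update_self]
        refine ⟨fun hh => ?_, fun hh => ?_⟩
        · rw [wp_seq, wp_setInt, wp_seq, wp_hashSet, hk', wp_setInt, wp_pushInt]
          have hnew := hI.new hh
          refine ⟨by simpa using h2, by simpa using h3, ?_, ?_⟩
          · simpa [IExpr.eval] using hnew
          · rw [tab_succ]
            simp only [State.setReg_intArr, State.setIArr_intArr, State.setHash_intArr,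
              Function.update_self, IExpr.eval, State.setReg_intReg, State.setHash_intReg,
              State.setReg_hash, State.setIArr_hash, State.setHash_hash, h4]
            congr 1
            -- Inserting a fresh key does not disturb the numbers already given out, because all
            -- earlier keys differ from it.
            refine tab_congr fun i hi => ?_
            rw [Function.update_of_ne (hI.ne hh hi)]
        · rw [wp_skip, wp_pushInt]
          refine ⟨by simpa using h2, by simpa using h3, ?_, ?_⟩
          · simpa using hI.old (not_le.1 hh)
          · simp [h4, IExpr.eval, tab_succ]
      · simp [Prog.costBound, BExpr.cost, IExpr.cost]
  refine Runs.mono (Runs.seq (r1.mono le_rfl fun s₁ _ hs₁ => hs₁ ▸ r2)) ?_ ?_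
  · have e1 : M + 1 ≤ (5 * S.N + 1) * (S.tot + 1) := by rw [hM]; ring_nf; omega
    have e2 := Nat.mul_le_mul_right 39 e1
    have e3 : (5 * S.N + 1) * 50 * (S.tot + 1) = (5 * S.N + 1) * (S.tot + 1) * 50 := by ring
    rw [e3]
    omega
  · rintro s' - ⟨-, -, hI, h4⟩
    refine ⟨_, hM ▸ h4, ?_, ?_, ?_⟩ <;> rw [← hM]
    · intro j hj
      have := hI.pos j hj
      omega
    · intro j hj
      have h1 := (hI.range (key j)).2
      have h2 := hI.le
      omega
    · intro i hi j hj
      have hp := hI.pos i hi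
      have : (s'.hash 0 (key i) - 1 = s'.hash 0 (key j) - 1) ↔ key i = key j := by
        constructor
        · intro he
          exact hI.inj _ _ (by omega) hp
        · intro he; rw [he]
      rw [this, hkey, Prod.mk.injEq]

/-- Number the cells by sorting; the length of the integer array `9` bounds the second keys. -/
def sortIdProg : Prog :=
  .seq (forLoop 0 (.lenInt 2) (.pushReal 6 (.add (.mul (.ofInt (.get 2 (.reg 0)))
    (.ofInt (.lenInt 9))) (.ofInt (.get 3 (.reg 0)))))) (compressProg 6 12 4 1)

theorem sortIdProg_mod {l : Loc} (h : sortIdProg.Mod l) :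
    l = .ireg 0 ∨ l = .rarr 6 ∨ l = .iarr 12 ∨ l = .iarr 4 ∨ l = .rreg 0 ∨
      ∃ r, 20 ≤ r ∧ r ≤ 27 ∧ l = .ireg r := by
  simp only [sortIdProg, Prog.Mod, forLoop_mod] at h
  rcases h with (h | h) | h
  · exact Or.inl h
  · exact Or.inr (Or.inl h)
  · exact Or.inr (Or.inr (compressProg_mod h))

theorem digits_unique_int {a a' b b' k : ℤ} (h : a * k + b = a' * k + b') (hb : 0 ≤ b) (hb' : 0 ≤ b')
    (hbk : b < k) (hbk' : b' < k) : a = a' ∧ b = b' := by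
  have hk : 0 < k := by omega
  have h1 : (a * k + b) / k = a := by
    rw [add_comm, Int.add_mul_ediv_right _ _ hk.ne', Int.ediv_eq_zero_of_lt hb hbk, zero_add]
  have h2 : (a' * k + b') / k = a' := by
    rw [add_comm, Int.add_mul_ediv_right _ _ hk.ne', Int.ediv_eq_zero_of_lt hb' hbk', zero_add]
  have : a = a' := by rw [← h1, ← h2, h]
  subst this
  exact ⟨rfl, by omega⟩

/-- A pair of keys is encoded as the integer `keyA * W + keyB`, injectively since `0 ≤ keyB < W`.
Distinct integers differ by at least one, so greedy cells of width `1` contain exactly one integer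
each, and the cell numbers are the desired numbers. -/
theorem sortIdProg_runs {S : Inst} {s : State} (h : KeyMem S s) {W : ℕ}
    (h9 : (s.intArr 9).length = W)
    (hW : ∀ i < S.tot, ∀ e < 5 * S.N, 0 ≤ S.keyB i e ∧ S.keyB i e < W)
    (h4 : s.intArr 4 = []) (h12 : s.intArr 12 = []) (h6 : s.realArr 6 = []) :
    Runs sortIdProg s ((5 * S.N + 1) * 20 * (S.tot + 1) + compressCost (S.tot * (5 * S.N)))
      (fun s' => ∃ c : ℕ → ℤ, s'.intArr 4 = tab (S.tot * (5 * S.N)) c ∧ IsNumbering S c) := by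
  obtain ⟨M, hM⟩ : ∃ M, M = S.tot * (5 * S.N) := ⟨_, rfl⟩
  obtain ⟨kA, hkA⟩ : ∃ k : ℕ → ℤ, k = fun j => S.keyA (j / (5 * S.N)) (j % (5 * S.N)) := ⟨_, rfl⟩
  obtain ⟨kB, hkB⟩ : ∃ k : ℕ → ℤ, k = fun j => S.keyB (j / (5 * S.N)) (j % (5 * S.N)) := ⟨_, rfl⟩
  have hA : s.intArr 2 = tab M kA := by rw [h.keyA, hkA, hM]
  have hB : s.intArr 3 = tab M kB := by rw [h.keyB, hkB, hM]
  have hbd : ∀ j < M, 0 ≤ kB j ∧ kB j < W := by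
    intro j hj
    have h5 : 0 < 5 * S.N := by
      rcases Nat.eq_zero_or_pos (5 * S.N) with h | h
      · rw [hM, h, mul_zero] at hj; omega
      · exact h
    rw [hkB]
    refine hW _ ?_ _ (Nat.mod_lt _ h5)
    rw [Nat.div_lt_iff_lt_mul h5, ← hM]
    exact hj
  obtain ⟨x, hx⟩ : ∃ x : ℕ → ℝ, x = fun j => ((kA j * W + kB j : ℤ) : ℝ) := ⟨_, rfl⟩
  have r1 : Runs (forLoop 0 (.lenInt 2) (.pushReal 6 (.add (.mul (.ofInt (.get 2 (.reg 0)))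
      (.ofInt (.lenInt 9))) (.ofInt (.get 3 (.reg 0)))))) s ((M + 1) * (11 + 1 + 8)) (fun s' =>
        s'.intArr = s.intArr ∧ s'.realArr 6 = tab M x) := by
    refine Runs.forLoop M 11 (fun j s' => s'.intArr = s.intArr ∧ s'.realArr 6 = tab j x) ?_ ?_ ?_ ?_
    · exact ⟨rfl, by simpa using h6⟩
    · simp [Prog.Mod]
    · rintro i - s' - ⟨h2, -⟩
      simp [IExpr.eval, h2, hA]
    · rintro j hj s' - h0 ⟨h2, h6⟩
      refine Runs.mono (Prog.LoopFree.runs_of_wp (p := .pushReal 6 (.add (.mul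
        (.ofInt (.get 2 (.reg 0))) (.ofInt (.lenInt 9))) (.ofInt (.get 3 (.reg 0))))) trivial ?_)
        (by simp [Prog.costBound, RExpr.cost, IExpr.cost]) (fun _ _ h => h)
      rw [wp_pushReal]
      refine ⟨by simpa using h2, ?_⟩
      simp [RExpr.eval, IExpr.eval, h2, h6, h0, hA, hB, h9, readAt_tab rfl hj, tab_succ, hx]
  have r2 : ∀ s₁ : State, s₁.intArr = s.intArr → s₁.realArr 6 = tab M x →
      Runs (compressProg 6 12 4 1) s₁ (compressCost M) (fun s' =>
        ∃ c : ℕ → ℤ, s'.intArr 4 = tab M c ∧ IsCells M ((1 : ℚ) : ℝ) x c) := by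
    intro s₁ hi hr
    exact compressProg_runs (by norm_num) (by norm_num) (by rw [hi, h12]) (by rw [hi, h4]) hr
  rw [← hM]
  refine Runs.mono (Runs.seq (r1.mono le_rfl fun s₁ _ hs₁ => r2 s₁ hs₁.1 hs₁.2)) ?_ ?_
  · have e1 : M + 1 ≤ (5 * S.N + 1) * (S.tot + 1) := by rw [hM]; ring_nf; omega
    have e2 := Nat.mul_le_mul_right 20 e1
    have e3 : (5 * S.N + 1) * 20 * (S.tot + 1) = (5 * S.N + 1) * (S.tot + 1) * 20 := by ring
    rw [e3]
    omega
  · rintro s' - ⟨c, h4, hc⟩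
    -- Reals in a common cell differ by less than one; for integers this is an inequality without
    -- the strict gap, and by symmetry an equality.
    have hle : ∀ i < M, ∀ j < M, c i = c j → kA j * W + kB j ≤ kA i * W + kB i := by
      intro i hi j hj he
      have h1 := hc.same i hi j hj he
      rw [hx] at h1
      have h2 : ((kA j * W + kB j : ℤ) : ℝ) < ((kA i * W + kB i + 1 : ℤ) : ℝ) := by
        push_cast at h1 ⊢; linarith
      have := Int.cast_lt.1 h2
      omega
    refine ⟨c, h4, ?_, ?_, ?_⟩ <;> rw [← hM]
    · exact hc.nonneg
    · exact hc.lt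
    · intro i hi j hj
      constructor
      · intro he
        have h1 := digits_unique_int (le_antisymm (hle j hj i hi he.symm) (hle i hi j hj he))
          (hbd i hi).1 (hbd j hj).1 (hbd i hi).2 (hbd j hj).2
        rw [hkA, hkB] at h1
        exact h1
      · rintro ⟨e1, e2⟩
        have e3 : x i = x j := by rw [hx, hkA, hkB]; simp only [e1, e2]
        exact le_antisymm (hc.mono i hi j hj e3.le) (hc.mono j hj i hi e3.ge)

/-! ### The algorithms -/

/-- The instance with numbers for the copies. -/
def Inst.withIds (S : Inst) (c : ℕ → ℤ) : Inst :=
  { S with id := fun i e => (c (i * (5 * S.N) + e)).toNat }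

theorem KeyMem.ready {S : Inst} {s : State} (h : KeyMem S s) {c : ℕ → ℤ}
    (h4 : s.intArr 4 = tab (S.tot * (5 * S.N)) c) (hc : IsNumbering S c) :
    Ready (S.withIds c) s := by
  refine ⟨h.points.xs, h.points.ys, h.points.n, h.points.tot, h.cx, h.cy, h.keyA, h.keyB,
    h4.trans (tab_congr fun j hj => ?_)⟩
  change c j = ((c (j / (5 * S.N) * (5 * S.N) + j % (5 * S.N))).toNat : ℤ)
  rw [Nat.div_add_mod', Int.toNat_of_nonneg (hc.nonneg j hj)]

/-- Two points in a fine cell have squared distance at most `2 / 200 ^ 2`, which is below `1 /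
10000`; points at distance at most `2` differ by at most `401 = R` columns and rows. -/
theorem IsNumbering.valid {S : Inst} {c : ℕ → ℤ} (hc : IsNumbering S c) (hN : 2 * S.R ≤ S.N)
    (hR : S.R = 401) (hx : IsGrid S.tot S.px S.cx) (hy : IsGrid S.tot S.py S.cy)
    (hsub : ∀ q < S.n', ∃ i < S.n, S.px i = S.px (S.n + q) ∧ S.py i = S.py (S.n + q)) :
    (S.withIds c).Valid := by
  have hlt : ∀ i < S.tot, ∀ e < 5 * S.N, i * (5 * S.N) + e < S.tot * (5 * S.N) :=
    fun i hi e he => Inst.digits_lt hi he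
  have hdig : ∀ i, ∀ e < 5 * S.N, (i * (5 * S.N) + e) / (5 * S.N) = i ∧
      (i * (5 * S.N) + e) % (5 * S.N) = e := by
    intro i e he
    constructor
    · rw [add_comm, Nat.add_mul_div_right _ _ (by omega), Nat.div_eq_of_lt he, zero_add]
    · rw [add_comm, Nat.add_mul_mod_self_right, Nat.mod_eq_of_lt he]
  have habs : ∀ {a b : ℝ}, a ^ 2 + b ^ 2 ≤ 4 → |a| ≤ 2 := by
    intro a b h
    exact abs_le_of_sq_le_sq (by nlinarith [sq_nonneg b]) (by norm_num)
  refine ⟨by change 0 < S.N; omega, hN, ?_, ?_, hsub, ?_, ?_⟩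
  · intro i hi j hj hd
    have hd' : (S.px i - S.px j) ^ 2 + (S.py i - S.py j) ^ 2 ≤ 4 := hd
    change |S.cx i - S.cx j| ≤ (S.R : ℤ) ∧ |S.cy i - S.cy j| ≤ (S.R : ℤ)
    rw [hR]
    exact ⟨hx.near i hi j hj (habs hd'), hy.near i hi j hj (habs (by rwa [add_comm]))⟩
  · intro i hi j hj h1 h2
    change (S.px i - S.px j) ^ 2 + (S.py i - S.py j) ^ 2 ≤ 1 / 10000
    have h3 := sq_le_sq' (abs_le.1 (hx.same i hi j hj h1)).1 (abs_le.1 (hx.same i hi j hj h1)).2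
    have h4 := sq_le_sq' (abs_le.1 (hy.same i hi j hj h2)).1 (abs_le.1 (hy.same i hi j hj h2)).2
    norm_num at h3 h4 ⊢
    linarith
  · intro i hi j hj e he e' he'
    change (c (i * (5 * S.N) + e)).toNat = (c (j * (5 * S.N) + e')).toNat ↔
      S.keyA i e = S.keyA j e' ∧ S.keyB i e = S.keyB j e'
    have h1 := hc.eq_iff _ (hlt i hi e he) _ (hlt j hj e' he')
    rw [(hdig i e he).1, (hdig i e he).2, (hdig j e' he').1, (hdig j e' he').2] at h1
    rw [← h1]
    have h2 := hc.nonneg _ (hlt i hi e he)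
    have h3 := hc.nonneg _ (hlt j hj e' he')
    omega
  · intro i hi e he
    change (c (i * (5 * S.N) + e)).toNat < S.tot * (5 * S.N)
    have h2 := hc.nonneg _ (hlt i hi e he)
    have h3 := hc.lt _ (hlt i hi e he)
    omega

/-- The output is a solution that is nearly four times as good as any other. -/
def Solved (S : Inst) (s : State) : Prop :=
  ∃ l : List ℕ, l.Nodup ∧ s.realArr 4 = l.map S.px ∧ s.realArr 5 = l.map S.py ∧
    S.Dominates l.toFinset ∧ ∀ D, S.Dominates D → S.N * l.length ≤ 4 * (D.card * (S.N + 12 * S.R))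

theorem KeyMem.main_runs {S : Inst} {s : State} (h : KeyMem S s) {c : ℕ → ℤ}
    (h4 : s.intArr 4 = tab (S.tot * (5 * S.N)) c) (hc : IsNumbering S c) (hN : 2 * S.R ≤ S.N)
    (hR : S.R = 401) (hx : IsGrid S.tot S.px S.cx) (hy : IsGrid S.tot S.py S.cy)
    (hsub : ∀ q < S.n', ∃ i < S.n, S.px i = S.px (S.n + q) ∧ S.py i = S.py (S.n + q))
    (hi : ∀ a, 5 ≤ a → a ≤ 8 → s.intArr a = []) (hr4 : s.realArr 4 = []) (hr5 : s.realArr 5 = []) :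
    Runs (mainProg S.N S.R) s (mainCost S.N S.R * (S.tot + 1)) (Solved S) :=
  mainProg_runs (hc.valid hN hR hx hy hsub) (h.ready h4 hc) hi hr4 hr5

/-- The input has been loaded and the working memory is empty. -/
structure Loaded (S : Inst) (s : State) : Prop where
  R_eq : S.R = 401
  R_le : 2 * S.R ≤ S.N
  sub : ∀ q < S.n', ∃ i < S.n, S.px i = S.px (S.n + q) ∧ S.py i = S.py (S.n + q)
  xs : s.realArr 0 = tab S.n S.px
  ys : s.realArr 1 = tab S.n S.py
  xs' : s.realArr 2 = tab S.n' fun q => S.px (S.n + q)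
  ys' : s.realArr 3 = tab S.n' fun q => S.py (S.n + q)
  intArr : ∀ a, s.intArr a = []
  realArr : ∀ a, 4 ≤ a → s.realArr a = []
  hash : ∀ a, s.hash a = fun _ => 0

/-- The algorithm with floor and hashing. -/
noncomputable def hashAlg (N : ℕ) : Prog :=
  .seq joinProg <| .seq floorGridProg <|
  .seq (keyProg N 401 fun e => .floor 1 (.div (.ofInt e) (.const N))) <|
  .seq hashIdProg (mainProg N 401)

/-- Running time of the algorithm with floor and hashing, per point. -/
noncomputable def hashAlgCost (N : ℕ) : ℕ :=
  30 + (30 + (((keyBody N 401 fun e => .floor 1 (.div (.ofInt e) (.const N))).costBound + 9) +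
    ((5 * N + 1) * 50 + mainCost N 401)))

theorem hashAlg_runs {S : Inst} {s : State} (h : Loaded S s) :
    Runs (hashAlg S.N) s (hashAlgCost S.N * (S.tot + 1)) (Solved S) := by
  have e : hashAlgCost S.N * (S.tot + 1) = 30 * (S.tot + 1) + (30 * (S.tot + 1) +
      (((keyBody S.N 401 fun e => .floor 1 (.div (.ofInt e) (.const S.N))).costBound + 9) *
        (S.tot + 1) + ((5 * S.N + 1) * 50 * (S.tot + 1) + mainCost S.N 401 * (S.tot + 1)))) := by
    unfold hashAlgCost; ring
  rw [e, hashAlg, ← h.R_eq]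
  refine Runs.seq ((joinProg_runs S h.xs h.ys h.xs' h.ys').mono le_rfl fun s₁ a₁ hP => ?_)
  have i₁ : ∀ a, s₁.intArr a = [] := fun a => by
    rw [a₁.iarr a, h.intArr]; intro h; simpa using joinProg_mod h
  refine Runs.seq ((floorGridProg_runs hP (i₁ 0) (i₁ 1)).mono le_rfl ?_)
  rintro s₂ a₂ ⟨hcx, hcy⟩
  have i₂ : ∀ a, 2 ≤ a → s₂.intArr a = [] := fun a ha => by
    rw [a₂.iarr a, i₁]; intro h; have := floorGridProg_mod h; simp at this; omega
  have hP₂ : PointMem S s₂ := by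
    refine hP.of_agree a₂ ?_ ?_ ?_ ?_ <;> (intro h; simpa using floorGridProg_mod h)
  -- Columns and rows of `S` are placeholders until they have been computed; from here on the
  -- instance carries the true ones.
  obtain ⟨S₁, hS₁⟩ : ∃ S₁ : Inst, S₁ = { S with
    cx := fun i => ⌊S.px i * 200⌋, cy := fun i => ⌊S.py i * 200⌋ } := ⟨_, rfl⟩
  have hdv := divides_floor (N := S.N) []
  have rk := keyProg_runs (S := S₁) (s := s₂) (by rw [hS₁]; exact hdv)
    (fun _ _ _ _ => trivial) (fun _ _ _ _ => trivial) (by rw [hS₁]; exact ⟨hP₂.1, hP₂.2, hP₂.3, hP₂.4⟩)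
    (i₂ 9 (by norm_num)) (by rw [hS₁]; exact hcx) (by rw [hS₁]; exact hcy) (i₂ 2 (by norm_num))
    (i₂ 3 (by norm_num))
  have eN : S₁.N = S.N := by rw [hS₁]
  have eR : S₁.R = S.R := by rw [hS₁]
  have et : S₁.tot = S.tot := by rw [hS₁]; rfl
  rw [eN, eR, et] at rk
  refine Runs.seq (rk.mono le_rfl ?_)
  intro s₃ a₃ hK
  have i₃ : ∀ a, 4 ≤ a → s₃.intArr a = [] := fun a ha => by
    rw [a₃.iarr a, i₂ a (by omega)]; intro h; have := keyProg_mod hdv h; simp at this; omega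
  have hh₃ : s₃.hash 0 = fun _ => 0 := by
    rw [a₃.table 0, a₂.table 0, a₁.table 0, h.hash]
    · intro h; simpa using joinProg_mod h
    · intro h; simpa using floorGridProg_mod h
    · intro h; simpa using keyProg_mod hdv h
  have ri := hashIdProg_runs hK (i₃ 4 le_rfl) hh₃
  rw [eN, et] at ri
  refine Runs.seq (ri.mono le_rfl ?_)
  rintro s₄ a₄ ⟨c, h4, hc⟩
  have i₄ : ∀ a, 5 ≤ a → a ≤ 8 → s₄.intArr a = [] := fun a ha _ => by
    rw [a₄.iarr a, i₃ a (by omega)]; intro h; have := hashIdProg_mod h; simp at this; omega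
  have r₄ : ∀ a, 4 ≤ a → s₄.realArr a = [] := fun a ha => by
    rw [a₄.rarr a, a₃.rarr a, a₂.rarr a, a₁.rarr a, h.realArr a ha]
    · intro h; have := joinProg_mod h; simp at this; omega
    · intro h; simpa using floorGridProg_mod h
    · intro h; simpa using keyProg_mod hdv h
    · intro h; simpa using hashIdProg_mod h
  have hK₄ : KeyMem S₁ s₄ := by
    refine ⟨hK.points.of_agree a₄ ?_ ?_ ?_ ?_, (a₄.iarr _ ?_).trans hK.cx,
      (a₄.iarr _ ?_).trans hK.cy, (a₄.iarr _ ?_).trans hK.keyA, (a₄.iarr _ ?_).trans hK.keyB⟩ <;>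
      (intro h; simpa using hashIdProg_mod h)
  have rm := hK₄.main_runs (by rw [eN, et]; exact h4) hc (by rw [eN, eR]; exact h.R_le)
    (eR.trans h.R_eq) (by rw [hS₁]; exact isGrid_floor _ _) (by rw [hS₁]; exact isGrid_floor _ _)
    (by rw [hS₁]; exact h.sub) i₄ (r₄ 4 le_rfl) (r₄ 5 (by norm_num))
  -- `Solved` involves only the points and the constants, not columns, rows or cell numbers, so the
  -- result for the enriched instance is the result for `S`.
  subst hS₁
  exact rm

/-- The algorithm without floor and hashing. -/
noncomputable def sortAlg (N : ℕ) : Prog :=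
  .seq joinProg <| .seq (compressProg 0 10 0 (1 / 200)) <| .seq (compressProg 1 11 1 (1 / 200)) <|
  .seq (divTableProg N (N + 2 * 401)) <| .seq (keyProg N 401 fun e => .setInt 1 (.get 9 e)) <|
  .seq sortIdProg (mainProg N 401)

/-- Running time of the algorithm without floor and hashing, for `k` points. -/
noncomputable def sortAlgCost (N k : ℕ) : ℕ :=
  30 * (k + 1) + (compressCost k + (compressCost k + ((k + (N + 2 * 401) + 1) * 40 +
    (((keyBody N 401 fun e => .setInt 1 (.get 9 e)).costBound + 9) * (k + 1) +
      (((5 * N + 1) * 20 * (k + 1) + compressCost (k * (5 * N))) + mainCost N 401 * (k + 1))))))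

theorem sortAlg_basic (N : ℕ) : (sortAlg N).Basic := by
  refine ⟨⟨trivial, ?_, trivial⟩, compressProg_basic _ _ _ _, compressProg_basic _ _ _ _,
    ⟨trivial, trivial, ?_⟩, ?_, ⟨?_, compressProg_basic _ _ _ _⟩, mainProg_basic _ _⟩
  · rw [forLoop_basic]; exact ⟨trivial, trivial⟩
  · rw [forLoop_basic]; exact ⟨trivial, trivial, ⟨trivial, trivial⟩, trivial⟩
  · rw [keyProg, forLoop_basic, keyBody, seqList_basic]
    intro p hp
    obtain ⟨e, -, rfl⟩ := List.mem_map.1 hp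
    exact ⟨trivial, trivial, trivial, trivial⟩
  · rw [forLoop_basic]; trivial

theorem sortAlg_runs {S : Inst} {s : State} (h : Loaded S s) :
    Runs (sortAlg S.N) s (sortAlgCost S.N S.tot) (Solved S) := by
  rw [sortAlg, sortAlgCost, ← h.R_eq]
  refine Runs.seq ((joinProg_runs S h.xs h.ys h.xs' h.ys').mono le_rfl fun s₁ a₁ hP => ?_)
  have i₁ : ∀ a, s₁.intArr a = [] := fun a => by
    rw [a₁.iarr a, h.intArr]; intro h; simpa using joinProg_mod h
  refine Runs.seq ((compressProg_runs (by norm_num) (by norm_num) (i₁ 10) (i₁ 0) hP.xs).mono le_rfl ?_)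
  rintro s₂ a₂ ⟨cx, hcx, hgx⟩
  have i₂ : ∀ a, 1 ≤ a → a < 10 ∨ 10 < a → s₂.intArr a = [] := fun a ha ha' => by
    rw [a₂.iarr a, i₁]; intro h; have := compressProg_mod h; simp at this; omega
  have hP₂ : PointMem S s₂ := by
    refine hP.of_agree a₂ ?_ ?_ ?_ ?_ <;> (intro h; have := compressProg_mod h; simp at this)
  refine Runs.seq ((compressProg_runs (by norm_num) (by norm_num) (i₂ 11 (by norm_num) (by norm_num))
    (i₂ 1 (by norm_num) (by norm_num)) hP₂.ys).mono le_rfl ?_)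
  rintro s₃ a₃ ⟨cy, hcy, hgy⟩
  have i₃ : ∀ a, 2 ≤ a → a < 10 ∨ 11 < a → s₃.intArr a = [] := fun a ha ha' => by
    rw [a₃.iarr a, i₂ a (by omega) (by omega)]
    intro h; have := compressProg_mod h; simp at this; omega
  have hP₃ : PointMem S s₃ := by
    refine hP₂.of_agree a₃ ?_ ?_ ?_ ?_ <;> (intro h; have := compressProg_mod h; simp at this)
  have hcx₃ : s₃.intArr 0 = tab S.tot cx := by
    rw [a₃.iarr 0, hcx]; intro h; have := compressProg_mod h; simp at this
  have hNpos : 0 < S.N := by have h1 := h.R_le; have h2 := h.R_eq; omega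
  refine Runs.seq ((divTableProg_runs hNpos (S.N + 2 * S.R) hP₃.tot
    (i₃ 9 (by norm_num) (by norm_num))).mono le_rfl ?_)
  intro s₄ a₄ h9
  have i₄ : ∀ a, 2 ≤ a → a < 9 ∨ 11 < a → s₄.intArr a = [] := fun a ha ha' => by
    rw [a₄.iarr a, i₃ a (by omega) (by omega)]
    intro h; have := divTableProg_mod h; simp at this; omega
  have hP₄ : PointMem S s₄ := by
    refine hP₃.of_agree a₄ ?_ ?_ ?_ ?_ <;> (intro h; simpa using divTableProg_mod h)
  have hcx₄ : s₄.intArr 0 = tab S.tot cx := by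
    rw [a₄.iarr 0, hcx₃]; intro h; simpa using divTableProg_mod h
  have hcy₄ : s₄.intArr 1 = tab S.tot cy := by
    rw [a₄.iarr 1, hcy]; intro h; simpa using divTableProg_mod h
  obtain ⟨S₁, hS₁⟩ : ∃ S₁ : Inst, S₁ = { S with cx := cx, cy := cy } := ⟨_, rfl⟩
  have eN : S₁.N = S.N := by rw [hS₁]
  have eR : S₁.R = S.R := by rw [hS₁]
  have et : S₁.tot = S.tot := by rw [hS₁]; rfl
  have ecx : S₁.cx = cx := by rw [hS₁]
  have ecy : S₁.cy = cy := by rw [hS₁]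
  have hdv := divides_table S.N (S.tot + (S.N + 2 * S.R))
  have rk := keyProg_runs (S := S₁) (s := s₄) (by rw [eN]; exact hdv)
    (by
      rw [et, eN, eR, ecx]
      intro i hi k hk
      have h1 := hgx.nonneg i hi
      have h2 := hgx.lt i hi
      push_cast
      omega)
    (by
      rw [et, eN, eR, ecy]
      intro i hi k hk
      have h1 := hgy.nonneg i hi
      have h2 := hgy.lt i hi
      push_cast
      omega)
    (by rw [hS₁]; exact ⟨hP₄.1, hP₄.2, hP₄.3, hP₄.4⟩)
    h9 (by rw [et, ecx]; exact hcx₄) (by rw [et, ecy]; exact hcy₄)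
    (i₄ 2 (by norm_num) (by norm_num)) (i₄ 3 (by norm_num) (by norm_num))
  rw [eN, eR, et] at rk
  refine Runs.seq (rk.mono le_rfl ?_)
  intro s₅ a₅ hK
  have i₅ : ∀ a, 4 ≤ a → a < 9 ∨ 11 < a → s₅.intArr a = [] := fun a ha ha' => by
    rw [a₅.iarr a, i₄ a (by omega) ha']; intro h; have := keyProg_mod hdv h; simp at this; omega
  have r₅ : ∀ a, 4 ≤ a → s₅.realArr a = [] := fun a ha => by
    rw [a₅.rarr a, a₄.rarr a, a₃.rarr a, a₂.rarr a, a₁.rarr a, h.realArr a ha]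
    · intro h; have := joinProg_mod h; simp at this; omega
    · intro h; have := compressProg_mod h; simp at this
    · intro h; have := compressProg_mod h; simp at this
    · intro h; simpa using divTableProg_mod h
    · intro h; simpa using keyProg_mod hdv h
  have h9₅ : (s₅.intArr 9).length = S.tot + (S.N + 2 * S.R) := by
    rw [a₅.iarr 9, h9, tab_length]; intro h; simpa using keyProg_mod hdv h
  have ri := sortIdProg_runs hK h9₅
    (by
      rw [et, eN]
      intro i hi e he
      have h1 := hgy.nonneg i hi
      have h2 := hgy.lt i hi
      have h3 := offY_le S.R (e % 5)
      have hpos : (0 : ℤ) < S.N := by exact_mod_cast hNpos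
      unfold Inst.keyB
      rw [ecy, eN, eR]
      -- A quotient is at most its dividend, which is less than the length of the quotient table;
      -- this length is therefore a valid radix for the encoding of the keys.
      refine ⟨Int.ediv_nonneg (by omega) hpos.le, ?_⟩
      refine lt_of_le_of_lt (Int.ediv_le_self _ (by omega)) ?_
      push_cast
      omega)
    (i₅ 4 le_rfl (by norm_num)) (i₅ 12 (by norm_num) (by norm_num)) (r₅ 6 (by norm_num))
  rw [eN, et] at ri
  refine Runs.seq (ri.mono le_rfl ?_)
  rintro s₆ a₆ ⟨c, h4, hc⟩
  have i₆ : ∀ a, 5 ≤ a → a ≤ 8 → s₆.intArr a = [] := fun a ha ha' => by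
    rw [a₆.iarr a, i₅ a (by omega) (by omega)]
    intro h; have := sortIdProg_mod h; simp at this; omega
  have r₆ : ∀ a, 4 ≤ a → a ≤ 5 → s₆.realArr a = [] := fun a ha ha' => by
    rw [a₆.rarr a, r₅ a ha]; intro h; have := sortIdProg_mod h; simp at this; omega
  have hK₆ : KeyMem S₁ s₆ := by
    refine ⟨hK.points.of_agree a₆ ?_ ?_ ?_ ?_, (a₆.iarr _ ?_).trans hK.cx,
      (a₆.iarr _ ?_).trans hK.cy, (a₆.iarr _ ?_).trans hK.keyA, (a₆.iarr _ ?_).trans hK.keyB⟩ <;>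
      (intro h; have := sortIdProg_mod h; simp at this)
  have rm := hK₆.main_runs (by rw [eN, et]; exact h4) hc (by rw [eN, eR]; exact h.R_le)
    (eR.trans h.R_eq) (by rw [hS₁]; exact IsCells.isGrid hgx) (by rw [hS₁]; exact IsCells.isGrid hgy)
    (by rw [hS₁]; exact h.sub) i₆ (r₆ 4 le_rfl (by norm_num)) (r₆ 5 (by norm_num) le_rfl)
  subst hS₁
  exact rm

/-! ### From indices to points -/

/-- The points of two lists, by index. -/
noncomputable def point (L L' : List Plane) (i : ℕ) : Plane := (L ++ L').getD i 0

/-- The instance given by two lists of points. -/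
noncomputable def instOf (N : ℕ) (L L' : List Plane) : Inst where
  N := N
  R := 401
  n := L.length
  n' := L'.length
  px := fun i => point L L' i 0
  py := fun i => point L L' i 1
  cx := fun _ => 0
  cy := fun _ => 0
  id := fun _ _ => 0

theorem point_left {L L' : List Plane} {i : ℕ} (hi : i < L.length) : point L L' i = L[i] := by
  simp [point, List.getElem?_append_left hi, hi]

theorem point_right {L L' : List Plane} {q : ℕ} (hq : q < L'.length) :
    point L L' (L.length + q) = L'[q] := by
  simp [point, hq]

theorem xs_eq_tab (L L' : List Plane) : xs L = tab L.length fun i => point L L' i 0 := by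
  apply List.ext_getElem
  · simp [xs]
  · intro i h1 h2
    have hi : i < L.length := by simpa [xs] using h1
    simp [xs, tab, point_left hi]

theorem ys_eq_tab (L L' : List Plane) : ys L = tab L.length fun i => point L L' i 1 := by
  apply List.ext_getElem
  · simp [ys]
  · intro i h1 h2
    have hi : i < L.length := by simpa [ys] using h1
    simp [ys, tab, point_left hi]

theorem xs_eq_tab' (L L' : List Plane) :
    xs L' = tab L'.length fun q => point L L' (L.length + q) 0 := by
  apply List.ext_getElem
  · simp [xs]
  · intro i h1 h2
    have hi : i < L'.length := by simpa [xs] using h1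
    simp [xs, tab, point_right hi]

theorem ys_eq_tab' (L L' : List Plane) :
    ys L' = tab L'.length fun q => point L L' (L.length + q) 1 := by
  apply List.ext_getElem
  · simp [ys]
  · intro i h1 h2
    have hi : i < L'.length := by simpa [ys] using h1
    simp [ys, tab, point_right hi]

theorem dist_le_two_iff (p q : Plane) : dist p q ≤ 2 ↔ (p 0 - q 0) ^ 2 + (p 1 - q 1) ^ 2 ≤ 4 := by
  rw [EuclideanSpace.dist_eq, Fin.sum_univ_two, Real.dist_eq, Real.dist_eq, sq_abs, sq_abs,
    Real.sqrt_le_left (by norm_num)]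
  norm_num

theorem Lists.length_eq {L : List Plane} {P : Finset Plane} (h : Lists L P) : L.length = P.card := by
  classical
  have : L.toFinset = P := by ext p; simp [h.2 p]
  rw [← this, List.toFinset_card_of_nodup h.1]

theorem point_mem {L L' : List Plane} {P : Finset Plane} (h : Lists L P) {i : ℕ}
    (hi : i < L.length) : point L L' i ∈ P := by
  rw [point_left hi, ← h.2]
  exact List.getElem_mem hi

theorem exists_point {L L' : List Plane} {P : Finset Plane} (h : Lists L P) {p : Plane}
    (hp : p ∈ P) : ∃ i < L.length, point L L' i = p := by
  obtain ⟨i, hi, he⟩ := List.getElem_of_mem ((h.2 p).2 hp)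
  exact ⟨i, hi, (point_left hi).trans he⟩

theorem point_inj {L L' : List Plane} (h : L.Nodup) {i j : ℕ} (hi : i < L.length)
    (hj : j < L.length) (he : point L L' i = point L L' j) : i = j := by
  rw [point_left hi, point_left hj] at he
  exact (h.getElem_inj_iff).1 he

theorem instOf_sub {N : ℕ} {P P' : Finset Plane} (hPP : P' ⊆ P) {L L' : List Plane}
    (hL : Lists L P) (hL' : Lists L' P') : ∀ q < (instOf N L L').n', ∃ i < (instOf N L L').n,
      (instOf N L L').px i = (instOf N L L').px ((instOf N L L').n + q) ∧
      (instOf N L L').py i = (instOf N L L').py ((instOf N L L').n + q) := by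
  intro q hq
  change q < L'.length at hq
  have hm : L'[q] ∈ P := hPP ((hL'.2 _).1 (List.getElem_mem hq))
  obtain ⟨i, hi, he⟩ := exists_point (L' := L') hL hm
  rw [← point_right (L := L) hq] at he
  refine ⟨i, hi, ?_, ?_⟩
  · change point L L' i 0 = point L L' (L.length + q) 0
    rw [he]
  · change point L L' i 1 = point L L' (L.length + q) 1
    rw [he]

theorem instOf_sqd {N : ℕ} {L L' : List Plane} {i j : ℕ} :
    (instOf N L L').sqd i j ≤ 4 ↔ dist (point L L' i) (point L L' j) ≤ 2 := by
  rw [dist_le_two_iff]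
  rfl

/-- Indices and points correspond because the list of `P` has no repetition. The guarantee `4 (1 +
12 R / N)` becomes `4 + 48 * 401 / N`, which is at most `4 + ε`. -/
theorem Solved.approx {N : ℕ} {ε : ℝ} (hN : 0 < N) (hε : 48 * 401 ≤ ε * N) {P P' : Finset Plane}
    {L L' : List Plane} (hL : Lists L P) (hL' : Lists L' P') {s : State}
    (h : Solved (instOf N L L') s) :
    ∃ D : Finset Plane, Outputs s D ∧ IsPDSApprox (4 + ε) P P' D := by
  classical
  obtain ⟨l, hl, h4, h5, hdom, hbest⟩ := h
  have hlt : ∀ i ∈ l, i < L.length := fun i hi =>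
    Finset.mem_range.1 (hdom.1 (List.mem_toFinset.2 hi))
  have hnd : (l.map (point L L')).Nodup :=
    hl.map_on fun i hi j hj he => point_inj hL.1 (hlt i hi) (hlt j hj) he
  refine ⟨(l.map (point L L')).toFinset, ⟨l.map (point L L'), ⟨hnd, fun p => by simp⟩, ?_, ?_⟩,
    ⟨?_, ?_⟩, ?_⟩
  · rw [h4]; simp [xs, instOf]
  · rw [h5]; simp [ys, instOf]
  · intro p hp
    obtain ⟨i, hi, rfl⟩ := List.mem_map.1 (List.mem_toFinset.1 hp)
    exact point_mem hL (hlt i hi)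
  · intro q hq
    obtain ⟨k, hk, rfl⟩ := List.getElem_of_mem ((hL'.2 q).2 hq)
    obtain ⟨i, hi, hd⟩ := hdom.2 k hk
    refine ⟨point L L' i, List.mem_toFinset.2 (List.mem_map_of_mem (List.mem_toFinset.1 hi)), ?_⟩
    rw [← point_right (L := L) hk]
    exact instOf_sqd.1 hd
  · intro D' hD'
    -- The indices of the points of the competing solution.
    obtain ⟨D, hD⟩ : ∃ D, D = (Finset.range L.length).filter fun i => point L L' i ∈ D' := ⟨_, rfl⟩
    have hcard : D.card ≤ D'.card := by
      refine Finset.card_le_card_of_injOn (point L L') ?_ ?_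
      · intro i hi
        rw [hD] at hi
        exact (Finset.mem_filter.1 hi).2
      · intro i hi j hj he
        rw [hD] at hi hj
        exact point_inj hL.1 (Finset.mem_range.1 (Finset.mem_filter.1 hi).1)
          (Finset.mem_range.1 (Finset.mem_filter.1 hj).1) he
    have hDd : (instOf N L L').Dominates D := by
      refine ⟨?_, fun k hk => ?_⟩
      · rw [hD]; exact Finset.filter_subset _ _
      · change k < L'.length at hk
        obtain ⟨p, hp, hd⟩ := hD'.2 L'[k] ((hL'.2 _).1 (List.getElem_mem hk))
        obtain ⟨i, hi, rfl⟩ := exists_point (L' := L') hL (hD'.1 hp)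
        refine ⟨i, ?_, ?_⟩
        · rw [hD]; exact Finset.mem_filter.2 ⟨Finset.mem_range.2 hi, hp⟩
        · rw [instOf_sqd]
          change dist (point L L' i) (point L L' (L.length + k)) ≤ 2
          rwa [point_right hk]
    have hb : N * l.length ≤ 4 * (D.card * (N + 12 * 401)) := hbest D hDd
    rw [List.toFinset_card_of_nodup hnd, List.length_map]
    have hb' : (N : ℝ) * l.length ≤ 4 * (D'.card * (N + 12 * 401)) := by
      have : N * l.length ≤ 4 * (D'.card * (N + 12 * 401)) :=
        hb.trans (Nat.mul_le_mul_left _ (Nat.mul_le_mul_right _ hcard))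
      exact_mod_cast this
    have hNr : (0 : ℝ) < N := by exact_mod_cast hN
    have hc : (0 : ℝ) ≤ D'.card := Nat.cast_nonneg _
    have h1 := mul_le_mul_of_nonneg_left hε hc
    refine le_of_mul_le_mul_left ?_ hNr
    calc (N : ℝ) * l.length ≤ 4 * (D'.card * (N + 12 * 401)) := hb'
      _ = 4 * D'.card * N + D'.card * (48 * 401) := by ring
      _ ≤ 4 * D'.card * N + D'.card * (ε * N) := by linarith
      _ = N * ((4 + ε) * D'.card) := by ring

/-! ### The partial dominating set problem -/

/-- From every state in which the coordinates of `P` and `P'` are loaded, the program computes an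
`α`-approximation in `T |P|` steps. -/
def Solves (A : Prog) (α : ℝ) (T : ℕ → ℕ) : Prop :=
  ∀ (P P' : Finset Plane), P' ⊆ P → ∀ (L L' : List Plane), Lists L P → Lists L' P' → ∀ s : State,
    s.realArr 0 = xs L → s.realArr 1 = ys L → s.realArr 2 = xs L' → s.realArr 3 = ys L' →
    (∀ a, s.intArr a = []) → (∀ a, 4 ≤ a → s.realArr a = []) → (∀ a, s.hash a = fun _ => 0) →
    Runs A s (T P.card) fun s' => ∃ D : Finset Plane, Outputs s' D ∧ IsPDSApprox α P P' D

theorem loaded_instOf {N : ℕ} (hN : 2 * 401 ≤ N) {P P' : Finset Plane} (hPP : P' ⊆ P)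
    {L L' : List Plane} (hL : Lists L P) (hL' : Lists L' P') {s : State}
    (h0 : s.realArr 0 = xs L) (h1 : s.realArr 1 = ys L) (h2 : s.realArr 2 = xs L')
    (h3 : s.realArr 3 = ys L') (hi : ∀ a, s.intArr a = []) (hr : ∀ a, 4 ≤ a → s.realArr a = [])
    (hh : ∀ a, s.hash a = fun _ => 0) : Loaded (instOf N L L') s :=
  ⟨rfl, hN, instOf_sub hPP hL hL', h0.trans (xs_eq_tab L L'), h1.trans (ys_eq_tab L L'),
    h2.trans (xs_eq_tab' L L'), h3.trans (ys_eq_tab' L L'), hi, hr, hh⟩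

theorem tot_instOf_le {N : ℕ} {P P' : Finset Plane} (hPP : P' ⊆ P) {L L' : List Plane}
    (hL : Lists L P) (hL' : Lists L' P') : (instOf N L L').tot ≤ 2 * P.card := by
  change L.length + L'.length ≤ 2 * P.card
  rw [hL.length_eq, hL'.length_eq]
  have := Finset.card_le_card hPP
  omega

theorem hashAlg_solves {N : ℕ} {ε : ℝ} (hN : 2 * 401 ≤ N) (hε : 48 * 401 ≤ ε * N) :
    Solves (hashAlg N) (4 + ε) fun n => hashAlgCost N * (2 * n + 1) := by
  intro P P' hPP L L' hL hL' s h0 h1 h2 h3 hi hr hh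
  refine (hashAlg_runs (loaded_instOf hN hPP hL hL' h0 h1 h2 h3 hi hr hh)).mono ?_ ?_
  · have := tot_instOf_le (N := N) hPP hL hL'
    exact Nat.mul_le_mul_left _ (by omega)
  · exact fun s' _ h => h.approx (by omega) hε hL hL'

theorem compressCost_mono {k m : ℕ} (h : k ≤ m) : compressCost k ≤ compressCost m := by
  have := Nat.clog_mono_right 2 h
  unfold compressCost sortCost passCost
  gcongr

/-- Monotonicity is needed since the number of list entries is only known to be at most `2 |P|`. -/
theorem sortAlgCost_mono {N k m : ℕ} (h : k ≤ m) : sortAlgCost N k ≤ sortAlgCost N m := by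
  have h1 := compressCost_mono h
  have h2 := compressCost_mono (Nat.mul_le_mul_right (5 * N) h)
  unfold sortAlgCost
  gcongr

theorem sortAlg_solves {N : ℕ} {ε : ℝ} (hN : 2 * 401 ≤ N) (hε : 48 * 401 ≤ ε * N) :
    Solves (sortAlg N) (4 + ε) fun n => sortAlgCost N (2 * n) := by
  intro P P' hPP L L' hL hL' s h0 h1 h2 h3 hi hr hh
  refine (sortAlg_runs (loaded_instOf hN hPP hL hL' h0 h1 h2 h3 hi hr hh)).mono ?_ ?_
  · exact sortAlgCost_mono (tot_instOf_le hPP hL hL')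
  · exact fun s' _ h => h.approx (by omega) hε hL hL'

theorem Solves.approximatesPDS {A : Prog} {α : ℝ} {T : ℕ → ℕ} (h : Solves A α T) :
    ApproximatesPDS A α T := by
  intro P P' hPP L L' hL hL'
  obtain ⟨s, t, hE, ht, hD⟩ := h P P' hPP L L' hL hL' (init [xs L, ys L, xs L', ys L']) rfl rfl rfl
    rfl (fun _ => rfl) (fun a ha => by
      change [xs L, ys L, xs L', ys L'].getD a [] = []
      rw [List.getD_eq_default]; simpa using ha) (fun _ => rfl)
  exact ⟨s, t, hE, ht, hD⟩

/-! ### The dominating set problem -/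

/-- Copy `P` to `P'`. -/
def copyProg : Prog :=
  forLoop 0 (.lenReal 0) (.seq (.pushReal 2 (.get 0 (.reg 0))) (.pushReal 3 (.get 1 (.reg 0))))

theorem copyProg_runs (L : List Plane) :
    Runs copyProg (init [xs L, ys L]) (15 * (L.length + 1)) (fun s => s.realArr 0 = xs L ∧
      s.realArr 1 = ys L ∧ s.realArr 2 = xs L ∧ s.realArr 3 = ys L) := by
  have hx := xs_eq_tab L []
  have hy := ys_eq_tab L []
  refine Runs.mono (Runs.forLoop L.length 6 (fun i s => s.realArr 0 = xs L ∧ s.realArr 1 = ys L ∧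
    s.realArr 2 = (tab i fun i => point L [] i 0) ∧
    s.realArr 3 = (tab i fun i => point L [] i 1)) ?_ ?_ ?_ ?_) ?_ ?_
  · exact ⟨rfl, rfl, rfl, rfl⟩
  · simp [Prog.Mod]
  · rintro i - s - ⟨h, -⟩
    simp [IExpr.eval, h, xs]
  · rintro i hi s - hi0 ⟨h0, h1, h2, h3⟩
    refine Prog.LoopFree.runs_of_wp (p := .seq (.pushReal 2 (.get 0 (.reg 0)))
      (.pushReal 3 (.get 1 (.reg 0)))) ⟨trivial, trivial⟩ ?_
    rw [wp_seq, wp_pushReal, wp_pushReal]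
    refine ⟨by simpa using h0, by simpa using h1, ?_, ?_⟩
    · rw [hx] at h0
      simp [RExpr.eval, IExpr.eval, h0, h2, hi0, readAt_tab rfl hi, tab_succ]
    · rw [hy] at h1
      simp [RExpr.eval, IExpr.eval, h1, h3, hi0, readAt_tab rfl hi, tab_succ]
  · simp only [IExpr.cost]; rw [mul_comm]
  · rintro s - ⟨h0, h1, h2, h3⟩
    exact ⟨h0, h1, h2.trans hx.symm, h3.trans hy.symm⟩

theorem copyProg_mod {l : Loc} (h : copyProg.Mod l) :
    l = .ireg 0 ∨ l = .rarr 2 ∨ l = .rarr 3 := by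
  simp only [copyProg, Prog.Mod, forLoop_mod] at h
  exact h

/-- For `P' = P` a point of the set dominates itself at distance zero, and any other point needs a
neighbor in the set; so feasible solutions and dominating sets of the graph are the same. -/
theorem IsPDSApprox.isDSApprox {α : ℝ} {P D : Finset Plane} (h : IsPDSApprox α P P D) :
    ∃ D₀ : Finset P, D₀.map (Function.Embedding.subtype _) = D ∧ IsDSApprox α P D₀ := by
  classical
  have hmap : (D.subtype (· ∈ P)).map (Function.Embedding.subtype _) = D :=
    Finset.subtype_map_of_mem h.1.1
  refine ⟨D.subtype (· ∈ P), hmap, ?_, ?_⟩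
  · intro v hv
    obtain ⟨p, hp, hd⟩ := h.1.2 v v.2
    refine ⟨⟨p, h.1.1 hp⟩, Finset.mem_subtype.2 hp, ?_, by rw [dist_comm]; exact hd⟩
    rintro rfl
    exact hv (Finset.mem_subtype.2 hp)
  · intro D' hD'
    have h1 := h.2 (D'.map (Function.Embedding.subtype _)) ⟨?_, ?_⟩
    · rw [Finset.card_map] at h1
      rwa [← Finset.card_map (Function.Embedding.subtype (· ∈ P)), hmap]
    · intro p hp
      obtain ⟨v, -, rfl⟩ := Finset.mem_map.1 hp
      exact v.2
    · intro q hq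
      by_cases hqD : (⟨q, hq⟩ : P) ∈ D'
      · exact ⟨q, Finset.mem_map.2 ⟨⟨q, hq⟩, hqD, rfl⟩, by simp⟩
      · obtain ⟨u, hu, -, hd⟩ := hD' ⟨q, hq⟩ hqD
        exact ⟨u, Finset.mem_map.2 ⟨u, hu, rfl⟩, by rw [dist_comm]; exact hd⟩

/-- After the copying the memory is no longer an initial one, since a register has been used. This
is why `Solves` allows arbitrary register contents. -/
theorem Solves.approximatesDS {A : Prog} {α : ℝ} {T : ℕ → ℕ} (h : Solves A α T) :
    ApproximatesDS (.seq copyProg A) α fun n => T n + 15 * (n + 1) := by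
  intro P L hL
  obtain ⟨s, t, hE, ht, D, hO, hD⟩ := Runs.seq ((copyProg_runs L).mono le_rfl
    fun s hA ⟨h0, h1, h2, h3⟩ => h P P subset_rfl L L hL hL s h0 h1 h2 h3
      (fun a => (hA.iarr a fun h => by simpa using copyProg_mod h).trans rfl)
      (fun a ha => by
        rw [hA.rarr a fun h => by have := copyProg_mod h; simp at this; omega]
        change [xs L, ys L].getD a [] = []
        rw [List.getD_eq_default]; simp; omega)
      (fun a => (hA.table a fun h => by simpa using copyProg_mod h).trans rfl))
  obtain ⟨D₀, hmap, hD₀⟩ := hD.isDSApprox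
  refine ⟨s, t, hE, ?_, D₀, by rwa [hmap], hD₀⟩
  rw [hL.length_eq] at ht
  exact ht.trans (add_comm _ _).le

/-! ### Running times -/

theorem isLinear_mul_add (A B : ℕ) : IsLinear fun n => A * (2 * n + 1) + B * (n + 1) := by
  refine Asymptotics.IsBigO.of_bound (3 * A + 2 * B) ?_
  filter_upwards [Filter.eventually_ge_atTop 1] with n hn
  have hn' : (1 : ℝ) ≤ n := by exact_mod_cast hn
  rw [Real.norm_of_nonneg (by positivity), Real.norm_of_nonneg (by positivity)]
  push_cast
  have hA : (0 : ℝ) ≤ A := by positivity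
  have hB : (0 : ℝ) ≤ B := by positivity
  nlinarith [mul_nonneg hA (sub_nonneg.2 hn'), mul_nonneg hB (sub_nonneg.2 hn')]

theorem compressCost_le : ∃ A, ∀ k, compressCost k ≤ A * ((k + 1) * (Nat.clog 2 k + 1)) := by
  obtain ⟨a, ha⟩ : ∃ a, a = refillProg.costBound + (emitProg 0 0).costBound + 9 := ⟨_, rfl⟩
  obtain ⟨b, hb⟩ : ∃ b, b = (scanBody 0 0 0 0).costBound + 9 := ⟨_, rfl⟩
  refine ⟨a + b + 52, fun k => ?_⟩
  unfold compressCost sortCost passCost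
  rw [← ha, ← hb]
  generalize Nat.clog 2 k = c
  nlinarith [Nat.zero_le (a * k * c), Nat.zero_le (a * c), Nat.zero_le (b * k * c),
    Nat.zero_le (b * c), Nat.zero_le (k * c)]

/-- The dominant term is the sorting of the `5 N k` encoded keys; everything else is at most a
constant times `k + 1`, or a sort of `k` reals. -/
theorem sortAlgCost_le (N : ℕ) (hN : 0 < N) :
    ∃ A, ∀ k, sortAlgCost N k ≤ A * ((k + 1) * (Nat.clog 2 (k * (5 * N)) + 1)) := by
  obtain ⟨A, hA⟩ := compressCost_le
  obtain ⟨a, ha⟩ : ∃ a, a = (keyBody N 401 fun e => .setInt 1 (.get 9 e)).costBound + 9 := ⟨_, rfl⟩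
  refine ⟨30 + 2 * A + (N + 2 * 401 + 1) * 40 + a + (5 * N + 1) * 20 + A * (5 * N + 1) +
    mainCost N 401, fun k => ?_⟩
  obtain ⟨X, hX⟩ : ∃ X, X = (k + 1) * (Nat.clog 2 (k * (5 * N)) + 1) := ⟨_, rfl⟩
  have hkX : k + 1 ≤ X := hX ▸ Nat.le_mul_of_pos_right _ (Nat.succ_pos _)
  have h1 : compressCost k ≤ A * X := by
    refine (hA k).trans (Nat.mul_le_mul_left _ ?_)
    rw [hX]
    have := Nat.clog_mono_right 2 (Nat.le_mul_of_pos_right k (by omega : 0 < 5 * N))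
    gcongr
  have h2 : compressCost (k * (5 * N)) ≤ A * (5 * N + 1) * X := by
    refine (hA _).trans ?_
    rw [mul_assoc, hX, ← mul_assoc (5 * N + 1)]
    refine Nat.mul_le_mul_left _ (Nat.mul_le_mul_right _ ?_)
    ring_nf; omega
  have h3 : (k + (N + 2 * 401) + 1) * 40 ≤ (N + 2 * 401 + 1) * 40 * X := by
    have : k + (N + 2 * 401) + 1 ≤ (N + 2 * 401 + 1) * (k + 1) := by ring_nf; omega
    calc _ ≤ (N + 2 * 401 + 1) * (k + 1) * 40 := Nat.mul_le_mul_right _ this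
      _ = (N + 2 * 401 + 1) * 40 * (k + 1) := by ring
      _ ≤ _ := Nat.mul_le_mul_left _ hkX
  unfold sortAlgCost
  rw [← hX, ← ha]
  have h4 := Nat.mul_le_mul_left 30 hkX
  have h5 := Nat.mul_le_mul_left a hkX
  have h6 := Nat.mul_le_mul_left ((5 * N + 1) * 20) hkX
  have h7 := Nat.mul_le_mul_left (mainCost N 401) hkX
  calc _ ≤ 30 * X + (A * X + (A * X + ((N + 2 * 401 + 1) * 40 * X + (a * X +
        (((5 * N + 1) * 20 * X + A * (5 * N + 1) * X) + mainCost N 401 * X))))) := by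
        gcongr
    _ = _ := by ring

/-- From `n ≥ 3 > e` on, `log n ≥ 1`, so additive constants can be absorbed into a multiple of `log
n`. -/
theorem clog_le_mul_log (m : ℕ) (hm : 0 < m) : ∃ B : ℝ, 0 ≤ B ∧ ∀ n : ℕ, 3 ≤ n →
    (Nat.clog 2 (n * m) + 1 : ℝ) ≤ B * Real.log n := by
  have hl2 : 0 < Real.log 2 := Real.log_pos (by norm_num)
  have hm' : (1 : ℝ) ≤ m := by exact_mod_cast hm
  have hlm : 0 ≤ Real.log m := Real.log_nonneg hm'
  refine ⟨Real.log m / Real.log 2 + 1 / Real.log 2 + 2, by positivity, fun n hn => ?_⟩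
  have hn' : (3 : ℝ) ≤ n := by exact_mod_cast hn
  have hlog : 1 ≤ Real.log n := by
    rw [Real.le_log_iff_exp_le (by linarith)]
    exact (Real.exp_one_lt_d9.le.trans (by norm_num)).trans hn'
  have h1 : (Nat.clog 2 (n * m) : ℝ) ≤ Real.logb 2 (n * m) + 1 := by
    have h := Real.natCeil_logb_natCast 2 (n * m)
    rw [← h]
    have h2 : (0 : ℝ) ≤ Real.logb (2 : ℕ) ((n * m : ℕ) : ℝ) := by
      refine Real.logb_nonneg (by norm_num) ?_
      push_cast; nlinarith
    have := (Nat.ceil_lt_add_one h2).le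
    push_cast at this ⊢
    exact this
  have h2 : Real.logb 2 (n * m) = Real.log n / Real.log 2 + Real.log m / Real.log 2 := by
    rw [Real.logb, Real.log_mul (by linarith) (by linarith), add_div]
  rw [h2] at h1
  have h3 : Real.log m / Real.log 2 ≤ Real.log m / Real.log 2 * Real.log n :=
    le_mul_of_one_le_right (by positivity) hlog
  calc (Nat.clog 2 (n * m) + 1 : ℝ)
      ≤ Real.log n / Real.log 2 + Real.log m / Real.log 2 + 2 := by linarith
    _ ≤ 1 / Real.log 2 * Real.log n + Real.log m / Real.log 2 * Real.log n + 2 * Real.log n := by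
        have : Real.log n / Real.log 2 = 1 / Real.log 2 * Real.log n := by ring
        linarith
    _ = _ := by ring

theorem isLinearithmic_sortAlgCost {N : ℕ} (hN : 0 < N) (B : ℕ) :
    IsLinearithmic fun n => sortAlgCost N (2 * n) + B * (n + 1) := by
  obtain ⟨A, hA⟩ := sortAlgCost_le N hN
  obtain ⟨C, hC, hlog⟩ := clog_le_mul_log (2 * (5 * N)) (by omega)
  refine Asymptotics.IsBigO.of_bound (3 * A * C + 2 * B) ?_
  filter_upwards [Filter.eventually_ge_atTop 3] with n hn
  have hn' : (3 : ℝ) ≤ n := by exact_mod_cast hn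
  have hl : 1 ≤ Real.log n := by
    rw [Real.le_log_iff_exp_le (by linarith)]
    exact (Real.exp_one_lt_d9.le.trans (by norm_num)).trans hn'
  rw [Real.norm_of_nonneg (by positivity), Real.norm_of_nonneg (by positivity)]
  have h1 : (sortAlgCost N (2 * n) : ℝ) ≤
      A * ((2 * n + 1) * (Nat.clog 2 (2 * n * (5 * N)) + 1)) := by
    exact_mod_cast hA (2 * n)
  have h2 := hlog n hn
  have e : n * (2 * (5 * N)) = 2 * n * (5 * N) := by ring
  rw [e] at h2
  have h3 : (2 * n + 1 : ℝ) ≤ 3 * n := by linarith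
  have h4 : (sortAlgCost N (2 * n) : ℝ) ≤ A * (3 * n * (C * Real.log n)) := by
    refine h1.trans ?_
    gcongr
  have h5 : (B * (n + 1) : ℝ) ≤ B * (2 * n * Real.log n) := by
    gcongr
    nlinarith
  push_cast
  calc (sortAlgCost N (2 * n) + B * (n + 1) : ℝ)
      ≤ A * (3 * n * (C * Real.log n)) + B * (2 * n * Real.log n) := add_le_add h4 h5
    _ = _ := by ring

theorem ApproximatesPDS.mono {A : Prog} {α : ℝ} {T T' : ℕ → ℕ} (h : ApproximatesPDS A α T)
    (hT : ∀ n, T n ≤ T' n) : ApproximatesPDS A α T' := by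
  intro P P' hPP L L' hL hL'
  obtain ⟨s, t, hE, ht, hD⟩ := h P P' hPP L L' hL hL'
  exact ⟨s, t, hE, ht.trans (hT _), hD⟩

end UnitDisk

theorem theorem4 (ε : ℝ) (hε : 0 < ε) :
    (∃ (A : RealRAM.Prog) (T : ℕ → ℕ),
      UnitDisk.IsLinear T ∧ UnitDisk.ApproximatesPDS A (4 + ε) T) ∧
    (∃ (A : RealRAM.Prog) (T : ℕ → ℕ),
      A.Basic ∧ UnitDisk.IsLinearithmic T ∧ UnitDisk.ApproximatesPDS A (4 + ε) T) ∧
    (∃ (A : RealRAM.Prog) (T : ℕ → ℕ),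
      UnitDisk.IsLinear T ∧ UnitDisk.ApproximatesDS A (4 + ε) T) ∧
    (∃ (A : RealRAM.Prog) (T : ℕ → ℕ),
      A.Basic ∧ UnitDisk.IsLinearithmic T ∧ UnitDisk.ApproximatesDS A (4 + ε) T) := by
  obtain ⟨N, hN, hNε⟩ : ∃ N : ℕ, 2 * 401 ≤ N ∧ 48 * 401 ≤ ε * N := by
    -- The first bound makes a coarse cell at least as wide as the square of copies, the second
    -- turns the loss `48 R / N` into at most `ε`.
    refine ⟨max (2 * 401) ⌈48 * 401 / ε⌉₊, le_max_left _ _, ?_⟩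
    have h1 : 48 * 401 / ε ≤ (max (2 * 401) ⌈48 * 401 / ε⌉₊ : ℕ) :=
      (Nat.le_ceil _).trans (by exact_mod_cast le_max_right _ _)
    rw [div_le_iff₀ hε] at h1
    linarith
  have hh := UnitDisk.hashAlg_solves hN hNε
  have hs := UnitDisk.sortAlg_solves hN hNε
  -- The summand `15 (n + 1)` pays for copying `P` in the dominating set problem; for the partial
  -- problem it is merely slack.
  have hlin := UnitDisk.isLinear_mul_add (UnitDisk.hashAlgCost N) 15
  have hlog := UnitDisk.isLinearithmic_sortAlgCost (N := N) (by omega) 15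
  have hcopy : UnitDisk.copyProg.Basic := by
    rw [UnitDisk.copyProg, RealRAM.forLoop_basic]
    exact ⟨trivial, trivial⟩
  exact ⟨⟨UnitDisk.hashAlg N, _, hlin, hh.approximatesPDS.mono fun n => Nat.le_add_right _ _⟩,
    ⟨UnitDisk.sortAlg N, _, UnitDisk.sortAlg_basic N, hlog,
      hs.approximatesPDS.mono fun n => Nat.le_add_right _ _⟩,
    ⟨.seq UnitDisk.copyProg (UnitDisk.hashAlg N), _, hlin, hh.approximatesDS⟩,
    ⟨.seq UnitDisk.copyProg (UnitDisk.sortAlg N), _, ⟨hcopy, UnitDisk.sortAlg_basic N⟩, hlog,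
      hs.approximatesDS⟩⟩
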